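/- **Setting.** Let $(\mathsf V,\mathsf E)$ be a finite oriented graph without loops; each edge $\mathsf e$ is identified with $[0,\ell_{\mathsf e}]$, $\ell_{\mathsf e}>0$ ($0$ is the initial, $\ell_{\mathsf e}$ the terminal endpoint), and carries functions with values in $\mathbb C^{k_{\mathsf e}}$, $k_{\mathsf e}\ge 1$. Let $\mathsf E_{\mathsf v}$ be the set of edges incident in $\mathsf v$, $k_{\mathsf v}=\sum_{\mathsf e\in \mathsf E_{\mathsf v}}k_{\mathsf e}$, $k=\sum_{\mathsf e}k_{\mathsf e}$, and let $\iota_{\mathsf v\mathsf e}$ be $+1$ if $\mathsf v$ is the terminal endpoint of $\mathsf e$, $-1$ if it is the initial one, and $0$ otherwise. For each $\mathsf e$ let $M_{\mathsf e},N_{\mathsf e},Q_{\mathsf e}:[0,\ell_{\mathsf e}]\to M_{k_{\mathsf e}}(\mathbb C)$, with $M_{\mathsf e}$ Lipschitz and $M_{\mathsf e}(x)$ invertible for every $x$, $N_{\mathsf e}\in L^\infty$, $Q_{\mathsf e}$ Lipschitz and uniformly positive definite, and $Q_{\mathsf e}(x)$, $Q_{\mathsf e}(x)M_{\mathsf e}(x)$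 Hermitian for every $x$. For each $\mathsf v$ let $Y^{(d)}_{\mathsf v}\subset Y_{\mathsf v}$ be subspaces of $\mathbb C^{k_{\mathsf v}}$, $B_{\mathsf v}:Y_{\mathsf v}\to Y_{\mathsf v}^{(d)}$ and $C_{\mathsf v}:Y^{(d)}_{\mathsf v}\to Y^{(d)}_{\mathsf v}$ linear, $Q_{\mathsf v}$ a Hermitian positive definite operator on $Y_{\mathsf v}^{(d)}$, and $P^{(d)}_{\mathsf v}$ the orthogonal projector of $\mathbb C^{k_{\mathsf v}}$ onto $Y^{(d)}_{\mathsf v}$. Put $\gamma_{\mathsf v}(u)=(u_{\mathsf e}(\mathsf v))_{\mathsf e\in\mathsf E_{\mathsf v}}$ and $T_{\mathsf v}=\operatorname{diag}(\iota_{\mathsf v\mathsf e}\,Q_{\mathsf e}(\mathsf v)M_{\mathsf e}(\mathsf v))_{\mathsf e\in\mathsf E_{\mathsf v}}$. All adjoints and orthogonal complements are Euclidean. On $\mathbf L^2_d=\bigoplus_{\mathsf e}L^2(0,\ell_{\mathsf e})^{k_{\mathsf e}}\oplus\bigoplus_{\mathsf v}Y^{(d)}_{\mathsf v}$ consider the operator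 $$\mathbb A(u,\mathsf x)=\big((M_{\mathsf e}u_{\mathsf e}'+N_{\mathsf e}u_{\mathsf e})_{\mathsf e},\ (B_{\mathsf v}\gamma_{\mathsf v}(u)+C_{\mathsf v}\mathsf x_{\mathsf v})_{\mathsf v}\big),$$ $$D(\mathbb A)=\Big\{(u,\mathsf x):\ u\in\bigoplus_{\mathsf e} H^1(0,\ell_{\mathsf e})^{k_{\mathsf e}},\ \gamma_{\mathsf v}(u)\in Y_{\mathsf v},\ \mathsf x_{\mathsf v}=P^{(d)}_{\mathsf v}\gamma_{\mathsf v}(u)\ \text{for all }\mathsf v\Big\}.$$ **Well-posedness assumptions.** Let $q_{\mathsf v}^{\mu}$ be the quadratic form associated with $T_{\mathsf v}+Q_{\mathsf v}B_{\mathsf v}+B_{\mathsf v}^*Q_{\mathsf v}-\mu P_{\mathsf v}^{(d)}Q_{\mathsf v}P_{\mathsf v}^{(d)}$. Let $\mathbb Y^*_{\mathsf v}$ be the set of all $(\xi,\mathsf y)\in\mathbb C^{k_{\mathsf v}}\oplus Y^{(d)}_{\mathsf v}$ such that the orthogonal projection of $T_{\mathsf v}\xi+B_{\mathsf v}^*Q_{\mathsf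 v}\mathsf y$ onto the orthogonal complement of $Y_{\mathsf v}^{(d)}$ in $Y_{\mathsf v}$ vanishes, and for $\kappa,\mu\ge 0$ let $r_{\mathsf v}^{\kappa,\mu}$ be the quadratic form on $\mathbb C^{k_{\mathsf v}}\oplus Y^{(d)}_{\mathsf v}$ associated with $$\begin{pmatrix}-T_{\mathsf v}-\kappa & T_{\mathsf v}\\ P^{(d)}_{\mathsf v}T_{\mathsf v} & (P^{(d)}_{\mathsf v}B_{\mathsf v}^*-\mu)Q_{\mathsf v}+Q_{\mathsf v}(B_{\mathsf v}-\mu)\end{pmatrix}.$$ * (W1) Take bases of $Y_{\mathsf v}^\perp$ and of $\operatorname{Ker}B_{\mathsf v}^*$, and the images under $B_{\mathsf v}^*$ of a basis of $\operatorname{Ran}B_{\mathsf v}$; the family of all these vectors, for all $\mathsf v\in\mathsf V$, extended by $0$ to $\mathbb C^k$, is a basis of $\mathbb C^k$ (this does not depend on the choice of the bases). Moreover, for each $\mathsf v$ there is $\mu\ge 0$ with $q^\mu_{\mathsf v}\le 0$ on $Y_{\mathsf v}$. * (W2) For each $\mathsf v$ there are $\mu,\mu'\ge 0$ with $q^\mu_{\mathsf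 v}\le 0$ on $Y^{(d)}_{\mathsf v}$ and $r_{\mathsf v}^{2\mu',\mu'}\le 0$ on $\mathbb Y_{\mathsf v}^*$. * (W2$'$) For each $\mathsf v$ there are $\mu,\mu'\ge 0$ with $q^\mu_{\mathsf v}\le 0$ on $Y_{\mathsf v}$ and $r_{\mathsf v}^{0,\mu'}\le 0$ on $\mathbb Y_{\mathsf v}^*$. (This implies (W2).) **Proposition.** For vectors, let $\xi^+$ be the entrywise projection $z\mapsto(\operatorname{Re} z)^+$ onto $\mathbb R_+$, and identify an operator from a subspace $W$ of $\mathbb C^{k_{\mathsf v}}$ into $Y_{\mathsf v}^{(d)}$ with the $k_{\mathsf v}\times k_{\mathsf v}$ matrix of its extension by $0$ to $W^\perp$. Suppose that for all $\mathsf e\in\mathsf E$, a.e. $x\in[0,\ell_{\mathsf e}]$ and all $\mathsf v\in\mathsf V$: * $N_{\mathsf e}(x),Q_{\mathsf e}(x),Q_{\mathsf v},B_{\mathsf v},C_{\mathsf v}$ are real, and $M_{\mathsf e}(x),Q_{\mathsf e}(x),Q_{\mathsf v}$ are diagonal; * the projector $\xi\mapsto\xi^+$ commutes with $P^{(d)}_{\mathsf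 v}$; * $\xi^+\in Y_{\mathsf v}$ for all $\xi\in Y_{\mathsf v}$, and $\mathsf y^+\in Y^{(d)}_{\mathsf v}$ for all $\mathsf y\in Y^{(d)}_{\mathsf v}$; * all off-diagonal entries of $N_{\mathsf e}(x)$ are nonnegative; and that * either all matrices $B_{\mathsf v}+C_{\mathsf v}P_{\mathsf v}^{(d)}$, $\mathsf v\in\mathsf V$, are (entrywise) positive, or $B_{\mathsf v}=0$ and all off-diagonal entries of $C_{\mathsf v}$ are nonnegative, for all $\mathsf v\in\mathsf V$. Then: 1. if (W1) or (W2$'$) holds, $\mathbb A$ generates a strongly continuous semigroup on $\mathbf L^2_d$; 2. if (W1) or (W2) holds, a strongly continuous semigroup generated by $\mathbb A$ is positive: it maps the cone of those $(u,\mathsf x)\in\mathbf L^2_d$ all of whose entries are real and nonnegative (a.e.) into itself. -/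

import Mathlib

open MeasureTheory Filter Topology
open scoped ContDiff NNReal

noncomputable section

/-! ### Strongly continuous semigroups -/

/-- A strongly continuous semigroup of bounded linear operators. -/
structure C0Semigroup (H : Type*) [NormedAddCommGroup H] [NormedSpace ℂ H] where
  op : ℝ≥0 → (H →L[ℂ] H)
  op_zero : op 0 = 1
  op_add : ∀ s t, op (s + t) = (op s).comp (op t)
  continuous_orbit : ∀ f, Continuous fun t => op t f

/-- The (possibly unbounded) operator with graph `A`, i.e. `A f g` means `f ∈ D(A)` and `A f = g`,
is the infinitesimal generator of the semigroup `T`. -/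
def C0Semigroup.IsGeneratedBy {H : Type*} [NormedAddCommGroup H] [NormedSpace ℂ H]
    (T : C0Semigroup H) (A : H → H → Prop) : Prop :=
  ∀ f g, A f g ↔
    Tendsto (fun t : ℝ≥0 => (((t : ℝ) : ℂ)⁻¹) • (T.op t f - f)) (𝓝[>] 0) (𝓝 g)

/-! ### Sobolev functions on an interval -/

/-- The space `L²(0,ℓ)^n`. -/
abbrev L2Interval (ℓ : ℝ) (n : ℕ) : Type :=
  Lp (EuclideanSpace ℂ (Fin n)) 2 (volume.restrict (Set.Ioo (0 : ℝ) ℓ))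

/-- `g ∈ L²(0,ℓ)^n` is the weak derivative of `u ∈ L²(0,ℓ)^n`; then `u ∈ H¹(0,ℓ)^n`. -/
def IsWeakDeriv {ℓ : ℝ} {n : ℕ} (u g : L2Interval ℓ n) : Prop :=
  ∀ φ : ℝ → ℝ, ContDiff ℝ ∞ φ → HasCompactSupport φ → tsupport φ ⊆ Set.Ioo 0 ℓ →
    ∫ x in Set.Ioo 0 ℓ, deriv φ x • u x = - ∫ x in Set.Ioo 0 ℓ, φ x • g x

/-- `w` is a representative of `u` that is continuous on `[0,ℓ]`; its end point values are the
traces of `u ∈ H¹(0,ℓ)^n`. -/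
def IsContinuousRep {ℓ : ℝ} {n : ℕ} (u : L2Interval ℓ n) (w : ℝ → EuclideanSpace ℂ (Fin n)) :
    Prop :=
  ContinuousOn w (Set.Icc 0 ℓ) ∧ ∀ᵐ x ∂(volume.restrict (Set.Ioo 0 ℓ)), u x = w x

/-! ### Networks -/

/-- A finite oriented graph without loops with vertex set `V` and edge set `E`; the edge `e` is
identified with `[0, ℓ e]`, the initial end point being `0` and the terminal one `ℓ e`, and carries
functions with `k e` components. -/
structure Network (V E : Type*) where
  init : E → V
  term : E → V
  loopless : ∀ e, init e ≠ term e
  k : E → ℕ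
  k_pos : ∀ e, 0 < k e
  ℓ : E → ℝ
  ℓ_pos : ∀ e, 0 < ℓ e

namespace Network

variable {V E : Type*} [Fintype V] [DecidableEq V] [Fintype E] [DecidableEq E]

/-- The set of edges incident in `v`. -/
abbrev Incident (G : Network V E) (v : V) : Type _ := {e : E // G.init e = v ∨ G.term e = v}

/-- The index set of `ℂ^{k_v}`. -/
abbrev VIdx (G : Network V E) (v : V) : Type _ := Σ e : G.Incident v, Fin (G.k e.1)

/-- The space `ℂ^{k_v}` with its Euclidean inner product. -/
abbrev VSpace (G : Network V E) (v : V) : Type _ := EuclideanSpace ℂ (G.VIdx v)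

/-- The entry `ι_{ve}` of the signed incidence matrix. -/
def incidence (G : Network V E) (v : V) (e : E) : ℂ :=
  (if G.term e = v then 1 else 0) - (if G.init e = v then 1 else 0)

/-- The coordinate, in `[0, ℓ e]`, of the end point `v` of `e`. -/
def coord (G : Network V E) (v : V) (e : E) : ℝ := if G.term e = v then G.ℓ e else 0

/-- The vector `(w_e(v))_{e ∈ E_v}` of the values at the vertex `v`. -/
def trace (G : Network V E) (w : ∀ e, ℝ → EuclideanSpace ℂ (Fin (G.k e))) (v : V) : G.VSpace v :=
  WithLp.toLp 2 fun p => w p.1.1 (G.coord v p.1.1) p.2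

/-- The extension of a vector in `ℂ^{k_v}` by zero to a vector in `ℂ^k`. -/
def extend (G : Network V E) (v : V) (ξ : G.VSpace v) : (Σ e : E, Fin (G.k e)) → ℂ :=
  fun p => if h : G.init p.1 = v ∨ G.term p.1 = v then ξ ⟨⟨p.1, h⟩, p.2⟩ else 0

/-- `ξ⁺`: the projection of `ξ` onto the positive cone `ℝ₊^{k_v}` (each entry `z` is replaced by
its projection `(Re z)⁺` onto `ℝ₊ ⊆ ℂ`). -/
def posPart (G : Network V E) {v : V} (ξ : G.VSpace v) : G.VSpace v :=
  WithLp.toLp 2 fun p => ((max (ξ p).re 0 : ℝ) : ℂ)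

/-- The coefficients of a hyperbolic system on a network and of its vertex conditions, with the
standing assumptions on them. -/
structure HypSystem (G : Network V E) where
  M : ∀ e, ℝ → Matrix (Fin (G.k e)) (Fin (G.k e)) ℂ
  N : ∀ e, ℝ → Matrix (Fin (G.k e)) (Fin (G.k e)) ℂ
  Q : ∀ e, ℝ → Matrix (Fin (G.k e)) (Fin (G.k e)) ℂ
  M_lipschitz : ∀ e, ∃ K : ℝ≥0, ∀ i j, LipschitzOnWith K (fun x => M e x i j) (Set.Icc 0 (G.ℓ e))
  M_invertible : ∀ e, ∀ x ∈ Set.Icc 0 (G.ℓ e), IsUnit (M e x)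
  N_bounded : ∀ e i j, MemLp (fun x => N e x i j) ⊤ (volume.restrict (Set.Icc 0 (G.ℓ e)))
  Q_lipschitz : ∀ e, ∃ K : ℝ≥0, ∀ i j, LipschitzOnWith K (fun x => Q e x i j) (Set.Icc 0 (G.ℓ e))
  Q_hermitian : ∀ e, ∀ x ∈ Set.Icc 0 (G.ℓ e), (Q e x).IsHermitian
  QM_hermitian : ∀ e, ∀ x ∈ Set.Icc 0 (G.ℓ e), (Q e x * M e x).IsHermitian
  Q_posDef : ∀ e, ∃ q > 0, ∀ x ∈ Set.Icc 0 (G.ℓ e), ∀ ξ : EuclideanSpace ℂ (Fin (G.k e)),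
    q * ‖ξ‖ ^ 2 ≤ (inner ℂ ξ (Matrix.toEuclideanLin (Q e x) ξ)).re
  Y : ∀ v, Submodule ℂ (G.VSpace v)
  Yd : ∀ v, Submodule ℂ (G.VSpace v)
  Yd_le : ∀ v, Yd v ≤ Y v
  B : ∀ v, Y v →ₗ[ℂ] Yd v
  C : ∀ v, Yd v →ₗ[ℂ] Yd v
  Qv : ∀ v, Yd v →ₗ[ℂ] Yd v
  Qv_symmetric : ∀ v, ∀ x y : Yd v, inner ℂ (Qv v x) y = inner ℂ x (Qv v y)
  Qv_posDef : ∀ v, ∀ x : Yd v, x ≠ 0 → 0 < (inner ℂ x (Qv v x)).re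

namespace HypSystem

variable {G : Network V E} (S : G.HypSystem)

/-- The orthogonal projector of `ℂ^{k_v}` onto `Y_v^{(d)}`. -/
def Pd (v : V) : G.VSpace v →ₗ[ℂ] S.Yd v := (S.Yd v).orthogonalProjectionOnto.toLinearMap

/-- The block diagonal matrix `T_v = diag (Q_e(v) M_e(v) ι_{ve})_{e ∈ E_v}`, as an operator. -/
def T (v : V) : G.VSpace v →ₗ[ℂ] G.VSpace v :=
  Matrix.toEuclideanLin (Matrix.blockDiagonal' fun e : G.Incident v =>
    G.incidence v e.1 • (S.Q e.1 (G.coord v e.1) * S.M e.1 (G.coord v e.1)))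

/-- The adjoint `B_v^* : Y_v^{(d)} → Y_v` with respect to the Euclidean inner products. -/
def Badj (v : V) : S.Yd v →ₗ[ℂ] S.Y v :=
  LinearMap.adjoint (𝕜 := ℂ) (E := S.Y v) (F := S.Yd v) (S.B v)

/-! #### The operator -/

/-- The Hilbert space `𝐋²_d = ⨁_e L²(0,ℓ_e)^{k_e} ⊕ ⨁_v Y_v^{(d)}`, with its canonical inner product
(which is equivalent to the one weighted by the `Q_e` and `Q_v`). -/
abbrev Space : Type _ :=
  WithLp 2 (PiLp 2 (fun e : E => L2Interval (G.ℓ e) (G.k e)) × PiLp 2 (fun v : V => S.Yd v))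

/-- The graph of the operator `𝔸 = (𝒜 0; ℬ 𝒞)`: `S.opGraph U F` means that `U = (u, x)` belongs to
`D(𝔸)`, that is, `u` is in `H¹`, `γ_v(u) ∈ Y_v` and `x_v = P_v^{(d)} γ_v(u)`, and that `F` is
`𝔸 U = (M u' + N u, B γ(u) + C x)`. -/
def opGraph (U F : S.Space) : Prop :=
  ∃ (g : ∀ e, L2Interval (G.ℓ e) (G.k e)) (w : ∀ e, ℝ → EuclideanSpace ℂ (Fin (G.k e)))
    (hY : ∀ v, G.trace w v ∈ S.Y v),
    (∀ e, IsWeakDeriv (U.fst e) (g e) ∧ IsContinuousRep (U.fst e) (w e)) ∧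
    (∀ v, U.snd v = S.Pd v (G.trace w v)) ∧
    (∀ e, ∀ᵐ x ∂(volume.restrict (Set.Ioo 0 (G.ℓ e))),
      F.fst e x = Matrix.toEuclideanLin (S.M e x) (g e x)
        + Matrix.toEuclideanLin (S.N e x) (U.fst e x)) ∧
    ∀ v, F.snd v = S.B v ⟨G.trace w v, hY v⟩ + S.C v (U.snd v)

/-- The cone `𝐋²_d(𝒢; ℝ₊)` of the elements of the space all of whose entries are real and
nonnegative. -/
def IsNonneg (U : S.Space) : Prop :=
  (∀ e, ∀ᵐ x ∂(volume.restrict (Set.Ioo 0 (G.ℓ e))),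
    ∀ i, (U.fst e x i).im = 0 ∧ 0 ≤ (U.fst e x i).re) ∧
  ∀ v i, ((U.snd v : G.VSpace v) i).im = 0 ∧ 0 ≤ ((U.snd v : G.VSpace v) i).re

/-- A semigroup on `𝐋²_d` is positive if it leaves the positive cone invariant. -/
def IsPositiveSemigroup (T : C0Semigroup S.Space) : Prop :=
  ∀ t U, S.IsNonneg U → S.IsNonneg (T.op t U)

/-! #### The well-posedness assumptions -/

/-- The value at `ξ ∈ Y_v` of the quadratic form associated with
`T_v + Q_v B_v + B_v^* Q_v - μ P_v^{(d)} Q_v P_v^{(d)}`. -/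
def vertexForm (v : V) (μ : ℝ) (ξ : S.Y v) : ℝ :=
  (inner ℂ (ξ : G.VSpace v)
    (S.T v ξ + (S.Qv v (S.B v ξ) : G.VSpace v) + (S.Badj v (S.Qv v (S.Pd v ξ)) : G.VSpace v)
      - (μ : ℂ) • (S.Qv v (S.Pd v ξ) : G.VSpace v))).re

/-- The basis property: with bases of `Y_v^⊥`, of `Ran B_v` (mapped to `Ran B_v^*` by `B_v^*`) and
of `Ker B_v^*`, the family of all these vectors of all vertices, extended by zero to `ℂ^k`, is a
basis of `ℂ^k`. (This does not depend on the choice of the bases.) -/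
def BasisProperty : Prop :=
  ∃ (b₁ : ∀ v, Module.Basis (Fin (Module.finrank ℂ (S.Y v)ᗮ)) ℂ (S.Y v)ᗮ)
    (b₂ : ∀ v, Module.Basis (Fin (Module.finrank ℂ (LinearMap.range (S.B v)))) ℂ
      (LinearMap.range (S.B v)))
    (b₃ : ∀ v, Module.Basis (Fin (Module.finrank ℂ (LinearMap.ker (S.Badj v)))) ℂ
      (LinearMap.ker (S.Badj v)))
    (b : Module.Basis
      (Σ v : V, (Fin (Module.finrank ℂ (S.Y v)ᗮ)
        ⊕ Fin (Module.finrank ℂ (LinearMap.range (S.B v))))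
        ⊕ Fin (Module.finrank ℂ (LinearMap.ker (S.Badj v))))
      ℂ ((Σ e : E, Fin (G.k e)) → ℂ)),
    ∀ v,
      (∀ i, b ⟨v, Sum.inl (Sum.inl i)⟩ = G.extend v (b₁ v i : G.VSpace v)) ∧
      (∀ j, b ⟨v, Sum.inl (Sum.inr j)⟩
        = G.extend v (S.Badj v (b₂ v j : S.Yd v) : G.VSpace v)) ∧
      ∀ l, b ⟨v, Sum.inr l⟩ = G.extend v ((b₃ v l : S.Yd v) : G.VSpace v)

/-- First well-posedness assumption: the basis property holds and each `Y_v` is a subspace of the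
nonpositive isotropic cone of the form of `T_v + Q_v B_v + B_v^* Q_v - μ P_v^{(d)} Q_v P_v^{(d)}`
for some `μ ≥ 0`. -/
def PrimalAssumption : Prop :=
  S.BasisProperty ∧ ∀ v, ∃ μ : ℝ, 0 ≤ μ ∧ ∀ ξ : S.Y v, S.vertexForm v μ ξ ≤ 0

/-- `(ξ, y) ∈ 𝕐_v^*`, the kernel of `(P_v^{(d),⊥} T_v,  P_v^{(d),⊥} B_v^* Q_v)`, where `P_v^{(d),⊥}`
is the orthogonal projector onto the orthogonal complement of `Y_v^{(d)}` in `Y_v`. -/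
def InYstar (v : V) (ξ : G.VSpace v) (y : S.Yd v) : Prop :=
  ((S.Yd v)ᗮ ⊓ S.Y v).orthogonalProjectionOnto
    (S.T v ξ + (S.Badj v (S.Qv v y) : G.VSpace v)) = 0

/-- The value at `(ξ, y)` of the quadratic form on `ℂ^{k_v} ⊕ Y_v^{(d)}` associated with
`(-T_v - κ, T_v; P_v^{(d)} T_v, (P_v^{(d)} B_v^* - μ) Q_v + Q_v (B_v - μ))`. -/
def adjointForm (v : V) (κ μ : ℝ) (ξ : G.VSpace v) (y : S.Yd v) : ℝ :=
  (inner ℂ ξ (- S.T v ξ - (κ : ℂ) • ξ + S.T v (y : G.VSpace v))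
    + inner ℂ y (S.Pd v (S.T v ξ)
      + (S.Pd v (S.Badj v (S.Qv v y) : G.VSpace v) - (μ : ℂ) • S.Qv v y)
      + S.Qv v (S.B v ⟨y, S.Yd_le v y.2⟩ - (μ : ℂ) • y))).re

/-- Second well-posedness assumption, in its weak form: for each `v`, the form of
`T_v + Q_v B_v + B_v^* Q_v - μ P_v^{(d)} Q_v P_v^{(d)}` is nonpositive on `Y_v^{(d)}` for some
`μ ≥ 0`, and the form `adjointForm` with `κ = 2 μ'` is nonpositive on `𝕐_v^*` for some
`μ' ≥ 0`. -/
def WeakAdjointAssumption : Prop :=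
  ∀ v, (∃ μ : ℝ, 0 ≤ μ ∧ ∀ y : S.Yd v, S.vertexForm v μ ⟨y, S.Yd_le v y.2⟩ ≤ 0) ∧
    ∃ μ' : ℝ, 0 ≤ μ' ∧ ∀ ξ y, S.InYstar v ξ y → S.adjointForm v (2 * μ') μ' ξ y ≤ 0

/-- Second well-posedness assumption, in its strong form: as in the weak form, but on the whole of
`Y_v` in the first condition, and with `κ = 0` in the second. -/
def StrongAdjointAssumption : Prop :=
  ∀ v, (∃ μ : ℝ, 0 ≤ μ ∧ ∀ ξ : S.Y v, S.vertexForm v μ ξ ≤ 0) ∧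
    ∃ μ' : ℝ, 0 ≤ μ' ∧ ∀ ξ y, S.InYstar v ξ y → S.adjointForm v 0 μ' ξ y ≤ 0

/-! #### Matrices of operators -/

/-- The `k_v × k_v` matrix of an operator `L : W → Y_v^{(d)}` on a subspace `W` of `ℂ^{k_v}`,
extended by zero to the orthogonal complement of `W`. -/
def matrixOf {v : V} {W : Submodule ℂ (G.VSpace v)} (L : W →ₗ[ℂ] S.Yd v) :
    Matrix (G.VIdx v) (G.VIdx v) ℂ :=
  Matrix.of fun i j =>
    (L (W.orthogonalProjectionOnto (EuclideanSpace.single j 1)) : G.VSpace v) i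

/-- The operator `B_v + C_v P_v^{(d)} : Y_v → Y_v^{(d)}`. -/
def BCP (v : V) : S.Y v →ₗ[ℂ] S.Yd v := S.B v + S.C v ∘ₗ S.Pd v ∘ₗ (S.Y v).subtype

end HypSystem

end Network

/-- All entries are real. -/
def Matrix.HasRealEntries {n : Type*} (A : Matrix n n ℂ) : Prop := ∀ i j, (A i j).im = 0

/-- All entries are real and nonnegative. -/
def Matrix.HasNonnegEntries {n : Type*} (A : Matrix n n ℂ) : Prop :=
  ∀ i j, (A i j).im = 0 ∧ 0 ≤ (A i j).re

/-- All off-diagonal entries are real and nonnegative. -/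
def Matrix.HasNonnegOffDiag {n : Type*} (A : Matrix n n ℂ) : Prop :=
  ∀ i j, i ≠ j → (A i j).im = 0 ∧ 0 ≤ (A i j).re

end

/-! Since the `M e` are diagonal, real and invertible, each component of `u` follows a scalar
transport equation `u_t = m u_x` whose speed has a fixed sign: it enters its edge at one end point
and leaves it at the other. The vertex conditions have to determine the values entering the edges
from the values leaving them and from the dynamic variables `x_v`. The exact algebraic form of this
demand is `HasOutflowCoordinates`: on every `Y_v` the map `ξ ↦ (P_v^{(d)} ξ, ξ|Out_v)` is a
bijection onto `Y_v^{(d)} × ℂ^{Out_v}`. The whole proof turns on it.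

The bijection yields a positive semigroup. Weight each component by `ρ / |m|`, where `ρ` is `1` at
the outflow end and a small `ε` at the inflow end. The outgoing energy then dominates the incoming
one, which the bijection bounds by `ε` times the outgoing values and `x`; so the transport operator
is quasi-dissipative (`IsDiagonal.exists_isQuasiDissipative`). The resolvent equation is solved
explicitly along the edges. Crossing an edge damps the inflow value by a factor `O(1/l)`, so the
remaining equation for the vertex values is a contraction for large `l`, and its iterates preserve
positivity (`IsDiagonal.isResolvable`). Positivity of the inverse coordinates holds because `γ⁺` has
the same nonnegative coordinates as `γ`, hence equals it
(`HasOutflowCoordinates.isNonnegReal_lift`). Adding a multiple of the identity makes the vertex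
operator and `N` positive, and a bounded positive perturbation is harmless. The Hille-Yosida
theorem, proved here so as to preserve closed cones, gives `IsDiagonal.exists_positive_semigroup`.

For generation, the bijection follows from the assumptions. `T_v` is diagonal, negative on outflow
and positive on inflow indices, so nonpositivity of the vertex form on `Y_v` gives injectivity.
Surjectivity follows from a dimension count based on the basis property, or dually from the adjoint
form with `κ = 0`.

For positivity the semigroup is given, and the existence of a semigroup generated by the operator
already forces the bijection. The resolvent estimate `‖U‖ ≤ (M/l) ‖(l - A) U‖` and its dual are
tested on functions concentrated in a layer of width about `1/l` at one end of the edges: their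
squared norm is at least of order `1/l`, whereas a defect of the bijection would make it `O(1/l²)`.
The positive semigroup constructed above then has the same generator as the given one, so the two
coincide (`IsGeneratedBy.eq_of_dense`). -/

noncomputable section

/-! ### Strongly continuous semigroups: resolvent estimates, density of the domain, uniqueness -/

namespace C0Semigroup

variable {H : Type*} [NormedAddCommGroup H] [NormedSpace ℂ H] (T : C0Semigroup H)

theorem op_comm (s t : ℝ≥0) (f : H) : T.op s (T.op t f) = T.op t (T.op s f) := by
  have h1 := congrArg (fun L => L f) (T.op_add s t)
  have h2 := congrArg (fun L => L f) (T.op_add t s)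
  simp only [ContinuousLinearMap.comp_apply] at h1 h2
  rw [← h1, ← h2, add_comm]

theorem op_add_apply (s t : ℝ≥0) (f : H) : T.op (s + t) f = T.op s (T.op t f) := by
  rw [T.op_add]; rfl

theorem op_zero_apply (f : H) : T.op 0 f = f := by
  rw [T.op_zero]; rfl

theorem exists_bound [CompleteSpace H] (τ : ℝ≥0) :
    ∃ M : ℝ, 1 ≤ M ∧ ∀ t ≤ τ, ‖T.op t‖ ≤ M := by
  obtain ⟨C, hC⟩ := banach_steinhaus (g := fun t : Set.Icc (0 : ℝ≥0) τ => T.op t) (by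
    intro f
    obtain ⟨C, hC⟩ := (isCompact_Icc (a := (0 : ℝ≥0)) (b := τ)).exists_bound_of_continuousOn
      (T.continuous_orbit f).continuousOn
    exact ⟨C, fun t => hC t t.2⟩)
  exact ⟨max C 1, le_max_right _ _, fun t ht => (hC ⟨t, zero_le, ht⟩).trans (le_max_left _ _)⟩

/-- Splitting `T_s g = T_s (g - f) + T_s f`, the local uniform bound controls the first term and
strong continuity the second. It serves the products `T_{t-s} T'_s f` of the uniqueness proof. -/
theorem continuous_uncurry [CompleteSpace H] : Continuous fun p : ℝ≥0 × H => T.op p.1 p.2 := by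
  rw [continuous_iff_continuousAt]
  rintro ⟨t, f⟩
  obtain ⟨M, -, hM⟩ := T.exists_bound (t + 1)
  have h1 : Tendsto (fun p : ℝ≥0 × H => T.op p.1 (p.2 - f)) (𝓝 (t, f)) (𝓝 0) := by
    have hz : Tendsto (fun p : ℝ≥0 × H => M * ‖p.2 - f‖) (𝓝 (t, f)) (𝓝 0) := by
      have : Continuous fun p : ℝ≥0 × H => M * ‖p.2 - f‖ := by fun_prop
      simpa using this.tendsto (t, f)
    refine squeeze_zero_norm' ?_ hz
    have hev : ∀ᶠ p : ℝ≥0 × H in 𝓝 (t, f), p.1 < t + 1 :=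
      continuous_fst.continuousAt.eventually_lt continuousAt_const (by simp)
    filter_upwards [hev] with p hp
    exact (T.op p.1).le_of_opNorm_le (hM _ hp.le) _
  have h2 : Tendsto (fun p : ℝ≥0 × H => T.op p.1 f) (𝓝 (t, f)) (𝓝 (T.op t f)) :=
    ((T.continuous_orbit f).comp continuous_fst).tendsto (t, f)
  have h3 := h1.add h2
  simp only [map_sub, sub_add_cancel, zero_add] at h3
  exact h3

variable {T} {A : H → H → Prop}

theorem IsGeneratedBy.tendsto_real (h : T.IsGeneratedBy A) {f g : H} (hfg : A f g) :
    Tendsto (fun s : ℝ => s⁻¹ • (T.op s.toNNReal f - f)) (𝓝[>] 0) (𝓝 g) := by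
  have h1 := (h f g).1 hfg
  have h2 : Tendsto Real.toNNReal (𝓝[>] (0 : ℝ)) (𝓝[>] (0 : ℝ≥0)) := by
    refine tendsto_nhdsWithin_of_tendsto_nhds_of_eventually_within _ ?_ ?_
    · have := (continuous_real_toNNReal.tendsto (0 : ℝ)).mono_left
        (nhdsWithin_le_nhds (s := Set.Ioi 0))
      simpa using this
    · filter_upwards [self_mem_nhdsWithin] with s hs
      simpa using hs
  refine (h1.comp h2).congr' ?_
  filter_upwards [self_mem_nhdsWithin] with s hs
  have hs' : (0 : ℝ) < s := hs
  simp only [Function.comp, Real.coe_toNNReal s hs'.le]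
  rw [← Complex.ofReal_inv, Complex.coe_smul]

theorem isGeneratedBy_of_tendsto_real (f g : H)
    (h : Tendsto (fun s : ℝ => s⁻¹ • (T.op s.toNNReal f - f)) (𝓝[>] 0) (𝓝 g)) :
    Tendsto (fun t : ℝ≥0 => (((t : ℝ) : ℂ)⁻¹) • (T.op t f - f)) (𝓝[>] 0) (𝓝 g) := by
  have h2 : Tendsto (fun t : ℝ≥0 => (t : ℝ)) (𝓝[>] (0 : ℝ≥0)) (𝓝[>] (0 : ℝ)) := by
    refine tendsto_nhdsWithin_of_tendsto_nhds_of_eventually_within _ ?_ ?_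
    · have := (NNReal.continuous_coe.tendsto (0 : ℝ≥0)).mono_left
        (nhdsWithin_le_nhds (s := Set.Ioi 0))
      simpa using this
    · filter_upwards [self_mem_nhdsWithin] with s hs
      simpa using hs
  refine (h.comp h2).congr fun s => ?_
  simp only [Function.comp, Real.toNNReal_coe]
  rw [← Complex.ofReal_inv, Complex.coe_smul]

theorem IsGeneratedBy.orbit (h : T.IsGeneratedBy A) {f g : H} (hfg : A f g) (t : ℝ≥0) :
    A (T.op t f) (T.op t g) := by
  rw [h]
  have h1 := ((T.op t).continuous.tendsto g).comp ((h f g).1 hfg)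
  refine h1.congr fun s => ?_
  simp only [Function.comp, map_smul, map_sub, T.op_comm t s]

theorem IsGeneratedBy.add (h : T.IsGeneratedBy A) {f g f' g' : H} (hfg : A f g)
    (hfg' : A f' g') : A (f + f') (g + g') := by
  rw [h] at *
  refine (hfg.add hfg').congr fun s => ?_
  rw [← smul_add, map_add]; congr 1; abel

theorem IsGeneratedBy.smul (h : T.IsGeneratedBy A) {f g : H} (c : ℂ) (hfg : A f g) :
    A (c • f) (c • g) := by
  rw [h] at *
  refine (hfg.const_smul c).congr fun s => ?_
  rw [map_smul, ← smul_sub, smul_comm]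

theorem continuous_orbit_real (T : C0Semigroup H) (f : H) :
    Continuous fun t : ℝ => T.op t.toNNReal f :=
  (T.continuous_orbit f).comp continuous_real_toNNReal

/-- The semigroup law carries the difference quotient at `t` back to the one at `0`, taken at `T_t
f`. Right derivatives suffice for the mean value inequalities used below. -/
theorem IsGeneratedBy.hasDerivWithinAt (h : T.IsGeneratedBy A) {f g : H} (hfg : A f g)
    {t : ℝ} (ht : 0 ≤ t) :
    HasDerivWithinAt (fun t : ℝ => T.op t.toNNReal f) (T.op t.toNNReal g) (Set.Ici t) t := by
  rw [hasDerivWithinAt_iff_tendsto_slope, Set.Ici_sdiff_left]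
  have h1 := h.tendsto_real (h.orbit hfg t.toNNReal)
  have h2 : Tendsto (fun y : ℝ => y - t) (𝓝[>] t) (𝓝[>] 0) := by
    refine tendsto_nhdsWithin_of_tendsto_nhds_of_eventually_within _ ?_ ?_
    · have : Continuous fun y : ℝ => y - t := by fun_prop
      have := (this.tendsto t).mono_left (nhdsWithin_le_nhds (s := Set.Ioi t))
      simpa using this
    · filter_upwards [self_mem_nhdsWithin] with s hs
      simpa using hs
  refine (h1.comp h2).congr' ?_
  filter_upwards [self_mem_nhdsWithin] with y hy
  have hy' : t < y := hy
  simp only [Function.comp, slope_def_module]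
  rw [← T.op_add_apply, ← Real.toNNReal_add (by linarith) ht, sub_add_cancel]

/-- With `F = (l - A) U`, the curve `e^{-lt} T_t U` has derivative `-e^{-lt} T_t F`. Integrating
over `[0, 1]` bounds `e^{-l} T_1 U - U` by `M ‖F‖ / l`, so a bound of the semigroup on `[0, 1]` is
enough and no growth rate is needed. -/
theorem IsGeneratedBy.norm_le [CompleteSpace H] (h : T.IsGeneratedBy A) :
    ∃ M : ℝ, 1 ≤ M ∧ ∀ l : ℝ, M ≤ l → ∀ U G, A U G → ‖U‖ ≤ M / l * ‖(l : ℂ) • U - G‖ := by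
  obtain ⟨M, hM1, hM⟩ := T.exists_bound 1
  -- For `l ≥ 2 M` one has `e^{-l} M ≤ 1/2`, because `e^l ≥ l + 1`; absorbing `e^{-l} T_1 U` costs
  -- the factor `2`.
  refine ⟨2 * M, by linarith, fun l hl U G hU => ?_⟩
  have hl0 : 0 < l := by linarith
  set F := (l : ℂ) • U - G with hF
  let φ : ℝ → H := fun t => Real.exp (-l * t) • T.op t.toNNReal U - U
  have hφc : ContinuousOn φ (Set.Icc 0 1) :=
    (((by fun_prop : Continuous fun t : ℝ => Real.exp (-l * t)).smul
      (T.continuous_orbit_real U)).sub continuous_const).continuousOn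
  have hexp : ∀ t : ℝ, HasDerivAt (fun t : ℝ => Real.exp (-l * t)) (Real.exp (-l * t) * (-l)) t := by
    intro t
    have := ((hasDerivAt_id t).const_mul (-l)).exp
    simpa using this
  have hφ' : ∀ t ∈ Set.Ico (0 : ℝ) 1, HasDerivWithinAt φ
      (-(Real.exp (-l * t) • T.op t.toNNReal F)) (Set.Ici t) t := by
    intro t ht
    have := (((hexp t).hasDerivWithinAt (s := Set.Ici t)).smul
      (h.hasDerivWithinAt hU ht.1)).sub_const U
    refine this.congr_deriv ?_
    rw [hF, map_sub, map_smul, Complex.coe_smul, mul_smul, neg_smul, smul_neg, smul_sub]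
    abel
  let B : ℝ → ℝ := fun t => M * ‖F‖ / l * (1 - Real.exp (-l * t))
  have hB : ∀ t, HasDerivAt B (M * ‖F‖ * Real.exp (-l * t)) t := by
    intro t
    have := ((hexp t).const_sub 1).const_mul (M * ‖F‖ / l)
    refine this.congr_deriv ?_
    field_simp
  have key := image_norm_le_of_norm_deriv_right_le_deriv_boundary' hφc hφ' (B := B)
    (B' := fun t => M * ‖F‖ * Real.exp (-l * t)) (by simp [φ, B, T.op_zero_apply])
    (fun t _ => (hB t).continuousAt.continuousWithinAt)
    (fun t _ => (hB t).hasDerivWithinAt) (by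
      intro t ht
      rw [norm_neg, norm_smul, Real.norm_of_nonneg (Real.exp_pos _).le, mul_comm]
      gcongr
      refine (T.op _).le_of_opNorm_le (hM _ ?_) _
      rw [Real.toNNReal_le_one]; exact ht.2.le) (Set.right_mem_Icc.2 zero_le_one)
  have h1 : ‖φ 1‖ ≤ M * ‖F‖ / l := by
    refine key.trans ?_
    have : 0 ≤ M * ‖F‖ / l := by positivity
    have h2 := Real.exp_pos (-l * 1)
    simp only [B]
    nlinarith
  have h2 : ‖U‖ ≤ ‖φ 1‖ + Real.exp (-l) * (M * ‖U‖) := by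
    have e : U = Real.exp (-l) • T.op 1 U - φ 1 := by simp [φ]
    have h3 : ‖U‖ ≤ ‖Real.exp (-l) • T.op 1 U‖ + ‖φ 1‖ := by
      conv_lhs => rw [e]
      exact norm_sub_le _ _
    rw [norm_smul, Real.norm_of_nonneg (Real.exp_pos _).le] at h3
    have h4 := (T.op 1).le_of_opNorm_le (hM 1 le_rfl) U
    have h5 := mul_le_mul_of_nonneg_left h4 (Real.exp_pos (-l)).le
    linarith
  have h3 : Real.exp (-l) * M ≤ 1 / 2 := by
    have h4 := Real.add_one_le_exp l
    have h5 : Real.exp (-l) * Real.exp l = 1 := by rw [← Real.exp_add]; simp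
    have h6 := Real.exp_pos (-l)
    nlinarith
  have h4 : ‖U‖ ≤ 2 * (M * ‖F‖ / l) := by
    nlinarith [norm_nonneg U]
  calc ‖U‖ ≤ 2 * (M * ‖F‖ / l) := h4
    _ = 2 * M / l * ‖F‖ := by ring

/-- The averages `t⁻¹ ∫₀ᵗ T_s f ds` belong to the domain and tend to `f`. -/
theorem IsGeneratedBy.dense_domain [CompleteSpace H] (h : T.IsGeneratedBy A) :
    Dense {U | ∃ G, A U G} := by
  intro f
  let G : ℝ → H := fun t => ∫ s in (0 : ℝ)..t, T.op s.toNNReal f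
  have hc := T.continuous_orbit_real f
  have hG : ∀ t, HasDerivAt G (T.op t.toNNReal f) t := fun t =>
    intervalIntegral.integral_hasDerivAt_right (hc.intervalIntegrable _ _)
      (hc.stronglyMeasurableAtFilter _ _) hc.continuousAt
  have hshift : ∀ t h : ℝ, 0 ≤ t → 0 ≤ h → T.op t.toNNReal (G h) = G (t + h) - G t := by
    intro t h ht hh
    simp only [G]
    rw [← ContinuousLinearMap.intervalIntegral_comp_comm _ (hc.intervalIntegrable _ _),
      intervalIntegral.integral_interval_sub_left (hc.intervalIntegrable _ _)
        (hc.intervalIntegrable _ _)]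
    have : ∫ x in (0 : ℝ)..h, T.op t.toNNReal (T.op x.toNNReal f)
        = ∫ x in (0 : ℝ)..h, T.op (t + x).toNNReal f := by
      refine intervalIntegral.integral_congr fun x hx => ?_
      rw [Set.uIcc_of_le hh] at hx
      rw [← T.op_add_apply, Real.toNNReal_add ht hx.1]
    rw [this, intervalIntegral.integral_comp_add_left (fun x => T.op x.toNNReal f)]
    simp
  have hmem : ∀ h : ℝ, 0 < h → A (G h) (T.op h.toNNReal f - f) := by
    intro k hk
    rw [h]
    refine isGeneratedBy_of_tendsto_real _ _ ?_
    have h1 : HasDerivAt (fun t => G (t + k) - G t) (T.op k.toNNReal f - f) 0 := by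
      have h2 := (hG (0 + k)).comp_add_const 0 k
      refine (h2.sub (hG 0)).congr_deriv ?_
      simp [T.op_zero_apply]
    have h2 := (hasDerivWithinAt_iff_tendsto_slope.1
      (h1.hasDerivWithinAt (s := Set.Ici (0 : ℝ))))
    rw [Set.Ici_sdiff_left] at h2
    refine h2.congr' ?_
    filter_upwards [self_mem_nhdsWithin] with t ht
    have ht' : (0 : ℝ) < t := ht
    rw [slope_def_module, hshift t k ht'.le hk.le]
    simp [G]
  have hlim : Tendsto (fun t : ℝ => ((t⁻¹ : ℝ) : ℂ) • G t) (𝓝[>] 0) (𝓝 f) := by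
    have h2 := (hasDerivWithinAt_iff_tendsto_slope.1
      ((hG 0).hasDerivWithinAt (s := Set.Ici (0 : ℝ))))
    rw [Set.Ici_sdiff_left] at h2
    simp only [Real.toNNReal_zero, T.op_zero_apply] at h2
    refine h2.congr' ?_
    filter_upwards with t
    rw [slope_def_module, Complex.coe_smul]
    simp [G]
  refine mem_closure_of_tendsto hlim ?_
  filter_upwards [self_mem_nhdsWithin] with t ht
  exact ⟨_, h.smul _ (hmem t ht)⟩

/-- For `f` in the domain, `s ↦ T_{t-s} T'_s f` has right derivative zero on `[0, t)`, so its end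
values `T_t f` and `T'_t f` agree; density does the rest. -/
theorem IsGeneratedBy.eq_of_dense [CompleteSpace H] {T' : C0Semigroup H}
    (h : T.IsGeneratedBy A) (h' : T'.IsGeneratedBy A) (t : ℝ≥0) (f : H) :
    T.op t f = T'.op t f := by
  have hd := h.dense_domain
  have key : ∀ f ∈ {U | ∃ G, A U G}, T.op t f = T'.op t f := by
    rintro f ⟨g, hfg⟩
    obtain ⟨M, hM1, hM⟩ := T.exists_bound t
    let V : ℝ → H := fun s => T.op ((t : ℝ) - s).toNNReal (T'.op s.toNNReal f)
    have hVc : Continuous V :=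
      T.continuous_uncurry.comp ((continuous_real_toNNReal.comp (by fun_prop :
        Continuous fun s : ℝ => (t : ℝ) - s)).prodMk (T'.continuous_orbit_real f))
    have hV' : ∀ s ∈ Set.Ico (0 : ℝ) t, HasDerivWithinAt V 0 (Set.Ici s) s := by
      intro s hs
      rw [hasDerivWithinAt_iff_tendsto_slope, Set.Ici_sdiff_left]
      set p := T'.op s.toNNReal f
      have hp : A p (T'.op s.toNNReal g) := h'.orbit hfg _
      have h1 := (hasDerivWithinAt_iff_tendsto_slope.1 (h'.hasDerivWithinAt hfg hs.1))
      rw [Set.Ici_sdiff_left] at h1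
      have h2 : Tendsto (fun y : ℝ => y - s) (𝓝[>] s) (𝓝[>] 0) := by
        refine tendsto_nhdsWithin_of_tendsto_nhds_of_eventually_within _ ?_ ?_
        · have : Continuous fun y : ℝ => y - s := by fun_prop
          have := (this.tendsto s).mono_left (nhdsWithin_le_nhds (s := Set.Ioi s))
          simpa using this
        · filter_upwards [self_mem_nhdsWithin] with s hs
          simpa using hs
      have h3 := h1.sub ((h.tendsto_real hp).comp h2)
      rw [sub_self] at h3
      have h4 := (h3.norm.const_mul M)
      rw [norm_zero, mul_zero] at h4
      refine squeeze_zero_norm' ?_ h4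
      filter_upwards [Ioo_mem_nhdsGT hs.2] with y hy
      -- The two difference quotients, of `T'` along its orbit and of `T` started at `p`, have the
      -- same limit since both semigroups have the generator `A`; the factor `T_{t-y}` in front
      -- stays bounded.
      have e : slope V s y = T.op ((t : ℝ) - y).toNNReal
          (slope (fun t : ℝ => T'.op t.toNNReal f) s y
            - (y - s)⁻¹ • (T.op (y - s).toNNReal p - p)) := by
        simp only [slope_def_module, ← smul_sub, V]
        rw [ContinuousLinearMap.map_smul_of_tower]
        simp only [map_sub]
        congr 1
        rw [← T.op_add_apply, ← Real.toNNReal_add (by linarith [hy.2]) (by linarith [hy.1])]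
        have : (t : ℝ) - y + (y - s) = t - s := by ring
        rw [this]
        abel
      rw [e]
      refine (T.op _).le_of_opNorm_le (hM _ ?_) _
      rw [Real.toNNReal_le_iff_le_coe]
      linarith [hy.1, hs.1]
    have := constant_of_has_deriv_right_zero hVc.continuousOn hV' t
      (Set.right_mem_Icc.2 t.2)
    simp only [V, sub_self, Real.toNNReal_zero, sub_zero, Real.toNNReal_coe, T.op_zero_apply,
      T'.op_zero_apply] at this
    exact this.symm
  have := Continuous.ext_on hd (T.op t).continuous (T'.op t).continuous key
  exact congrFun this f

/-- The resolvent bound for the adjoint, without introducing the adjoint. Pairing the curve from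
`norm_le` with `Ψ` yields `|⟨Ψ, U⟩| ≤ (M κ / l + ‖Ψ‖ / 2) ‖U‖` on the domain, and by density this
may be read at `U = Ψ`. -/
theorem IsGeneratedBy.norm_le_of_dual {H : Type*} [NormedAddCommGroup H]
    [InnerProductSpace ℂ H] [CompleteSpace H] {T : C0Semigroup H} {A : H → H → Prop}
    (h : T.IsGeneratedBy A) :
    ∃ M : ℝ, 1 ≤ M ∧ ∀ l : ℝ, M ≤ l → ∀ (Ψ : H) (κ : ℝ), 0 ≤ κ →
      (∀ U G, A U G → ‖inner ℂ Ψ ((l : ℂ) • U - G)‖ ≤ κ * ‖U‖) → ‖Ψ‖ ≤ M / l * κ := by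
  obtain ⟨M, hM1, hM⟩ := T.exists_bound 1
  refine ⟨2 * M, by linarith, fun l hl Ψ κ hk0 hΨ => ?_⟩
  have hl0 : 0 < l := by linarith
  have hexp : ∀ t : ℝ, HasDerivAt (fun t : ℝ => Real.exp (-l * t)) (Real.exp (-l * t) * (-l)) t := by
    intro t
    have := ((hasDerivAt_id t).const_mul (-l)).exp
    simpa using this
  have h3 : Real.exp (-l) * M ≤ 1 / 2 := by
    have h4 := Real.add_one_le_exp l
    have h5 : Real.exp (-l) * Real.exp l = 1 := by rw [← Real.exp_add]; simp
    have h6 := Real.exp_pos (-l)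
    nlinarith
  have key : ∀ U ∈ {U | ∃ G, A U G}, ‖inner ℂ Ψ U‖ ≤ M * κ / l * ‖U‖ + 1 / 2 * ‖Ψ‖ * ‖U‖ := by
    rintro U ⟨G, hU⟩
    let φ : ℝ → ℂ := fun t => inner ℂ Ψ (Real.exp (-l * t) • T.op t.toNNReal U - U)
    have hφc : ContinuousOn φ (Set.Icc 0 1) := by
      have : Continuous fun t : ℝ => Real.exp (-l * t) • T.op t.toNNReal U - U :=
        ((by fun_prop : Continuous fun t : ℝ => Real.exp (-l * t)).smul
          (T.continuous_orbit_real U)).sub continuous_const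
      exact (continuous_const.inner this).continuousOn
    have hφ' : ∀ t ∈ Set.Ico (0 : ℝ) 1, HasDerivWithinAt φ
        (inner ℂ Ψ (-(Real.exp (-l * t) • T.op t.toNNReal ((l : ℂ) • U - G)))) (Set.Ici t) t := by
      intro t ht
      have := (((hexp t).hasDerivWithinAt (s := Set.Ici t)).smul
        (h.hasDerivWithinAt hU ht.1)).sub_const U
      have := (hasDerivWithinAt_const t (Set.Ici t) Ψ).inner ℂ this
      refine this.congr_deriv ?_
      rw [inner_zero_left, add_zero]
      congr 1
      rw [map_sub, map_smul, Complex.coe_smul, mul_smul, neg_smul, smul_neg, smul_sub]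
      abel
    let B : ℝ → ℝ := fun t => M * (κ * ‖U‖) / l * (1 - Real.exp (-l * t))
    have hB : ∀ t, HasDerivAt B (M * (κ * ‖U‖) * Real.exp (-l * t)) t := by
      intro t
      have := ((hexp t).const_sub 1).const_mul (M * (κ * ‖U‖) / l)
      refine this.congr_deriv ?_
      field_simp
    have key := image_norm_le_of_norm_deriv_right_le_deriv_boundary' hφc hφ' (B := B)
      (B' := fun t => M * (κ * ‖U‖) * Real.exp (-l * t)) (by simp [φ, B, T.op_zero_apply])
      (fun t _ => (hB t).continuousAt.continuousWithinAt)
      (fun t _ => (hB t).hasDerivWithinAt) (by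
        intro t ht
        rw [inner_neg_right, norm_neg, ← Complex.coe_smul, inner_smul_right, norm_mul,
          Complex.norm_real, Real.norm_of_nonneg (Real.exp_pos _).le, mul_comm]
        refine mul_le_mul_of_nonneg_right ?_ (Real.exp_pos _).le
        have h5 := hΨ _ _ (h.orbit hU t.toNNReal)
        rw [← map_smul, ← map_sub] at h5
        refine h5.trans ?_
        have h6 : ‖T.op t.toNNReal U‖ ≤ M * ‖U‖ := by
          refine (T.op _).le_of_opNorm_le (hM _ ?_) _
          rw [Real.toNNReal_le_one]; exact ht.2.le
        calc κ * ‖T.op t.toNNReal U‖ ≤ κ * (M * ‖U‖) := by gcongr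
          _ = _ := by ring) (Set.right_mem_Icc.2 zero_le_one)
    have h1 : ‖φ 1‖ ≤ M * (κ * ‖U‖) / l := by
      refine key.trans ?_
      have : 0 ≤ M * (κ * ‖U‖) / l := by positivity
      have h2 := Real.exp_pos (-l * 1)
      simp only [B]
      nlinarith
    have h2 : ‖inner ℂ Ψ U‖ ≤ ‖φ 1‖ + Real.exp (-l) * (‖Ψ‖ * (M * ‖U‖)) := by
      have e : inner ℂ Ψ U = inner ℂ Ψ (Real.exp (-l) • T.op 1 U) - φ 1 := by
        simp [φ]
      have h3 : ‖inner ℂ Ψ U‖ ≤ ‖inner ℂ Ψ (Real.exp (-l) • T.op 1 U)‖ + ‖φ 1‖ := by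
        conv_lhs => rw [e]
        exact norm_sub_le _ _
      rw [← Complex.coe_smul, inner_smul_right, norm_mul, Complex.norm_real,
          Real.norm_of_nonneg (Real.exp_pos _).le] at h3
      have h4 := (T.op 1).le_of_opNorm_le (hM 1 le_rfl) U
      have h6 := (norm_inner_le_norm (𝕜 := ℂ) Ψ (T.op 1 U)).trans
        (mul_le_mul_of_nonneg_left h4 (norm_nonneg Ψ))
      have h5 := mul_le_mul_of_nonneg_left h6 (Real.exp_pos (-l)).le
      linarith
    have h5 : Real.exp (-l) * (‖Ψ‖ * (M * ‖U‖)) ≤ 1 / 2 * ‖Ψ‖ * ‖U‖ := by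
      calc Real.exp (-l) * (‖Ψ‖ * (M * ‖U‖)) = (Real.exp (-l) * M) * (‖Ψ‖ * ‖U‖) := by ring
        _ ≤ 1 / 2 * (‖Ψ‖ * ‖U‖) := by gcongr
        _ = _ := by ring
    calc ‖inner ℂ Ψ U‖ ≤ M * (κ * ‖U‖) / l + 1 / 2 * ‖Ψ‖ * ‖U‖ := by linarith
      _ = _ := by ring
  -- The estimate is a closed condition on `U`, so it passes from the dense domain to `U = Ψ`, where
  -- the term with `1/2` can be absorbed.
  have hall : ‖inner ℂ Ψ Ψ‖ ≤ M * κ / l * ‖Ψ‖ + 1 / 2 * ‖Ψ‖ * ‖Ψ‖ := by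
    have hcl : IsClosed {U : H | ‖inner ℂ Ψ U‖ ≤ M * κ / l * ‖U‖ + 1 / 2 * ‖Ψ‖ * ‖U‖} := by
      refine isClosed_le ?_ ?_
      · exact (continuous_const.inner continuous_id).norm
      · fun_prop
    exact (closure_minimal key hcl) (h.dense_domain Ψ)
  rw [inner_self_eq_norm_sq_to_K] at hall
  rw [norm_pow] at hall
  simp only [Complex.coe_algebraMap, Complex.norm_real, norm_norm] at hall
  by_cases h0 : Ψ = 0
  · subst h0
    rw [norm_zero]; positivity
  · have hp : 0 < ‖Ψ‖ := norm_pos_iff.2 h0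
    have h6 : ‖Ψ‖ ≤ M * κ / l + 1 / 2 * ‖Ψ‖ := by
      by_contra hcon
      push Not at hcon
      nlinarith
    calc ‖Ψ‖ ≤ 2 * (M * κ / l) := by linarith
      _ = _ := by ring

end C0Semigroup
end

noncomputable section

/-! ### The Hille-Yosida theorem -/

section General

variable {H : Type*} [NormedAddCommGroup H] [NormedSpace ℂ H]

/-- A closed convex cone. -/
structure IsClosedCone (K : Set H) : Prop where
  isClosed : IsClosed K
  zero_mem : (0 : H) ∈ K
  add_mem : ∀ f ∈ K, ∀ g ∈ K, f + g ∈ K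
  smul_mem : ∀ c : ℝ, 0 ≤ c → ∀ f ∈ K, (c : ℂ) • f ∈ K

/-- Bounding all powers of `X`, and not only `‖X‖`, keeps `M` outside the exponential. -/
theorem NormedSpace.norm_exp_le_of_norm_pow_le [CompleteSpace H] (X : H →L[ℂ] H) (M r : ℝ)
    (h : ∀ k : ℕ, ‖X ^ k‖ ≤ M * r ^ k) : ‖NormedSpace.exp X‖ ≤ M * Real.exp r := by
  have h1 := NormedSpace.exp_series_hasSum_exp' (𝕂 := ℂ) X
  have h2 : HasSum (fun k : ℕ => M * (r ^ k / k.factorial)) (M * Real.exp r) := by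
    refine HasSum.mul_left M ?_
    have := NormedSpace.expSeries_div_hasSum_exp r
    rwa [← Real.exp_eq_exp_ℝ] at this
  refine h1.norm_le_of_bounded h2 fun k => ?_
  rw [norm_smul, norm_inv, Complex.norm_natCast]
  calc (k.factorial : ℝ)⁻¹ * ‖X ^ k‖ ≤ (k.factorial : ℝ)⁻¹ * (M * r ^ k) := by gcongr; exact h k
    _ = _ := by ring

/-- The partial sums of the exponential series at `f` are combinations of the `X ^ k f` with
nonnegative coefficients. -/
theorem IsClosedCone.exp_mem [CompleteSpace H] {K : Set H} (hK : IsClosedCone K) (X : H →L[ℂ] H)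
    (hX : ∀ f ∈ K, X f ∈ K) : ∀ f ∈ K, NormedSpace.exp X f ∈ K := by
  intro f hf
  have h1 := NormedSpace.exp_series_hasSum_exp' (𝕂 := ℂ) X
  have h2 := (ContinuousLinearMap.apply ℂ H f).hasSum h1
  refine hK.isClosed.mem_of_tendsto h2 (Eventually.of_forall fun s => ?_)
  have hpow : ∀ k : ℕ, (X ^ k) f ∈ K := by
    intro k
    induction k with
    | zero => simpa using hf
    | succ k ih => rw [pow_succ']; exact hX _ ih
  refine Finset.sum_induction _ (· ∈ K) (fun a b ha hb => hK.add_mem a ha b hb) hK.zero_mem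
    fun k _ => ?_
  have := hK.smul_mem (k.factorial : ℝ)⁻¹ (by positivity) _ (hpow k)
  simpa using this

theorem cauchySeq_of_dense {L : ℕ → (H →L[ℂ] H)} {C : ℝ} (hC : ∀ n, ‖L n‖ ≤ C) {D : Set H}
    (hD : Dense D) (h : ∀ f ∈ D, CauchySeq fun n => L n f) (f : H) :
    CauchySeq fun n => L n f := by
  rw [Metric.cauchySeq_iff]
  intro ε hε
  have hC0 : 0 ≤ C := (norm_nonneg _).trans (hC 0)
  obtain ⟨g, hg, hfg⟩ := Metric.dense_iff.1 hD f (ε / (3 * (C + 1))) (by positivity)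
  rw [Metric.mem_ball, dist_eq_norm, norm_sub_rev] at hg
  obtain ⟨N, hN⟩ := Metric.cauchySeq_iff.1 (h g hfg) (ε / 3) (by positivity)
  refine ⟨N, fun m hm n hn => ?_⟩
  have h1 := hN m hm n hn
  rw [dist_eq_norm] at *
  have h2 : ∀ k, ‖L k (f - g)‖ < ε / 3 := fun k => by
    calc ‖L k (f - g)‖ ≤ C * ‖f - g‖ := (L k).le_of_opNorm_le (hC k) _
      _ ≤ (C + 1) * ‖f - g‖ := by gcongr; linarith
      _ < (C + 1) * (ε / (3 * (C + 1))) := by gcongr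
      _ = ε / 3 := by field_simp
  have e : L m f - L n f = L m (f - g) + (L m g - L n g) - L n (f - g) := by
    simp only [map_sub]; abel
  rw [e]
  calc _ ≤ ‖L m (f - g) + (L m g - L n g)‖ + ‖L n (f - g)‖ := norm_sub_le _ _
    _ ≤ ‖L m (f - g)‖ + ‖L m g - L n g‖ + ‖L n (f - g)‖ := by gcongr; exact norm_add_le _ _
    _ < ε / 3 + ε / 3 + ε / 3 := by gcongr <;> [exact h2 m; exact h2 n]
    _ = ε := by ring

theorem tendsto_of_dense {L : ℕ → (H →L[ℂ] H)} {C : ℝ} (hC : ∀ n, ‖L n‖ ≤ C) {D : Set H}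
    (hD : Dense D) (h : ∀ f ∈ D, Tendsto (fun n => L n f) atTop (𝓝 f)) (f : H) :
    Tendsto (fun n => L n f) atTop (𝓝 f) := by
  rw [Metric.tendsto_atTop]
  intro ε hε
  have hC0 : 0 ≤ C := (norm_nonneg _).trans (hC 0)
  obtain ⟨g, hg, hfg⟩ := Metric.dense_iff.1 hD f (ε / (3 * (C + 1))) (by positivity)
  rw [Metric.mem_ball, dist_eq_norm, norm_sub_rev] at hg
  obtain ⟨N, hN⟩ := Metric.tendsto_atTop.1 (h g hfg) (ε / 3) (by positivity)
  refine ⟨N, fun n hn => ?_⟩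
  have h1 := hN n hn
  rw [dist_eq_norm] at *
  have h2 : ‖L n (f - g)‖ < ε / 3 := by
    calc ‖L n (f - g)‖ ≤ C * ‖f - g‖ := (L n).le_of_opNorm_le (hC n) _
      _ ≤ (C + 1) * ‖f - g‖ := by gcongr; linarith
      _ < (C + 1) * (ε / (3 * (C + 1))) := by gcongr
      _ = ε / 3 := by field_simp
  have h3 : ‖f - g‖ ≤ ε / 3 := by
    refine hg.le.trans ?_
    rw [div_le_div_iff₀ (by positivity) (by positivity)]
    nlinarith
  have e : L n f - f = L n (f - g) + (L n g - g) - (f - g) := by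
    simp only [map_sub]; abel
  rw [e]
  calc _ ≤ ‖L n (f - g) + (L n g - g)‖ + ‖f - g‖ := norm_sub_le _ _
    _ ≤ ‖L n (f - g)‖ + ‖L n g - g‖ + ‖f - g‖ := by gcongr; exact norm_add_le _ _
    _ < ε / 3 + ε / 3 + ε / 3 := by linarith
    _ = ε := by ring

end General

/-- The data of the Hille-Yosida theorem: a densely defined operator with graph `A` and resolvent
`R l` for `l > l₀`, whose powers are bounded by `M / (l - w) ^ k`. -/
structure ResolventData {H : Type*} [NormedAddCommGroup H] [NormedSpace ℂ H]
    (A : H → H → Prop) (R : ℝ → (H →L[ℂ] H)) (l₀ w M : ℝ) : Prop where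
  w_nonneg : 0 ≤ w
  le_l₀ : 2 * w ≤ l₀
  right_inv : ∀ l > l₀, ∀ F, A (R l F) ((l : ℂ) • R l F - F)
  left_inv : ∀ l > l₀, ∀ U G, A U G → R l ((l : ℂ) • U - G) = U
  norm_pow_le : ∀ l > l₀, ∀ k : ℕ, ‖R l ^ k‖ ≤ M / (l - w) ^ k
  dense : Dense {U | ∃ G, A U G}

namespace ResolventData

variable {H : Type*} [NormedAddCommGroup H] [NormedSpace ℂ H]
  {A : H → H → Prop} {R : ℝ → (H →L[ℂ] H)} {l₀ w M : ℝ} (hR : ResolventData A R l₀ w M)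

include hR

theorem M_nonneg : 0 ≤ M := by
  have := hR.norm_pow_le (l₀ + 1) (by linarith) 0
  simp only [pow_zero, div_one] at this
  exact (norm_nonneg _).trans this

theorem resolvent_sub {l m : ℝ} (hl : l₀ < l) (hm : l₀ < m) (F : H) :
    R m F - R l F = ((l : ℂ) - m) • R l (R m F) := by
  have h1 := hR.left_inv l hl _ _ (hR.right_inv m hm F)
  have e : (l : ℂ) • R m F - ((m : ℂ) • R m F - F) = ((l : ℂ) - m) • R m F + F := by
    rw [sub_smul]; abel
  rw [e, map_add, map_smul] at h1
  exact sub_eq_of_eq_add h1.symm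

/-- The resolvent identity, written for `(l, m)` and for `(m, l)`, identifies both products after
multiplication by `l - m`. -/
theorem commute {l m : ℝ} (hl : l₀ < l) (hm : l₀ < m) : Commute (R l) (R m) := by
  by_cases h : l = m
  · rw [h]
  ext F
  have h1 := hR.resolvent_sub hl hm F
  have h2 := hR.resolvent_sub hm hl F
  have h3 : ((l : ℂ) - m) • R l (R m F) = ((l : ℂ) - m) • R m (R l F) := by
    rw [← h1, ← neg_sub (m : ℂ) l, neg_smul, ← h2]; abel
  have h4 : ((l : ℂ) - m) ≠ 0 := by
    rw [sub_ne_zero]; exact_mod_cast h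
  exact smul_right_injective H h4 h3

/-- Here `2 w ≤ l₀` enters: the ratio `l / (l - w)` is at most `2`, which keeps `l R l` and the
growth rates of the Yosida semigroups bounded uniformly in `l`. -/
theorem l_sub_w {l : ℝ} (hl : l₀ < l) : 0 < l - w ∧ l ≤ 2 * (l - w) ∧ 0 < l := by
  have := hR.w_nonneg; have := hR.le_l₀
  exact ⟨by linarith, by linarith, by linarith⟩

theorem norm_le {l : ℝ} (hl : l₀ < l) : ‖R l‖ ≤ M / (l - w) := by
  simpa using hR.norm_pow_le l hl 1

theorem norm_smul_le {l : ℝ} (hl : l₀ < l) : ‖(l : ℂ) • R l‖ ≤ 2 * M := by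
  obtain ⟨h1, h2, h3⟩ := hR.l_sub_w hl
  have hM := hR.M_nonneg
  rw [norm_smul, Complex.norm_real, Real.norm_of_nonneg h3.le]
  calc l * ‖R l‖ ≤ (2 * (l - w)) * (M / (l - w)) := by gcongr; exact hR.norm_le hl
    _ = 2 * M := by field_simp

end ResolventData

section Yosida

variable {H : Type*} [NormedAddCommGroup H] [NormedSpace ℂ H]

/-- The Yosida approximation `l² R l - l`. -/
def yosida (R : ℝ → (H →L[ℂ] H)) (l : ℝ) : H →L[ℂ] H := (l ^ 2) • R l - l • 1

/-- The semigroup generated by the Yosida approximation. -/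
def yosidaSemigroup (R : ℝ → (H →L[ℂ] H)) (l t : ℝ) : H →L[ℂ] H :=
  Real.exp (-l * t) • NormedSpace.exp (t • ((l ^ 2) • R l))

end Yosida

namespace ResolventData

variable {H : Type*} [NormedAddCommGroup H] [NormedSpace ℂ H] [CompleteSpace H]
  {A : H → H → Prop} {R : ℝ → (H →L[ℂ] H)} {l₀ w M : ℝ}

omit [CompleteSpace H] in
theorem _root_.yosidaSemigroup_zero (l : ℝ) : yosidaSemigroup R l 0 = 1 := by
  simp [yosidaSemigroup]

theorem _root_.yosidaSemigroup_add (l s t : ℝ) :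
    yosidaSemigroup R l (s + t) = yosidaSemigroup R l s * yosidaSemigroup R l t := by
  let _ := NormedAlgebra.restrictScalars ℚ ℂ (H →L[ℂ] H)
  simp only [yosidaSemigroup]
  rw [add_smul, NormedSpace.exp_add_of_commute
    (((Commute.refl _).smul_left s).smul_right t), mul_add, Real.exp_add, smul_mul_smul_comm]

theorem _root_.yosidaSemigroup_hasDerivAt (l t : ℝ) :
    HasDerivAt (yosidaSemigroup R l) (yosidaSemigroup R l t * yosida R l) t := by
  have h1 : HasDerivAt (fun t : ℝ => Real.exp (-l * t)) (Real.exp (-l * t) * (-l)) t := by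
    have := ((hasDerivAt_id t).const_mul (-l)).exp
    simpa using this
  have h2 := hasDerivAt_exp_smul_const (𝕂 := ℝ) ((l ^ 2) • R l) t
  refine (h1.smul h2).congr_deriv ?_
  simp only [yosidaSemigroup, yosida, mul_sub, smul_mul_assoc, mul_smul_comm, mul_one]
  module

end ResolventData
end

/-! ### Convergence of the Yosida approximations -/

noncomputable section

theorem hasDerivAt_clm_apply {H : Type*} [NormedAddCommGroup H] [NormedSpace ℂ H]
    {L : ℝ → (H →L[ℂ] H)} {L' : H →L[ℂ] H} {s : ℝ} (h : HasDerivAt L L' s) (f : H) :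
    HasDerivAt (fun s => L s f) (L' f) s :=
  ((ContinuousLinearMap.apply ℂ H f).restrictScalars ℝ).hasFDerivAt.comp_hasDerivAt s h

theorem yosidaSemigroup_apply_hasDerivAt {H : Type*} [NormedAddCommGroup H] [NormedSpace ℂ H]
    [CompleteSpace H] {R : ℝ → (H →L[ℂ] H)} (l : ℝ) (f : H) (t : ℝ) :
    HasDerivAt (fun t => yosidaSemigroup R l t f) (yosidaSemigroup R l t (yosida R l f)) t :=
  hasDerivAt_clm_apply (yosidaSemigroup_hasDerivAt l t) f

theorem continuous_yosidaSemigroup_apply {H : Type*} [NormedAddCommGroup H] [NormedSpace ℂ H]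
    [CompleteSpace H] {R : ℝ → (H →L[ℂ] H)} (l : ℝ) (f : H) :
    Continuous fun t => yosidaSemigroup R l t f :=
  continuous_iff_continuousAt.2 fun t => (yosidaSemigroup_apply_hasDerivAt l f t).continuousAt

namespace ResolventData

variable {H : Type*} [NormedAddCommGroup H] [NormedSpace ℂ H]
  {A : H → H → Prop} {R : ℝ → (H →L[ℂ] H)} {l₀ w M : ℝ} (hR : ResolventData A R l₀ w M)

include hR

/-- The resolvent identity `l R_l U = U + R_l A U` turns `l² R_l - l` into `l R_l A` on the domain.
-/
theorem yosida_apply {l : ℝ} (hl : l₀ < l) {U G : H} (hU : A U G) :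
    yosida R l U = (l : ℂ) • R l G := by
  have h1 := hR.left_inv l hl U G hU
  rw [map_sub, map_smul, sub_eq_iff_eq_add] at h1
  have h2 : (l : ℂ) • ((l : ℂ) • R l U) = (l : ℂ) • U + (l : ℂ) • R l G := by
    rw [h1, smul_add]
  simp only [yosida, sub_apply, smul_apply, one_apply_eq_self]
  rw [← Complex.coe_smul, ← Complex.coe_smul l U, Complex.ofReal_pow, pow_two, mul_smul, h2]
  abel

variable [CompleteSpace H]

/-- The exponents combine to `l² / (l - w) - l = w l / (l - w) ≤ 2 w`, which does not depend on `l`.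
-/
theorem norm_yosidaSemigroup_le {l t : ℝ} (hl : l₀ < l) (ht : 0 ≤ t) :
    ‖yosidaSemigroup R l t‖ ≤ M * Real.exp (2 * w * t) := by
  obtain ⟨h1, h2, h3⟩ := hR.l_sub_w hl
  have hM := hR.M_nonneg
  have hw := hR.w_nonneg
  have hb := NormedSpace.norm_exp_le_of_norm_pow_le (t • ((l ^ 2) • R l)) M
    (t * l ^ 2 / (l - w)) (by
      intro k
      rw [← mul_smul, smul_pow, norm_smul, Real.norm_of_nonneg (by positivity)]
      calc (t * l ^ 2) ^ k * ‖R l ^ k‖ ≤ (t * l ^ 2) ^ k * (M / (l - w) ^ k) := by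
            gcongr; exact hR.norm_pow_le l hl k
        _ = _ := by rw [div_pow]; ring)
  rw [yosidaSemigroup, norm_smul, Real.norm_of_nonneg (Real.exp_pos _).le]
  calc Real.exp (-l * t) * ‖NormedSpace.exp (t • ((l ^ 2) • R l))‖
      ≤ Real.exp (-l * t) * (M * Real.exp (t * l ^ 2 / (l - w))) := by gcongr
    _ = M * Real.exp (-l * t + t * l ^ 2 / (l - w)) := by rw [Real.exp_add]; ring
    _ ≤ M * Real.exp (2 * w * t) := by
        gcongr
        have e : -l * t + t * l ^ 2 / (l - w) = l / (l - w) * (w * t) := by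
          field_simp; ring
        rw [e]
        have : l / (l - w) ≤ 2 := by rw [div_le_iff₀ h1]; exact h2
        calc l / (l - w) * (w * t) ≤ 2 * (w * t) := by gcongr
          _ = _ := by ring

omit [CompleteSpace H] in
theorem commute_yosidaSemigroup {l m : ℝ} (hl : l₀ < l) (hm : l₀ < m) (s : ℝ) :
    Commute (yosidaSemigroup R l s) (yosida R m) := by
  let _ := NormedAlgebra.restrictScalars ℚ ℂ (H →L[ℂ] H)
  have h1 : Commute (R l) (yosida R m) :=
    ((hR.commute hl hm).smul_right _).sub_right ((Commute.one_right _).smul_right _)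
  exact (((h1.smul_left _).smul_left _).exp_left).smul_left _

/-- Interpolating by `s ↦ S_m(t - s) S_l(s) f` and using that everything commutes, the derivative is
`S_m(t - s) S_l(s)` applied to the difference of the two approximations at `f`. -/
theorem norm_yosidaSemigroup_sub_le {l m t : ℝ} (hl : l₀ < l) (hm : l₀ < m) (ht : 0 ≤ t) (f : H) :
    ‖yosidaSemigroup R l t f - yosidaSemigroup R m t f‖
      ≤ M ^ 2 * Real.exp (2 * w * t) * ‖yosida R l f - yosida R m f‖ * t := by
  have hM := hR.M_nonneg
  let φ : ℝ → H := fun s => (yosidaSemigroup R m (t - s) * yosidaSemigroup R l s) f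
  have hφ : ∀ s, HasDerivAt φ
      (yosidaSemigroup R m (t - s) (yosidaSemigroup R l s (yosida R l f - yosida R m f))) s := by
    intro s
    have h1 := (yosidaSemigroup_hasDerivAt (R := R) m (t - s)).comp_const_sub t s
    have h2 := h1.mul (yosidaSemigroup_hasDerivAt (R := R) l s)
    have h3 := hasDerivAt_clm_apply h2 f
    refine h3.congr_deriv ?_
    have hc : ∀ g, yosida R m (yosidaSemigroup R l s g) = yosidaSemigroup R l s (yosida R m g) :=
      fun g => (congrArg (fun L : H →L[ℂ] H => L g)
        (hR.commute_yosidaSemigroup hl hm s).eq).symm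
    change -(yosidaSemigroup R m (t - s) (yosida R m (yosidaSemigroup R l s f)))
      + yosidaSemigroup R m (t - s) (yosidaSemigroup R l s (yosida R l f)) = _
    rw [hc, map_sub, map_sub]
    abel
  have := norm_image_sub_le_of_norm_deriv_le_segment' (f := φ) (a := 0) (b := t)
    (C := M ^ 2 * Real.exp (2 * w * t) * ‖yosida R l f - yosida R m f‖)
    (fun s _ => (hφ s).hasDerivWithinAt) (by
      intro s hs
      have h1 := (yosidaSemigroup R m (t - s)).le_of_opNorm_le
        (hR.norm_yosidaSemigroup_le hm (by linarith [hs.2] : 0 ≤ t - s))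
        (yosidaSemigroup R l s (yosida R l f - yosida R m f))
      have h2 := (yosidaSemigroup R l s).le_of_opNorm_le
        (hR.norm_yosidaSemigroup_le hl hs.1) (yosida R l f - yosida R m f)
      refine h1.trans ?_
      calc _ ≤ M * Real.exp (2 * w * (t - s)) * (M * Real.exp (2 * w * s)
              * ‖yosida R l f - yosida R m f‖) := by gcongr
        _ = M ^ 2 * (Real.exp (2 * w * (t - s)) * Real.exp (2 * w * s))
              * ‖yosida R l f - yosida R m f‖ := by ring
        _ = _ := by rw [← Real.exp_add]; congr 3; ring_nf) t
    (Set.right_mem_Icc.2 ht)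
  simpa [φ, yosidaSemigroup_zero] using this

omit [NormedAddCommGroup H] [NormedSpace ℂ H] [CompleteSpace H] hR in
theorem lam_lt (n : ℕ) : l₀ < l₀ + 1 + n := by
  have : (0 : ℝ) ≤ n := n.cast_nonneg
  linarith

-- On the domain `l R_l U - U = R_l A U` is `O(1/l)`; the uniform bound of `l R_l` extends the
-- convergence to all vectors.
omit [CompleteSpace H] in
theorem tendsto_smul_resolvent (f : H) :
    Tendsto (fun n : ℕ => ((l₀ + 1 + n : ℝ) : ℂ) • R (l₀ + 1 + n) f) atTop (𝓝 f) := by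
  have hM := hR.M_nonneg
  have h0 := tendsto_of_dense (L := fun n : ℕ => ((l₀ + 1 + n : ℝ) : ℂ) • R (l₀ + 1 + n))
    (C := 2 * M) (fun n => hR.norm_smul_le (lam_lt n)) hR.dense ?_ f
  · exact h0
  · rintro f ⟨G, hf⟩
    rw [tendsto_iff_norm_sub_tendsto_zero]
    have hlim : Tendsto (fun n : ℕ => M / (l₀ + 1 + n - w) * ‖G‖) atTop (𝓝 0) := by
      have h1 : Tendsto (fun n : ℕ => l₀ + 1 + (n : ℝ) - w) atTop atTop := by
        have := tendsto_atTop_add_const_left atTop (l₀ + 1 - w)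
          (tendsto_natCast_atTop_atTop (R := ℝ))
        refine this.congr fun n => by ring
      simpa using (h1.const_div_atTop M).mul_const ‖G‖
    refine squeeze_zero (fun _ => norm_nonneg _) (fun n => ?_) hlim
    have h1 := hR.left_inv _ (lam_lt n) f G hf
    rw [map_sub, map_smul, sub_eq_iff_eq_add] at h1
    have h2 : (((l₀ + 1 + n : ℝ) : ℂ) • R (l₀ + 1 + n)) f - f = R (l₀ + 1 + n) G := by
      rw [smul_apply, h1]; abel
    rw [h2]
    exact (R _).le_of_opNorm_le (hR.norm_le (lam_lt n)) G

theorem cauchySeq_yosidaSemigroup {t : ℝ} (ht : 0 ≤ t) (f : H) :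
    CauchySeq fun n : ℕ => yosidaSemigroup R (l₀ + 1 + n) t f := by
  refine cauchySeq_of_dense (fun n => hR.norm_yosidaSemigroup_le (lam_lt n) ht) hR.dense ?_ f
  rintro f ⟨G, hf⟩
  have hM := hR.M_nonneg
  have h1 : Tendsto (fun n : ℕ => yosida R (l₀ + 1 + n) f) atTop (𝓝 G) := by
    refine (hR.tendsto_smul_resolvent G).congr fun n => ?_
    rw [hR.yosida_apply (lam_lt n) hf]
  have h2 := h1.cauchySeq
  rw [Metric.cauchySeq_iff] at h2 ⊢
  intro ε hε
  set C := M ^ 2 * Real.exp (2 * w * t) * t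
  have hC : 0 ≤ C := by positivity
  obtain ⟨N, hN⟩ := h2 (ε / (C + 1)) (by positivity)
  refine ⟨N, fun m hm n hn => ?_⟩
  have h3 := hN m hm n hn
  rw [dist_eq_norm] at *
  calc _ ≤ _ := hR.norm_yosidaSemigroup_sub_le (lam_lt m) (lam_lt n) ht f
    _ = C * ‖yosida R (l₀ + 1 + m) f - yosida R (l₀ + 1 + n) f‖ := by ring
    _ ≤ (C + 1) * ‖yosida R (l₀ + 1 + m) f - yosida R (l₀ + 1 + n) f‖ := by gcongr; linarith
    _ < (C + 1) * (ε / (C + 1)) := by gcongr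
    _ = ε := by field_simp

theorem exists_limit : ∃ T : ℝ≥0 → (H →L[ℂ] H), ∀ (t : ℝ≥0) f,
    Tendsto (fun n : ℕ => yosidaSemigroup R (l₀ + 1 + n) t f) atTop (𝓝 (T t f)) := by
  have h : ∀ t : ℝ≥0, ∃ L : H →L[ℂ] H, ∀ f,
      Tendsto (fun n : ℕ => yosidaSemigroup R (l₀ + 1 + n) t f) atTop (𝓝 (L f)) := by
    intro t
    choose L hL using fun f => cauchySeq_tendsto_of_complete
      (hR.cauchySeq_yosidaSemigroup t.2 f)
    exact ⟨continuousLinearMapOfTendsto (fun n : ℕ => yosidaSemigroup R (l₀ + 1 + n) t)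
      (tendsto_pi_nhds.2 hL), hL⟩
  choose T hT using h
  exact ⟨T, hT⟩

theorem norm_limit_le {T : ℝ≥0 → (H →L[ℂ] H)} (hT : ∀ (t : ℝ≥0) f,
    Tendsto (fun n : ℕ => yosidaSemigroup R (l₀ + 1 + n) t f) atTop (𝓝 (T t f))) (t : ℝ≥0) :
    ‖T t‖ ≤ M * Real.exp (2 * w * t) := by
  have hM := hR.M_nonneg
  refine (T t).opNorm_le_bound (by positivity) fun f => ?_
  refine le_of_tendsto (hT t f).norm (Eventually.of_forall fun n => ?_)
  exact (yosidaSemigroup R _ t).le_of_opNorm_le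
    (hR.norm_yosidaSemigroup_le (lam_lt n) t.2) f

omit hR [CompleteSpace H] in
theorem limit_zero {T : ℝ≥0 → (H →L[ℂ] H)} (hT : ∀ (t : ℝ≥0) f,
    Tendsto (fun n : ℕ => yosidaSemigroup R (l₀ + 1 + n) t f) atTop (𝓝 (T t f))) : T 0 = 1 := by
  ext f
  refine tendsto_nhds_unique (hT 0 f) ?_
  simp [yosidaSemigroup_zero]

theorem limit_add {T : ℝ≥0 → (H →L[ℂ] H)} (hT : ∀ (t : ℝ≥0) f,
    Tendsto (fun n : ℕ => yosidaSemigroup R (l₀ + 1 + n) t f) atTop (𝓝 (T t f))) (s t : ℝ≥0) :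
    T (s + t) = (T s).comp (T t) := by
  ext f
  refine tendsto_nhds_unique (hT (s + t) f) ?_
  have h1 : Tendsto (fun n : ℕ => yosidaSemigroup R (l₀ + 1 + n) s
      (yosidaSemigroup R (l₀ + 1 + n) t f - T t f)) atTop (𝓝 0) := by
    have h2 := (tendsto_iff_norm_sub_tendsto_zero.1 (hT t f)).const_mul
      (M * Real.exp (2 * w * s))
    rw [mul_zero] at h2
    refine squeeze_zero_norm (fun n => ?_) h2
    exact (yosidaSemigroup R _ s).le_of_opNorm_le
      (hR.norm_yosidaSemigroup_le (lam_lt n) s.2) _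
  have h2 := h1.add (hT s (T t f))
  rw [zero_add] at h2
  refine h2.congr fun n => ?_
  rw [map_sub, sub_add_cancel, NNReal.coe_add, yosidaSemigroup_add]
  rfl

omit [CompleteSpace H] in
theorem tendsto_yosida {f G : H} (hf : A f G) :
    Tendsto (fun n : ℕ => yosida R (l₀ + 1 + n) f) atTop (𝓝 G) :=
  (hR.tendsto_smul_resolvent G).congr fun n => by
      rw [hR.yosida_apply (lam_lt n) hf]

omit [CompleteSpace H] in
theorem norm_yosida_le {f G : H} (hf : A f G) (n : ℕ) :
    ‖yosida R (l₀ + 1 + n) f‖ ≤ 2 * M * ‖G‖ := by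
  rw [hR.yosida_apply (lam_lt n) hf, ← smul_apply]
  exact ContinuousLinearMap.le_of_opNorm_le _ (hR.norm_smul_le (lam_lt n)) G

/-- The approximating orbits are Lipschitz on `[0, τ]` with a constant independent of `n`, and the
bound survives the limit. Strong continuity is deduced from this on the dense domain. -/
theorem norm_limit_sub_le {T : ℝ≥0 → (H →L[ℂ] H)} (hT : ∀ (t : ℝ≥0) f,
    Tendsto (fun n : ℕ => yosidaSemigroup R (l₀ + 1 + n) t f) atTop (𝓝 (T t f))) {f G : H} (hf : A f G) (τ : ℝ) (s t : ℝ≥0) (hs : (s : ℝ) ≤ τ) (ht : (t : ℝ) ≤ τ) :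
    ‖T t f - T s f‖ ≤ M * Real.exp (2 * w * τ) * (2 * M * ‖G‖) * ‖(t : ℝ) - s‖ := by
  have hM := hR.M_nonneg
  have hw := hR.w_nonneg
  refine le_of_tendsto ((hT t f).sub (hT s f)).norm (Eventually.of_forall fun n => ?_)
  refine Convex.norm_image_sub_le_of_norm_hasDerivWithin_le (s := Set.Icc 0 τ)
    (f := fun t : ℝ => yosidaSemigroup R (l₀ + 1 + n) t f)
    (f' := fun t => yosidaSemigroup R (l₀ + 1 + n) t (yosida R (l₀ + 1 + n) f)) ?_ ?_
    (convex_Icc _ _) ⟨s.2, hs⟩ ⟨t.2, ht⟩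
  · intro x _
    exact (yosidaSemigroup_apply_hasDerivAt (l₀ + 1 + n) f x).hasDerivWithinAt
  · intro x hx
    have h1 := (yosidaSemigroup R (l₀ + 1 + n) x).le_of_opNorm_le
      (hR.norm_yosidaSemigroup_le (lam_lt n) hx.1) (yosida R (l₀ + 1 + n) f)
    refine h1.trans ?_
    have : 2 * w * x ≤ 2 * w * τ := by gcongr; exact hx.2
    gcongr
    exact hR.norm_yosida_le hf n

theorem continuous_limit {T : ℝ≥0 → (H →L[ℂ] H)} (hT : ∀ (t : ℝ≥0) f,
    Tendsto (fun n : ℕ => yosidaSemigroup R (l₀ + 1 + n) t f) atTop (𝓝 (T t f))) (f : H) : Continuous fun t => T t f := by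
  have hM := hR.M_nonneg
  have hw := hR.w_nonneg
  rw [continuous_iff_continuousAt]
  intro t
  rw [Metric.continuousAt_iff']
  intro ε hε
  set C := M * Real.exp (2 * w * (t + 1)) with hC
  have hC0 : 0 ≤ C := by positivity
  obtain ⟨g, hg, G, hgG⟩ := Metric.dense_iff.1 hR.dense f (ε / (3 * (C + 1))) (by positivity)
  rw [Metric.mem_ball, dist_eq_norm, norm_sub_rev] at hg
  have h2 : ∀ s : ℝ≥0, s ≤ t + 1 → ‖T s (f - g)‖ < ε / 3 := by
    intro s hs
    have hs' : (s : ℝ) ≤ t + 1 := by exact_mod_cast hs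
    have h3 : ‖T s‖ ≤ C := (hR.norm_limit_le hT s).trans (by rw [hC]; gcongr)
    calc ‖T s (f - g)‖ ≤ C * ‖f - g‖ := (T s).le_of_opNorm_le h3 _
      _ ≤ (C + 1) * ‖f - g‖ := by gcongr; linarith
      _ < (C + 1) * (ε / (3 * (C + 1))) := by gcongr
      _ = ε / 3 := by field_simp
  set D := M * Real.exp (2 * w * (t + 1)) * (2 * M * ‖G‖)
  have hlim : Tendsto (fun s : ℝ≥0 => D * ‖(s : ℝ) - t‖) (𝓝 t) (𝓝 0) := by
    have : Continuous fun s : ℝ≥0 => D * ‖(s : ℝ) - t‖ := by fun_prop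
    simpa using this.tendsto t
  have hnear : ∀ᶠ s in 𝓝 t, s < t + 1 :=
    continuousAt_id.eventually_lt continuousAt_const (by simp)
  filter_upwards [hlim.eventually_lt_const (show 0 < ε / 3 by positivity), hnear] with s hs hs1
  have h4 := hR.norm_limit_sub_le hT hgG (t + 1) t s (by linarith) (by exact_mod_cast hs1.le)
  rw [dist_eq_norm]
  have e : T s f - T t f = T s (f - g) + (T s g - T t g) - T t (f - g) := by
    simp only [map_sub]; abel
  rw [e]
  have h5 := h2 s hs1.le
  have h6 := h2 t (by simp)
  calc _ ≤ ‖T s (f - g) + (T s g - T t g)‖ + ‖T t (f - g)‖ := norm_sub_le _ _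
    _ ≤ ‖T s (f - g)‖ + ‖T s g - T t g‖ + ‖T t (f - g)‖ := by gcongr; exact norm_add_le _ _
    _ < ε / 3 + ε / 3 + ε / 3 := by linarith
    _ = ε := by ring

/-- The integrated form of the evolution equation passes to the limit by dominated convergence;
differentiability of the limit orbit at `0` is then read off from the integral. -/
theorem limit_sub_eq_integral {T : ℝ≥0 → (H →L[ℂ] H)} (hT : ∀ (t : ℝ≥0) f,
    Tendsto (fun n : ℕ => yosidaSemigroup R (l₀ + 1 + n) t f) atTop (𝓝 (T t f))) {f G : H} (hf : A f G) {t : ℝ} (ht : 0 ≤ t) :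
    T t.toNNReal f - f = ∫ s in (0 : ℝ)..t, T s.toNNReal G := by
  have hM := hR.M_nonneg
  have hw := hR.w_nonneg
  have h1 : ∀ n : ℕ, yosidaSemigroup R (l₀ + 1 + n) t f - f
      = ∫ s in (0 : ℝ)..t, yosidaSemigroup R (l₀ + 1 + n) s (yosida R (l₀ + 1 + n) f) := by
    intro n
    rw [intervalIntegral.integral_eq_sub_of_hasDerivAt
      (f := fun s => yosidaSemigroup R (l₀ + 1 + n) s f)]
    · simp [yosidaSemigroup_zero]
    · exact fun x _ => yosidaSemigroup_apply_hasDerivAt (l₀ + 1 + n) f x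
    · exact (continuous_yosidaSemigroup_apply _ _).intervalIntegrable _ _
  have h2 : Tendsto (fun n : ℕ => ∫ s in (0 : ℝ)..t,
      yosidaSemigroup R (l₀ + 1 + n) s (yosida R (l₀ + 1 + n) f)) atTop
      (𝓝 (∫ s in (0 : ℝ)..t, T s.toNNReal G)) := by
    refine intervalIntegral.tendsto_integral_filter_of_dominated_convergence
      (fun _ => M * Real.exp (2 * w * t) * (2 * M * ‖G‖)) ?_ ?_ ?_ ?_
    · refine Eventually.of_forall fun n => ?_
      exact (continuous_yosidaSemigroup_apply _ _).aestronglyMeasurable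
    · refine Eventually.of_forall fun n => Eventually.of_forall fun x hx => ?_
      rw [Set.uIoc_of_le ht] at hx
      have h1 := (yosidaSemigroup R (l₀ + 1 + n) x).le_of_opNorm_le
        (hR.norm_yosidaSemigroup_le (lam_lt n) hx.1.le) (yosida R (l₀ + 1 + n) f)
      refine h1.trans ?_
      have : 2 * w * x ≤ 2 * w * t := by gcongr; exact hx.2
      gcongr
      exact hR.norm_yosida_le hf n
    · exact intervalIntegrable_const
    · refine Eventually.of_forall fun x hx => ?_
      rw [Set.uIoc_of_le ht] at hx
      have hx' : ((x.toNNReal : ℝ≥0) : ℝ) = x := Real.coe_toNNReal x hx.1.le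
      have h3 : Tendsto (fun n : ℕ => yosidaSemigroup R (l₀ + 1 + n) x
          (yosida R (l₀ + 1 + n) f - G)) atTop (𝓝 0) := by
        have h4 := (tendsto_iff_norm_sub_tendsto_zero.1 (hR.tendsto_yosida hf)).const_mul
          (M * Real.exp (2 * w * x))
        rw [mul_zero] at h4
        refine squeeze_zero_norm (fun n => ?_) h4
        exact (yosidaSemigroup R _ x).le_of_opNorm_le
          (hR.norm_yosidaSemigroup_le (lam_lt n) hx.1.le) _
      have h5 := h3.add (hT x.toNNReal G)
      rw [zero_add, hx'] at h5
      refine h5.congr fun n => ?_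
      rw [map_sub, sub_add_cancel]
  have h3 := (hT t.toNNReal f).sub_const f
  rw [Real.coe_toNNReal t ht] at h3
  exact tendsto_nhds_unique h3 (h2.congr fun n => (h1 n).symm)

theorem hille_yosida : ∃ T : C0Semigroup H, T.IsGeneratedBy A ∧
    ∀ K : Set H, IsClosedCone K → (∀ l > l₀, ∀ f ∈ K, R l f ∈ K) →
      ∀ t, ∀ f ∈ K, T.op t f ∈ K := by
  obtain ⟨T, hT⟩ := hR.exists_limit
  have hzero := limit_zero hT
  have hadd := hR.limit_add hT
  have hcont := hR.continuous_limit hT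
  let S : C0Semigroup H := ⟨T, hzero, hadd, hcont⟩
  have hfor : ∀ f G, A f G →
      Tendsto (fun t : ℝ≥0 => (((t : ℝ) : ℂ)⁻¹) • (S.op t f - f)) (𝓝[>] 0) (𝓝 G) := by
    intro f G hf
    refine C0Semigroup.isGeneratedBy_of_tendsto_real f G ?_
    have hc := S.continuous_orbit_real G
    have hd : HasDerivAt (fun t : ℝ => ∫ s in (0 : ℝ)..t, T s.toNNReal G) G 0 := by
      have : HasDerivAt (fun t : ℝ => ∫ s in (0 : ℝ)..t, S.op s.toNNReal G)
          (S.op (0 : ℝ).toNNReal G) 0 := intervalIntegral.integral_hasDerivAt_right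
        (hc.intervalIntegrable _ _) (hc.stronglyMeasurableAtFilter _ _) hc.continuousAt
      simpa [S.op_zero_apply] using this
    have h2 := hasDerivWithinAt_iff_tendsto_slope.1 (hd.hasDerivWithinAt (s := Set.Ici (0 : ℝ)))
    rw [Set.Ici_sdiff_left] at h2
    refine h2.congr' ?_
    filter_upwards [self_mem_nhdsWithin] with t ht
    rw [slope_def_module, ← hR.limit_sub_eq_integral hT hf (le_of_lt ht)]
    simp [S]
  refine ⟨S, fun f g => ⟨hfor f g, fun hfg => ?_⟩, fun K hK hRK t f hf => ?_⟩
  -- So far the generator extends `A`. The extension is not proper: `l - A` is onto for large `l`,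
  -- whereas `l` minus the generator is injective by the resolvent estimate. Hence `f` coincides
  -- with `R l (l f - g)`, which lies in the domain of `A`.
  · have hgen : S.IsGeneratedBy fun f g =>
        Tendsto (fun t : ℝ≥0 => (((t : ℝ) : ℂ)⁻¹) • (S.op t f - f)) (𝓝[>] 0) (𝓝 g) :=
      fun _ _ => Iff.rfl
    obtain ⟨M', hM', hb⟩ := hgen.norm_le
    set l := max (l₀ + 1) M'
    have hl : l₀ < l := by
      have := le_max_left (l₀ + 1) M'
      linarith
    have h1 := hR.right_inv l hl ((l : ℂ) • f - g)
    have h2 := hgen.add (hfor _ _ h1) (hgen.smul (-1) hfg)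
    have h3 := hb l (le_max_right _ _) _ _ h2
    have e : (l : ℂ) • (R l ((l : ℂ) • f - g) + (-1 : ℂ) • f)
        - ((l : ℂ) • R l ((l : ℂ) • f - g) - ((l : ℂ) • f - g) + (-1 : ℂ) • g) = 0 := by
      module
    rw [e, norm_zero, mul_zero] at h3
    have h4 : R l ((l : ℂ) • f - g) = f := by
      have := norm_le_zero_iff.1 h3
      rw [neg_one_smul, ← sub_eq_add_neg, sub_eq_zero] at this
      exact this
    rw [h4] at h1
    have e2 : (l : ℂ) • f - ((l : ℂ) • f - g) = g := by abel
    rwa [e2] at h1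
  · refine hK.isClosed.mem_of_tendsto (hT t f) (Eventually.of_forall fun n => ?_)
    have h1 := hK.exp_mem ((t : ℝ) • (((l₀ + 1 + n : ℝ) ^ 2) • R (l₀ + 1 + n))) (by
      intro g hg
      have := hK.smul_mem ((t : ℝ) * (l₀ + 1 + n) ^ 2) (by positivity) _
        (hRK _ (lam_lt n) g hg)
      rw [Complex.coe_smul, mul_smul] at this
      exact this) f hf
    have h2 := hK.smul_mem _ (Real.exp_pos (-(l₀ + 1 + n) * (t : ℝ))).le _ h1
    rw [Complex.coe_smul] at h2
    exact h2

end ResolventData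
end

/-! ### Quasi-dissipative operators on a Hilbert space with an equivalent inner product -/

noncomputable section

theorem exists_fixedPoint_of_norm_lt_one {𝕜 H : Type*} [NontriviallyNormedField 𝕜]
    [NormedAddCommGroup H] [NormedSpace 𝕜 H] [CompleteSpace H] {K : Set H} (hK : IsClosed K)
    (h0 : (0 : H) ∈ K) (hadd : ∀ f ∈ K, ∀ g ∈ K, f + g ∈ K)
    (S : H →L[𝕜] H) (hS : ‖S‖ < 1) (hSK : ∀ f ∈ K, S f ∈ K) (y : H) :
    ∃ z, z = S z + y ∧ (y ∈ K → z ∈ K) := by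
  let f : H → H := fun z => S z + y
  have hf : ContractingWith ‖S‖₊ f := by
    refine ⟨by exact_mod_cast hS, LipschitzWith.of_dist_le_mul fun a b => ?_⟩
    simp only [f, dist_add_right]
    exact S.lipschitz.dist_le_mul a b
  refine ⟨hf.fixedPoint f, hf.fixedPoint_isFixedPt.symm, fun hy => ?_⟩
  refine hK.mem_of_tendsto (hf.tendsto_iterate_fixedPoint 0) (Eventually.of_forall fun n => ?_)
  induction n with
  | zero => simpa using h0
  | succ n ih =>
    rw [Function.iterate_succ_apply']
    exact hadd _ (hSK _ ih) _ hy

/-- A single-valued linear operator, given by its graph. -/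
structure IsLinearGraph {H : Type*} [AddCommGroup H] [Module ℂ H] (A : H → H → Prop) : Prop where
  add : ∀ U G U' G', A U G → A U' G' → A (U + U') (G + G')
  smul : ∀ (c : ℂ) U G, A U G → A (c • U) (c • G)
  zero : A 0 0
  eq_zero : ∀ G, A 0 G → G = 0

section Hilbert

variable {H : Type*} [NormedAddCommGroup H] [InnerProductSpace ℂ H]

/-- A bounded symmetric coercive operator, used as a weight for an equivalent inner product. -/
structure IsWeight (Q : H →L[ℂ] H) (c : ℝ) : Prop where
  pos : 0 < c
  symm : ∀ U F, inner ℂ (Q U) F = inner ℂ U (Q F)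
  coercive : ∀ U, c * ‖U‖ ^ 2 ≤ (inner ℂ (Q U) U).re

/-- Quasi-dissipativity with respect to the weighted inner product. -/
def IsQuasiDissipative (Q : H →L[ℂ] H) (w : ℝ) (A : H → H → Prop) : Prop :=
  ∀ U G, A U G → (inner ℂ (Q U) G).re ≤ w * (inner ℂ (Q U) U).re

/-- Solvability of the resolvent equation for large `l`, by an element of `K` for right hand sides
in `K`. -/
def IsResolvable (K : Set H) (A : H → H → Prop) : Prop :=
  ∃ l₀ : ℝ, ∀ l ≥ l₀, ∀ F, ∃ U, A U ((l : ℂ) • U - F) ∧ (F ∈ K → U ∈ K)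

variable {Q : H →L[ℂ] H} {c w : ℝ} {A : H → H → Prop} {K : Set H}

theorem IsWeight.nonneg (hQ : IsWeight Q c) (U : H) : 0 ≤ (inner ℂ (Q U) U).re :=
  le_trans (mul_nonneg hQ.pos.le (sq_nonneg _)) (hQ.coercive U)

theorem IsWeight.le (Q : H →L[ℂ] H) (U : H) : (inner ℂ (Q U) U).re ≤ ‖Q‖ * ‖U‖ ^ 2 := by
  calc (inner ℂ (Q U) U).re ≤ ‖inner ℂ (Q U) U‖ := Complex.re_le_norm _
    _ ≤ ‖Q U‖ * ‖U‖ := norm_inner_le_norm _ _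
    _ ≤ ‖Q‖ * ‖U‖ * ‖U‖ := by gcongr; exact Q.le_opNorm U
    _ = _ := by ring

/-- Put `F = (l - A) U`. Dissipativity gives `(l - w) ⟨QU, U⟩ ≤ Re ⟨QU, F⟩`, and nonnegativity of
the weighted square of `(l - w) U - F` replaces the Cauchy-Schwarz inequality. -/
theorem IsWeight.sq_le (hQ : IsWeight Q c) (hA : IsQuasiDissipative Q w A) {l : ℝ} (hl : w < l)
    {U G : H} (hU : A U G) :
    (l - w) ^ 2 * (inner ℂ (Q U) U).re
      ≤ (inner ℂ (Q ((l : ℂ) • U - G)) ((l : ℂ) • U - G)).re := by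
  set F := (l : ℂ) • U - G with hF
  have h1 := hA U G hU
  have hG : G = (l : ℂ) • U - F := by rw [hF]; abel
  rw [hG, inner_sub_right, inner_smul_right, Complex.sub_re, Complex.re_ofReal_mul] at h1
  have h2 := hQ.nonneg (((l - w : ℝ) : ℂ) • U - F)
  have h3 : (inner ℂ (Q (((l - w : ℝ) : ℂ) • U - F)) (((l - w : ℝ) : ℂ) • U - F)).re
      = (l - w) ^ 2 * (inner ℂ (Q U) U).re - 2 * (l - w) * (inner ℂ (Q U) F).re
        + (inner ℂ (Q F) F).re := by
    have h4 : (inner ℂ (Q F) U).re = (inner ℂ (Q U) F).re := by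
      rw [hQ.symm, ← inner_conj_symm, Complex.conj_re]
    simp only [map_sub, map_smul, inner_sub_left, inner_sub_right, inner_smul_left,
      inner_smul_right, Complex.sub_re, Complex.conj_ofReal, Complex.re_ofReal_mul, h4]
    ring
  rw [h3] at h2
  have h5 : 0 < l - w := by linarith
  nlinarith

/-- As in the Lax-Milgram lemma, coercivity bounds `Q` from below, so its range is closed, and it
leaves no nonzero vector orthogonal to the range. -/
theorem IsWeight.surjective [CompleteSpace H] (hQ : IsWeight Q c) : Function.Surjective Q := by
  have hanti : AntilipschitzWith (Real.toNNReal c⁻¹) Q := by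
    refine ContinuousLinearMap.antilipschitz_of_bound Q fun U => ?_
    have hc := hQ.pos
    rw [Real.coe_toNNReal _ (by positivity)]
    have h1 := hQ.coercive U
    have h2 : (inner ℂ (Q U) U).re ≤ ‖Q U‖ * ‖U‖ :=
      (Complex.re_le_norm _).trans (norm_inner_le_norm _ _)
    rw [inv_mul_eq_div, le_div_iff₀ hc]
    by_cases hU : ‖U‖ = 0
    · rw [hU, zero_mul]; exact norm_nonneg _
    · have : 0 < ‖U‖ := lt_of_le_of_ne (norm_nonneg _) (Ne.symm hU)
      nlinarith
  have hcl : IsClosed (Q.range : Set H) := by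
    have := hanti.isClosed_range Q.uniformContinuous
    rw [LinearMap.coe_range]
    exact this
  have htop : Q.range = ⊤ := by
    have : CompleteSpace Q.range := hcl.completeSpace_coe
    rw [← Submodule.orthogonal_eq_bot_iff, Submodule.eq_bot_iff]
    intro h hh
    rw [Submodule.mem_orthogonal] at hh
    have h1 := hh (Q h) ⟨h, rfl⟩
    have h2 := hQ.coercive h
    rw [h1, Complex.zero_re] at h2
    have h3 : ‖h‖ ^ 2 ≤ 0 := by
      by_contra h4
      push Not at h4
      have := mul_pos hQ.pos h4
      linarith
    have h4 : ‖h‖ = 0 := by nlinarith [norm_nonneg h]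
    exact norm_eq_zero.1 h4
  exact LinearMap.range_eq_top.1 htop

/-- The weighted estimate makes solutions of the resolvent equation unique and bounded by the data;
solvability is the hypothesis. -/
theorem exists_resolvent (hQ : IsWeight Q c) (hlin : IsLinearGraph A)
    (hA : IsQuasiDissipative Q w A) (hres : IsResolvable K A) :
    ∃ (l₁ : ℝ) (R : ℝ → (H →L[ℂ] H)), ∀ l > l₁, w < l ∧
      (∀ F, A (R l F) ((l : ℂ) • R l F - F)) ∧
      (∀ U G, A U G → R l ((l : ℂ) • U - G) = U) ∧
      (∀ k : ℕ, ‖R l ^ k‖ ≤ √(‖Q‖ / c) / (l - w) ^ k) ∧ ∀ F ∈ K, R l F ∈ K := by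
  obtain ⟨l₀, hl₀⟩ := hres
  have hinj : ∀ l > w, ∀ U U' F, A U ((l : ℂ) • U - F) → A U' ((l : ℂ) • U' - F) → U = U' := by
    intro l hl U U' F h h'
    have h1 := hlin.add _ _ _ _ h (hlin.smul (-1) _ _ h')
    have h2 := hQ.sq_le hA hl h1
    have e : (l : ℂ) • (U + (-1 : ℂ) • U')
      - ((l : ℂ) • U - F + (-1 : ℂ) • ((l : ℂ) • U' - F)) = 0 := by module
    rw [e, map_zero, inner_zero_left, Complex.zero_re] at h2
    have h3 := hQ.coercive (U + (-1 : ℂ) • U')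
    have h4 : 0 < (l - w) ^ 2 * c := mul_pos (by nlinarith) hQ.pos
    have h5 : (l - w) ^ 2 * c * ‖U + (-1 : ℂ) • U'‖ ^ 2 ≤ 0 := by
      calc _ = (l - w) ^ 2 * (c * ‖U + (-1 : ℂ) • U'‖ ^ 2) := by ring
        _ ≤ _ := mul_le_mul_of_nonneg_left h3 (sq_nonneg _)
        _ ≤ 0 := h2
    have h6 : ‖U + (-1 : ℂ) • U'‖ ^ 2 ≤ 0 := by
      by_contra h7; push Not at h7; nlinarith
    have h7 : ‖U + (-1 : ℂ) • U'‖ = 0 := by nlinarith [norm_nonneg (U + (-1 : ℂ) • U')]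
    have h8 := norm_eq_zero.1 h7
    rw [neg_one_smul, ← sub_eq_add_neg, sub_eq_zero] at h8
    exact h8
  have key : ∀ l > max l₀ w, ∃ R : H →L[ℂ] H,
      (∀ F, A (R F) ((l : ℂ) • R F - F)) ∧
      (∀ U G, A U G → R ((l : ℂ) • U - G) = U) ∧
      (∀ k : ℕ, ‖R ^ k‖ ≤ √(‖Q‖ / c) / (l - w) ^ k) ∧ ∀ F ∈ K, R F ∈ K := by
    intro l hl
    have hl1 : w < l := lt_of_le_of_lt (le_max_right _ _) hl
    have hl2 : l₀ ≤ l := (lt_of_le_of_lt (le_max_left _ _) hl).le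
    have hlw : 0 < l - w := by linarith
    choose r hr hrK using hl₀ l hl2
    -- The chosen solution depends linearly on the data because it is unique.
    let L : H →ₗ[ℂ] H :=
      { toFun := r
        map_add' := fun F F' => by
          refine hinj l hl1 _ _ (F + F') (hr _) ?_
          have := hlin.add _ _ _ _ (hr F) (hr F')
          convert this using 1
          rw [smul_add]; abel
        map_smul' := fun a F => by
          refine hinj l hl1 _ _ (a • F) (hr _) ?_
          have := hlin.smul a _ _ (hr F)
          convert this using 1
          · rfl
          · change (l : ℂ) • a • r F - a • F = _
            rw [smul_sub, smul_comm] }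
    have hsq : ∀ F, (l - w) ^ 2 * (inner ℂ (Q (L F)) (L F)).re ≤ (inner ℂ (Q F) F).re := by
      intro F
      have := hQ.sq_le hA hl1 (hr F)
      rwa [sub_sub_cancel] at this
    have hb : ∀ U F (a : ℝ), 0 < a → a ^ 2 * (inner ℂ (Q U) U).re ≤ (inner ℂ (Q F) F).re →
        ‖U‖ ≤ √(‖Q‖ / c) / a * ‖F‖ := by
      intro U F a ha h
      have hc := hQ.pos
      refine abs_le_of_sq_le_sq' ?_ (by positivity) |>.2
      rw [mul_pow, div_pow, Real.sq_sqrt (by positivity)]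
      have h1 := IsWeight.le Q F
      have h2 := hQ.coercive U
      have h3 : a ^ 2 * (c * ‖U‖ ^ 2) ≤ ‖Q‖ * ‖F‖ ^ 2 :=
        (mul_le_mul_of_nonneg_left h2 (sq_nonneg a)).trans (h.trans h1)
      rw [div_div, div_mul_eq_mul_div, le_div_iff₀ (by positivity)]
      linarith
    let R : H →L[ℂ] H := L.mkContinuous (√(‖Q‖ / c) / (l - w)) fun F => hb _ _ _ hlw (hsq F)
    -- The estimate is iterated in the weighted norm, where its constant is exactly `1 / (l - w)`.
    -- The norms are compared only afterwards, so `√(‖Q‖ / c)` is not raised to the power `k`.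
    have hpow : ∀ (k : ℕ) F, ((l - w) ^ k) ^ 2 * (inner ℂ (Q ((R ^ k) F)) ((R ^ k) F)).re
        ≤ (inner ℂ (Q F) F).re := by
      intro k F
      induction k with
      | zero => simp
      | succ k ih =>
        have e : (R ^ (k + 1)) F = L ((R ^ k) F) := by rw [pow_succ']; rfl
        rw [e]
        refine le_trans ?_ ih
        have := mul_le_mul_of_nonneg_left (hsq ((R ^ k) F)) (sq_nonneg ((l - w) ^ k))
        calc _ = ((l - w) ^ k) ^ 2 * ((l - w) ^ 2
            * (inner ℂ (Q (L ((R ^ k) F))) (L ((R ^ k) F))).re) := by ring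
          _ ≤ _ := this
    refine ⟨R, hr, fun U G hU => ?_, fun k => ?_, hrK⟩
    · refine hinj l hl1 _ _ ((l : ℂ) • U - G) (hr _) ?_
      rwa [sub_sub_cancel]
    · exact ContinuousLinearMap.opNorm_le_bound _ (by positivity)
        fun F => hb _ _ _ (by positivity) (hpow k F)
  choose R hR using key
  classical
  refine ⟨max l₀ w, fun l => if h : l > max l₀ w then R l h else 0, fun l hl => ?_⟩
  simp only [dif_pos hl]
  exact ⟨lt_of_le_of_lt (le_max_right _ _) hl, hR l hl⟩

/-- A vector orthogonal to the domain has the form `Q V`. If `(l - A) U = V`, then `⟨QU, V⟩ = 0`,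
and dissipativity with `l > w` forces `U = 0`; single-valuedness of `A` at `0` then gives `V = 0`.
-/
theorem dense_of_isResolvable [CompleteSpace H] (hQ : IsWeight Q c) (hlin : IsLinearGraph A)
    (hA : IsQuasiDissipative Q w A) (hres : IsResolvable K A) : Dense {U | ∃ G, A U G} := by
  let D : Submodule ℂ H :=
    { carrier := {U | ∃ G, A U G}
      add_mem' := by
        rintro U U' ⟨G, h⟩ ⟨G', h'⟩
        exact ⟨_, hlin.add _ _ _ _ h h'⟩
      zero_mem' := ⟨0, hlin.zero⟩
      smul_mem' := by
        rintro a U ⟨G, h⟩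
        exact ⟨_, hlin.smul a _ _ h⟩ }
  have hD : D.topologicalClosure = ⊤ := by
    rw [Submodule.topologicalClosure_eq_top_iff, Submodule.eq_bot_iff]
    intro h hh
    rw [Submodule.mem_orthogonal] at hh
    obtain ⟨V, rfl⟩ := hQ.surjective h
    obtain ⟨l₀, hl₀⟩ := hres
    set l := max l₀ (w + 1)
    have hlw : 0 < l - w := by linarith [le_max_right l₀ (w + 1)]
    obtain ⟨U, hU, -⟩ := hl₀ l (le_max_left _ _) V
    have h1 := hh U ⟨_, hU⟩
    rw [← hQ.symm] at h1
    have h2 := hA U _ hU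
    rw [inner_sub_right, inner_smul_right, h1, sub_zero, Complex.re_ofReal_mul] at h2
    have h3 := hQ.coercive U
    have h4 : (inner ℂ (Q U) U).re ≤ 0 := by
      by_contra h5; push Not at h5; nlinarith
    have h5 : ‖U‖ = 0 := by
      have h6 : ‖U‖ ^ 2 ≤ 0 := by
        by_contra h7; push Not at h7
        have := mul_pos hQ.pos h7
        linarith
      nlinarith [norm_nonneg U]
    rw [norm_eq_zero] at h5
    rw [h5, smul_zero, zero_sub] at hU
    have h6 := hlin.eq_zero _ hU
    rw [neg_eq_zero] at h6
    rw [h6, map_zero]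
  have h1 := Submodule.dense_iff_topologicalClosure_eq_top.2 hD
  exact h1

theorem exists_semigroup_of_isQuasiDissipative [CompleteSpace H] (hQ : IsWeight Q c)
    (hlin : IsLinearGraph A) (hA : IsQuasiDissipative Q w A) (hK : IsClosedCone K)
    (hres : IsResolvable K A) :
    ∃ T : C0Semigroup H, T.IsGeneratedBy A ∧ ∀ t, ∀ f ∈ K, T.op t f ∈ K := by
  -- The Hille-Yosida data ask for a nonnegative growth rate, so `w` is enlarged.
  have hA' : IsQuasiDissipative Q (max w 0) A := fun U G hU => (hA U G hU).trans (by
    gcongr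
    · exact hQ.nonneg U
    · exact le_max_left _ _)
  obtain ⟨l₁, R, hR⟩ := exists_resolvent hQ hlin hA' hres
  set l₂ := max l₁ (2 * max w 0)
  have hlt : ∀ l > l₂, l > l₁ := fun l hl => lt_of_le_of_lt (le_max_left _ _) hl
  have hdata : ResolventData A R l₂ (max w 0) (√(‖Q‖ / c)) :=
    { w_nonneg := le_max_right _ _
      le_l₀ := le_max_right _ _
      right_inv := fun l hl => (hR l (hlt l hl)).2.1
      left_inv := fun l hl => (hR l (hlt l hl)).2.2.1
      norm_pow_le := fun l hl => (hR l (hlt l hl)).2.2.2.1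
      dense := dense_of_isResolvable hQ hlin hA hres }
  obtain ⟨T, hT, hTK⟩ := hdata.hille_yosida
  exact ⟨T, hT, hTK K hK fun l hl => (hR l (hlt l hl)).2.2.2.2⟩

/-- Bounded perturbations: the operator `A + N - a`. -/
theorem exists_semigroup_of_perturbation [CompleteSpace H] (hQ : IsWeight Q c)
    (hlin : IsLinearGraph A) (hA : IsQuasiDissipative Q w A) (hK : IsClosedCone K)
    (hres : IsResolvable K A) (N : H →L[ℂ] H) (hN : ∀ f ∈ K, N f ∈ K) (a : ℝ) :
    ∃ T : C0Semigroup H, T.IsGeneratedBy (fun U F => A U (F + (a : ℂ) • U - N U)) ∧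
      ∀ t, ∀ f ∈ K, T.op t f ∈ K := by
  refine exists_semigroup_of_isQuasiDissipative (w := w - a + ‖Q‖ * ‖N‖ / c) hQ ?_ ?_ hK ?_
  · refine ⟨fun U G U' G' h h' => ?_, fun s U G h => ?_, ?_, fun G h => ?_⟩
    · convert hlin.add _ _ _ _ h h' using 1
      rw [smul_add, map_add]; abel
    · convert hlin.smul s _ _ h using 1
      rw [smul_sub, smul_add, map_smul, smul_comm]
    · simpa using hlin.zero
    · have := hlin.eq_zero (G + (a : ℂ) • (0 : H) - N 0) h
      simpa using this
  · intro U F hU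
    have h1 := hA _ _ hU
    rw [inner_sub_right, inner_add_right, inner_smul_right, Complex.sub_re, Complex.add_re,
      Complex.re_ofReal_mul] at h1
    have h2 : (inner ℂ (Q U) (N U)).re ≤ ‖Q‖ * ‖N‖ / c * (inner ℂ (Q U) U).re := by
      have hc := hQ.pos
      calc (inner ℂ (Q U) (N U)).re ≤ ‖inner ℂ (Q U) (N U)‖ := Complex.re_le_norm _
        _ ≤ ‖Q U‖ * ‖N U‖ := norm_inner_le_norm _ _
        _ ≤ (‖Q‖ * ‖U‖) * (‖N‖ * ‖U‖) := by
          gcongr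
          · exact Q.le_opNorm U
          · exact N.le_opNorm U
        _ = ‖Q‖ * ‖N‖ / c * (c * ‖U‖ ^ 2) := by field_simp
        _ ≤ _ := by gcongr; exact hQ.coercive U
    linarith
  · obtain ⟨l₁, R, hR⟩ := exists_resolvent hQ hlin hA hres
    set M := √(‖Q‖ / c) * ‖N‖
    have hM : 0 ≤ M := by positivity
    refine ⟨max (l₁ + 1) (w + M + 1) - a, fun l hl F => ?_⟩
    have hl1 : l + a > l₁ := by linarith [le_max_left (l₁ + 1) (w + M + 1)]
    have hl2 : l + a - w > M := by linarith [le_max_right (l₁ + 1) (w + M + 1)]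
    obtain ⟨-, h1, -, h3, h4⟩ := hR (l + a) hl1
    have h5 := h3 1
    rw [pow_one, pow_one] at h5
    have hnorm : ‖(R (l + a)).comp N‖ < 1 := by
      calc ‖(R (l + a)).comp N‖ ≤ ‖R (l + a)‖ * ‖N‖ := ContinuousLinearMap.opNorm_comp_le _ _
        _ ≤ √(‖Q‖ / c) / (l + a - w) * ‖N‖ := by gcongr
        _ = M / (l + a - w) := by ring
        _ < 1 := by rw [div_lt_one (by linarith)]; exact hl2
    -- The equation `(l - (A + N - a)) z = F` reads `z = R (l + a) (N z + F)`. The iteration started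
    -- at `0` stays in `K` when `F` does, since both `R (l + a)` and `N` preserve `K`.
    obtain ⟨z, hz, hzK⟩ := exists_fixedPoint_of_norm_lt_one hK.isClosed hK.zero_mem hK.add_mem
      ((R (l + a)).comp N) hnorm (fun f hf => h4 _ (hN f hf)) (R (l + a) F)
    refine ⟨z, ?_, fun hF => hzK (h4 F hF)⟩
    have h6 := h1 (N z + F)
    have h7 : R (l + a) (N z + F) = z := by
      rw [map_add]; exact hz.symm
    rw [h7] at h6
    convert h6 using 1
    push_cast
    module

end Hilbert
end

noncomputable section

/-! ### Sobolev functions of one variable -/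

/-- `w` is, on `[0, ℓ]`, a primitive of the integrable function `g`. -/
structure IsPrimitive (ℓ : ℝ) (w g : ℝ → ℂ) : Prop where
  integrable : IntervalIntegrable g volume 0 ℓ
  eq_add : ∀ x ∈ Set.Icc 0 ℓ, w x = w 0 + ∫ t in (0 : ℝ)..x, g t

theorem absolutelyContinuousOnInterval_const {F : Type*} [SeminormedAddCommGroup F] (a b : ℝ)
    (z : F) : AbsolutelyContinuousOnInterval (fun _ : ℝ => z) a b :=
  ((LipschitzWith.const z).lipschitzOnWith (s := Set.uIcc a b)).absolutelyContinuousOnInterval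

/-- The real and imaginary parts are indefinite integrals of real functions, and their combination
agrees with the given function on the interval, which is all that the criterion inspects. -/
theorem IntervalIntegrable.absolutelyContinuousOnInterval_integral_complex {g : ℝ → ℂ} {a b : ℝ}
    (hg : IntervalIntegrable g volume a b) :
    AbsolutelyContinuousOnInterval (fun x => ∫ t in a..x, g t) a b := by
  have hre : IntervalIntegrable (fun t => (g t).re) volume a b :=
    ⟨Complex.reCLM.integrable_comp hg.1, Complex.reCLM.integrable_comp hg.2⟩
  have him : IntervalIntegrable (fun t => (g t).im) volume a b :=
    ⟨Complex.imCLM.integrable_comp hg.1, Complex.imCLM.integrable_comp hg.2⟩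
  have h1 := (hre.absolutelyContinuousOnInterval_intervalIntegral
    (Set.left_mem_uIcc (a := a) (b := b))).fun_smul
    (absolutelyContinuousOnInterval_const a b (1 : ℂ))
  have h2 := (him.absolutelyContinuousOnInterval_intervalIntegral
    (Set.left_mem_uIcc (a := a) (b := b))).fun_smul
    (absolutelyContinuousOnInterval_const a b Complex.I)
  have h3 := h1.fun_add h2
  rw [absolutelyContinuousOnInterval_iff] at h3 ⊢
  intro ε hε
  obtain ⟨δ, hδ, H⟩ := h3 ε hε
  refine ⟨δ, hδ, fun E hE hlen => ?_⟩
  convert H E hE hlen using 1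
  have hx : ∀ x ∈ Set.uIcc a b, ∫ t in a..x, g t
      = (∫ t in a..x, (g t).re) • (1 : ℂ) + (∫ t in a..x, (g t).im) • Complex.I := by
    intro x hx
    have hgx : IntervalIntegrable g volume a x :=
      hg.mono_set (Set.uIcc_subset_uIcc Set.left_mem_uIcc hx)
    have h1 := Complex.reCLM.intervalIntegral_comp_comm hgx
    have h2 := Complex.imCLM.intervalIntegral_comp_comm hgx
    simp only [Complex.reCLM_apply, Complex.imCLM_apply] at h1 h2
    rw [h1, h2]
    apply Complex.ext <;> simp
  refine Finset.sum_congr rfl fun i hi => ?_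
  rw [hx _ (hE.1 i hi).1, hx _ (hE.1 i hi).2]

namespace IsPrimitive

variable {ℓ : ℝ} {w g w' g' : ℝ → ℂ}

theorem absolutelyContinuousOnInterval (h : IsPrimitive ℓ w g) (hℓ : 0 ≤ ℓ) :
    AbsolutelyContinuousOnInterval w 0 ℓ := by
  have h1 := (absolutelyContinuousOnInterval_const 0 ℓ (w 0)).fun_add
    h.integrable.absolutelyContinuousOnInterval_integral_complex
  rw [absolutelyContinuousOnInterval_iff] at h1 ⊢
  intro ε hε
  obtain ⟨δ, hδ, H⟩ := h1 ε hε
  refine ⟨δ, hδ, fun E hE hlen => ?_⟩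
  convert H E hE hlen using 1
  refine Finset.sum_congr rfl fun i hi => ?_
  have h2 := hE.1 i hi
  rw [Set.uIcc_of_le hℓ] at h2
  rw [h.eq_add _ h2.1, h.eq_add _ h2.2]

theorem continuousOn (h : IsPrimitive ℓ w g) (hℓ : 0 ≤ ℓ) : ContinuousOn w (Set.Icc 0 ℓ) := by
  have := (h.absolutelyContinuousOnInterval hℓ).continuousOn
  rwa [Set.uIcc_of_le hℓ] at this

theorem ae_hasDerivAt (h : IsPrimitive ℓ w g) (hℓ : 0 ≤ ℓ) :
    ∀ᵐ x, x ∈ Set.Ioo 0 ℓ → HasDerivAt w (g x) x := by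
  filter_upwards [h.integrable.ae_hasDerivAt_integral] with x hx hxm
  have h1 := (hx (by rw [Set.uIcc_of_le hℓ]; exact Set.Ioo_subset_Icc_self hxm) 0
    (by rw [Set.uIcc_of_le hℓ]; exact Set.left_mem_Icc.2 hℓ)).const_add (w 0)
  refine h1.congr_of_eventuallyEq ?_
  filter_upwards [Ioo_mem_nhds hxm.1 hxm.2] with y hy
  exact h.eq_add y (Set.Ioo_subset_Icc_self hy)

/-- The difference of `w` and the indefinite integral of `g` is absolutely continuous with
derivative zero almost everywhere, hence constant. -/
theorem of_absolutelyContinuousOnInterval (hℓ : 0 ≤ ℓ)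
    (hw : AbsolutelyContinuousOnInterval w 0 ℓ) (hg : IntervalIntegrable g volume 0 ℓ)
    (h : ∀ᵐ x, x ∈ Set.Ioo 0 ℓ → HasDerivAt w (g x) x) : IsPrimitive ℓ w g := by
  refine ⟨hg, ?_⟩
  have hG := hg.absolutelyContinuousOnInterval_integral_complex
  have h0 : ∀ᵐ x : ℝ, x ≠ 0 := by simp [ae_iff, measure_singleton]
  have h1 : ∀ᵐ x : ℝ, x ≠ ℓ := by simp [ae_iff, measure_singleton]
  obtain ⟨C, hC⟩ := (hw.fun_sub hG).const_of_ae_hasDerivAt_zero (by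
    filter_upwards [h, hg.ae_hasDerivAt_integral, h0, h1] with x hx1 hx2 hx3 hx4 hx5
    have hx6 := hx5
    rw [Set.uIcc_of_le hℓ] at hx6
    have := (hx1 ⟨lt_of_le_of_ne hx6.1 hx3.symm, lt_of_le_of_ne hx6.2 hx4⟩).sub
      (hx2 hx5 0 Set.left_mem_uIcc)
    rwa [sub_self] at this)
  intro x hx
  rw [← Set.uIcc_of_le hℓ] at hx
  have e1 := hC x hx
  have e2 := hC 0 Set.left_mem_uIcc
  simp only [intervalIntegral.integral_same, sub_zero] at e2
  rw [e2, ← e1]; ring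

/-- Products of absolutely continuous functions are absolutely continuous, and the product rule
holds almost everywhere. The integrations by parts below are instances of this. -/
theorem mul (h : IsPrimitive ℓ w g) (h' : IsPrimitive ℓ w' g') (hℓ : 0 ≤ ℓ) :
    IsPrimitive ℓ (fun x => w x * w' x) (fun x => g x * w' x + w x * g' x) := by
  have hac := (h.absolutelyContinuousOnInterval hℓ).fun_smul (h'.absolutelyContinuousOnInterval hℓ)
  refine of_absolutelyContinuousOnInterval hℓ hac ?_ ?_
  · have hc := h.continuousOn hℓ
    have hc' := h'.continuousOn hℓ
    rw [← Set.uIcc_of_le hℓ] at hc hc'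
    exact (h.integrable.mul_continuousOn hc').add (h'.integrable.continuousOn_mul hc)
  · filter_upwards [h.ae_hasDerivAt hℓ, h'.ae_hasDerivAt hℓ] with x h1 h2 hx
    exact (h1 hx).mul (h2 hx)

theorem star (h : IsPrimitive ℓ w g) :
    IsPrimitive ℓ (fun x => (starRingEnd ℂ) (w x)) (fun x => (starRingEnd ℂ) (g x)) := by
  refine ⟨⟨Complex.conjCLE.toContinuousLinearMap.integrable_comp h.integrable.1,
    Complex.conjCLE.toContinuousLinearMap.integrable_comp h.integrable.2⟩, fun x hx => ?_⟩
  rw [h.eq_add x hx, map_add]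
  congr 1
  rw [intervalIntegral, intervalIntegral, map_sub, integral_conj, integral_conj]

theorem integral_eq (h : IsPrimitive ℓ w g) (hℓ : 0 ≤ ℓ) : ∫ x in (0 : ℝ)..ℓ, g x = w ℓ - w 0 := by
  rw [h.eq_add ℓ (Set.right_mem_Icc.2 hℓ)]; ring

theorem of_hasDerivAt (hℓ : 0 ≤ ℓ) (hw : ∀ x ∈ Set.Icc 0 ℓ, HasDerivAt w (g x) x)
    (hg : ContinuousOn g (Set.Icc 0 ℓ)) : IsPrimitive ℓ w g := by
  rw [← Set.uIcc_of_le hℓ] at hg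
  refine ⟨hg.intervalIntegrable, fun x hx => ?_⟩
  have hsub : Set.uIcc 0 x ⊆ Set.Icc 0 ℓ := by
    rw [Set.uIcc_of_le hx.1]; exact Set.Icc_subset_Icc_right hx.2
  rw [intervalIntegral.integral_eq_sub_of_hasDerivAt (f := w) (fun y hy => hw y (hsub hy))
    (hg.mono (hsub.trans (by rw [Set.uIcc_of_le hℓ]))).intervalIntegrable]
  ring

theorem congr (h : IsPrimitive ℓ w g) (hℓ : 0 ≤ ℓ) (hw : ∀ x ∈ Set.Icc 0 ℓ, w' x = w x)
    (hg : ∀ᵐ x ∂(volume.restrict (Set.Ioo 0 ℓ)), g' x = g x) : IsPrimitive ℓ w' g' := by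
  have hg1 : ∀ᵐ x ∂(volume.restrict (Set.Ioc 0 ℓ)), g' x = g x := by
    rwa [restrict_Ioo_eq_restrict_Ioc] at hg
  have hint : IntervalIntegrable g' volume 0 ℓ := by
    rw [intervalIntegrable_iff_integrableOn_Ioc_of_le hℓ]
    have := (intervalIntegrable_iff_integrableOn_Ioc_of_le hℓ).1 h.integrable
    exact Integrable.congr this (hg1.mono fun x hx => hx.symm)
  refine ⟨hint, fun x hx => ?_⟩
  rw [hw x hx, hw 0 (Set.left_mem_Icc.2 hℓ), h.eq_add x hx]
  congr 1
  rw [intervalIntegral.integral_of_le hx.1, intervalIntegral.integral_of_le hx.1]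
  refine integral_congr_ae ?_
  have := ae_restrict_of_ae_restrict_of_subset (Set.Ioc_subset_Ioc_right hx.2) hg1
  exact this.mono fun x hx => hx.symm

end IsPrimitive

theorem integral_Ioo_eq {F : Type*} [NormedAddCommGroup F] [NormedSpace ℝ F] {ℓ : ℝ} (hℓ : 0 ≤ ℓ)
    (f : ℝ → F) : ∫ x in Set.Ioo 0 ℓ, f x = ∫ x in (0 : ℝ)..ℓ, f x := by
  rw [intervalIntegral.integral_of_le hℓ, integral_Ioc_eq_integral_Ioo]

/-- The lemma of du Bois-Reymond. -/
theorem ae_eq_const_of_integral_deriv_eq_zero {ℓ : ℝ} (hℓ : 0 < ℓ) {h : ℝ → ℂ}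
    (hh : IntegrableOn h (Set.Ioo 0 ℓ))
    (H : ∀ φ : ℝ → ℝ, ContDiff ℝ ∞ φ → HasCompactSupport φ → tsupport φ ⊆ Set.Ioo 0 ℓ →
      ∫ x in Set.Ioo 0 ℓ, deriv φ x • h x = 0) :
    ∃ C : ℂ, ∀ᵐ x ∂(volume.restrict (Set.Ioo 0 ℓ)), h x = C := by
  obtain ⟨ψ₀, hψ₀, hc₀, hs₀, hi₀⟩ : ∃ ψ₀ : ℝ → ℝ, ContDiff ℝ ∞ ψ₀ ∧ HasCompactSupport ψ₀ ∧
      tsupport ψ₀ ⊆ Set.Ioo 0 ℓ ∧ ∫ x, ψ₀ x = 1 := by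
    let b : ContDiffBump (ℓ / 2) := ⟨ℓ / 8, ℓ / 4, by positivity, by linarith⟩
    refine ⟨b.normed volume, b.contDiff_normed, b.hasCompactSupport_normed, ?_, b.integral_normed⟩
    rw [b.tsupport_normed_eq, Real.closedBall_eq_Icc]
    intro x hx
    simp only [b] at hx
    exact ⟨by linarith [hx.1], by linarith [hx.2]⟩
  have hbd : ∀ ψ : ℝ → ℝ, ContDiff ℝ ∞ ψ → HasCompactSupport ψ →
      IntegrableOn (fun x => ψ x • h x) (Set.Ioo 0 ℓ) := by
    intro ψ hψ hc
    obtain ⟨C, hC⟩ := hc.exists_bound_of_continuous hψ.continuous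
    exact hh.bdd_smul C hψ.continuous.aestronglyMeasurable (Eventually.of_forall hC)
  set C := ∫ x in Set.Ioo 0 ℓ, ψ₀ x • h x with hCdef
  have hprim : ∀ ψ : ℝ → ℝ, ContDiff ℝ ∞ ψ → HasCompactSupport ψ → tsupport ψ ⊆ Set.Ioo 0 ℓ →
      ∫ x in Set.Ioo 0 ℓ, ψ x • (h x - C) = 0 := by
    intro ψ hψ hc hs
    set a := ∫ x, ψ x
    -- A test function is the derivative of a test function exactly when its integral vanishes;
    -- subtracting `a ψ₀` achieves that, and `C` is the resulting correction.
    let η : ℝ → ℝ := fun x => ψ x - a * ψ₀ x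
    have hη : ContDiff ℝ ∞ η := hψ.sub (contDiff_const.mul hψ₀)
    have hηs : tsupport η ⊆ tsupport ψ ∪ tsupport ψ₀ := by
      refine (tsupport_sub ψ (fun x => a * ψ₀ x)).trans (Set.union_subset_union_right _ ?_)
      exact tsupport_mul_subset_right
    have hηc : HasCompactSupport η :=
      (hc.isCompact.union hc₀.isCompact).of_isClosed_subset (isClosed_tsupport _) hηs
    have hη01 : tsupport η ⊆ Set.Ioo 0 ℓ := hηs.trans (Set.union_subset hs hs₀)
    have hηi : ∫ x, η x = 0 := by
      rw [integral_sub (hψ.continuous.integrable_of_hasCompactSupport hc)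
        ((hψ₀.continuous.integrable_of_hasCompactSupport hc₀).const_mul a), integral_const_mul, hi₀]
      simp [a]
    let φ : ℝ → ℝ := fun x => ∫ t in (0 : ℝ)..x, η t
    have hφd : ∀ x, HasDerivAt φ (η x) x := fun x =>
      intervalIntegral.integral_hasDerivAt_right (hη.continuous.intervalIntegrable _ _)
        (hη.continuous.stronglyMeasurableAtFilter _ _) hη.continuous.continuousAt
    have hderiv : deriv φ = η := funext fun x => (hφd x).deriv
    have hφ : ContDiff ℝ ∞ φ := by
      rw [contDiff_infty_iff_deriv]
      exact ⟨fun x => (hφd x).differentiableAt, by rw [hderiv]; exact hη⟩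
    obtain ⟨p, q, hp0, hpq, hqℓ, hpqs⟩ : ∃ p q, 0 < p ∧ p ≤ q ∧ q < ℓ ∧
        tsupport η ⊆ Set.Icc p q := by
      rcases (tsupport η).eq_empty_or_nonempty with he | hne
      · exact ⟨ℓ / 2, ℓ / 2, by positivity, le_rfl, by linarith, by simp [he]⟩
      · obtain ⟨p, hp, hp'⟩ := hηc.isCompact.exists_isLeast hne
        obtain ⟨q, hq, hq'⟩ := hηc.isCompact.exists_isGreatest hne
        exact ⟨p, q, (hη01 hp).1, hp' hq, (hη01 hq).2, fun x hx => ⟨hp' hx, hq' hx⟩⟩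
    have hη0 : ∀ x, x ∉ Set.Icc p q → η x = 0 := fun x hx =>
      image_eq_zero_of_notMem_tsupport fun h => hx (hpqs h)
    have hφ0 : ∀ x, x ∉ Set.Icc p q → φ x = 0 := by
      intro x hx
      rcases lt_or_ge x p with h1 | h1
      · refine intervalIntegral.integral_zero_ae (Eventually.of_forall fun t ht => hη0 t ?_)
        rintro ⟨h2, h3⟩
        rcases le_total 0 x with h4 | h4
        · rw [Set.uIoc_of_le h4] at ht; linarith [ht.2]
        · rw [Set.uIoc_of_ge h4] at ht; linarith [ht.2]
      · have h2 : q < x := by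
          by_contra h3; push Not at h3; exact hx ⟨h1, h3⟩
        have h3 : ∫ t, η t = ∫ t in (0 : ℝ)..x, η t := by
          rw [intervalIntegral.integral_of_le (by linarith)]
          refine (setIntegral_eq_integral_of_forall_compl_eq_zero fun t ht => hη0 t ?_).symm
          rintro ⟨h4, h5⟩
          exact ht ⟨by linarith, by linarith⟩
        simp only [φ]
        rw [← h3, hηi]
    have hφs : tsupport φ ⊆ Set.Icc p q :=
      closure_minimal (fun x hx => by
        by_contra h1; exact hx (hφ0 x h1)) isClosed_Icc
    have hφc : HasCompactSupport φ :=
      isCompact_Icc.of_isClosed_subset (isClosed_tsupport _) hφs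
    have h1 := H φ hφ hφc (hφs.trans fun x hx => ⟨by linarith [hx.1], by linarith [hx.2]⟩)
    rw [hderiv] at h1
    have h2 : ∫ x in Set.Ioo 0 ℓ, ψ x • h x = (a : ℂ) * C := by
      have e : ∀ x, ψ x • h x = η x • h x + (a : ℂ) * (ψ₀ x • h x) := by
        intro x
        simp only [η, Complex.real_smul]; push_cast; ring
      simp_rw [e]
      rw [integral_add (hbd η hη hηc) ((hbd ψ₀ hψ₀ hc₀).const_mul _), h1, zero_add,
        integral_const_mul]
    have h3 : ∫ x in Set.Ioo 0 ℓ, ψ x • C = (a : ℂ) * C := by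
      rw [integral_smul_const, setIntegral_eq_integral_of_forall_compl_eq_zero]
      · rfl
      · intro x hx
        exact image_eq_zero_of_notMem_tsupport fun h => hx (hs h)
    simp_rw [smul_sub]
    rw [integral_sub (hbd ψ hψ hc), h2, h3, sub_self]
    exact ((hψ.continuous.integrable_of_hasCompactSupport hc).smul_const C).integrableOn
  refine ⟨C, ?_⟩
  have hint : IntegrableOn (fun x => h x - C) (Set.Ioo 0 ℓ) :=
    Integrable.sub hh (integrableOn_const (by simp))
  have h1 := isOpen_Ioo.ae_eq_zero_of_integral_contDiff_smul_eq_zero (μ := volume)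
    hint.locallyIntegrableOn (by
      intro ψ hψ hc hs
      rw [← setIntegral_eq_integral_of_forall_compl_eq_zero (s := Set.Ioo 0 ℓ)]
      · exact hprim ψ hψ hc hs
      · intro x hx
        rw [image_eq_zero_of_notMem_tsupport fun h => hx (hs h), zero_smul])
  rw [ae_restrict_iff' measurableSet_Ioo]
  filter_upwards [h1] with x hx hxm
  exact sub_eq_zero.1 (hx hxm)

theorem L2Interval.memLp_coord {ℓ : ℝ} {n : ℕ} (u : L2Interval ℓ n) (i : Fin n) :
    MemLp (fun x => u x i) 2 (volume.restrict (Set.Ioo 0 ℓ)) :=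
  (EuclideanSpace.proj (𝕜 := ℂ) i).comp_memLp' (Lp.memLp u)

theorem L2Interval.integrable_coord {ℓ : ℝ} {n : ℕ} (u : L2Interval ℓ n) (i : Fin n) :
    IntegrableOn (fun x => u x i) (Set.Ioo 0 ℓ) :=
  (L2Interval.memLp_coord u i).integrable (by norm_num)

theorem L2Interval.integrable {ℓ : ℝ} {n : ℕ} (u : L2Interval ℓ n) :
    IntegrableOn (fun x => u x) (Set.Ioo 0 ℓ) :=
  (Lp.memLp u).integrable (by norm_num)

theorem integrableOn_smul_of_contDiff {F : Type*} [NormedAddCommGroup F] [NormedSpace ℝ F]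
    {ℓ : ℝ} {f : ℝ → F} (hf : IntegrableOn f (Set.Ioo 0 ℓ)) {φ : ℝ → ℝ} (hφ : Continuous φ)
    (hc : HasCompactSupport φ) : IntegrableOn (fun x => φ x • f x) (Set.Ioo 0 ℓ) := by
  obtain ⟨C, hC⟩ := hc.exists_bound_of_continuous hφ
  exact hf.bdd_smul C hφ.aestronglyMeasurable (Eventually.of_forall hC)

theorem IsPrimitive.integral_deriv_smul {ℓ : ℝ} (hℓ : 0 < ℓ) {w g : ℝ → ℂ}
    (h : IsPrimitive ℓ w g) {φ : ℝ → ℝ} (hφ : ContDiff ℝ ∞ φ) (hs : tsupport φ ⊆ Set.Ioo 0 ℓ) :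
    ∫ x in Set.Ioo 0 ℓ, deriv φ x • w x = - ∫ x in Set.Ioo 0 ℓ, φ x • g x := by
  have hd : Continuous (deriv φ) := hφ.continuous_deriv (by simp)
  have h1 : IsPrimitive ℓ (fun x => (φ x : ℂ)) (fun x => ((deriv φ x : ℝ) : ℂ)) :=
    IsPrimitive.of_hasDerivAt hℓ.le
      (fun x _ => ((hφ.differentiable (by simp)) x).hasDerivAt.ofReal_comp) (by fun_prop)
  have h2 := h1.mul h hℓ.le
  have h3 := h2.integral_eq hℓ.le
  have e0 : φ 0 = 0 := image_eq_zero_of_notMem_tsupport fun h => lt_irrefl _ (hs h).1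
  have e1 : φ ℓ = 0 := image_eq_zero_of_notMem_tsupport fun h => lt_irrefl _ (hs h).2
  have hwc := h.continuousOn hℓ.le
  rw [← Set.uIcc_of_le hℓ.le] at hwc
  rw [intervalIntegral.integral_add (h1.integrable.mul_continuousOn hwc)
    (h.integrable.continuousOn_mul (by have := hφ.continuous; fun_prop)), e0, e1] at h3
  simp only [Complex.ofReal_zero, zero_mul, sub_zero] at h3
  simp only [Complex.real_smul]
  rw [integral_Ioo_eq hℓ.le, integral_Ioo_eq hℓ.le]
  exact eq_neg_of_add_eq_zero_left h3

/-- The difference of `u` and the indefinite integral of the weak derivative is constant by the du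
Bois-Reymond lemma. Continuity of `w` extends the identity to the closed interval, so that the end
point values are included. -/
theorem isPrimitive_of_isWeakDeriv {ℓ : ℝ} (hℓ : 0 < ℓ) {n : ℕ} {u g : L2Interval ℓ n}
    {w : ℝ → EuclideanSpace ℂ (Fin n)} (hg : IsWeakDeriv u g) (hw : IsContinuousRep u w)
    (i : Fin n) : IsPrimitive ℓ (fun x => w x i) (fun x => g x i) := by
  have hgi : IntervalIntegrable (fun x => g x i) volume 0 ℓ := by
    rw [intervalIntegrable_iff_integrableOn_Ioo_of_le hℓ.le]
    exact L2Interval.integrable_coord g i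
  let W : ℝ → ℂ := fun x => ∫ t in (0 : ℝ)..x, g t i
  have hW : IsPrimitive ℓ W (fun x => g x i) := ⟨hgi, fun x _ => by simp [W]⟩
  have hWi : IntegrableOn W (Set.Ioo 0 ℓ) :=
    ((hW.continuousOn hℓ.le).integrableOn_compact isCompact_Icc).mono_set Set.Ioo_subset_Icc_self
  obtain ⟨C, hC⟩ := ae_eq_const_of_integral_deriv_eq_zero hℓ
    (h := fun x => u x i - W x) (Integrable.sub (L2Interval.integrable_coord u i) hWi) (by
      intro φ hφ hc hs
      have hd : Continuous (deriv φ) := hφ.continuous_deriv (by simp)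
      have h1 := congrArg (fun z => EuclideanSpace.proj (𝕜 := ℂ) i z) (hg φ hφ hc hs)
      simp only [map_neg] at h1
      rw [← ContinuousLinearMap.integral_comp_comm _
          (integrableOn_smul_of_contDiff (L2Interval.integrable u) hd hc.deriv),
        ← ContinuousLinearMap.integral_comp_comm _
          (integrableOn_smul_of_contDiff (L2Interval.integrable g) hφ.continuous hc)] at h1
      simp only [PiLp.proj_apply, PiLp.smul_apply] at h1
      simp_rw [smul_sub]
      rw [integral_sub (integrableOn_smul_of_contDiff (L2Interval.integrable_coord u i) hd hc.deriv)
        (integrableOn_smul_of_contDiff hWi hd hc.deriv), h1, hW.integral_deriv_smul hℓ hφ hs,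
        sub_self])
  have hwi : ContinuousOn (fun x => w x i) (Set.Icc 0 ℓ) :=
    (EuclideanSpace.proj (𝕜 := ℂ) i).continuous.comp_continuousOn hw.1
  have heq : Set.EqOn (fun x => w x i) (fun x => W x + C) (Set.Icc 0 ℓ) := by
    refine Measure.eqOn_Icc_of_ae_eq volume hℓ.ne ?_ hwi
      ((hW.continuousOn hℓ.le).add continuousOn_const)
    rw [← restrict_Ioo_eq_restrict_Icc]
    filter_upwards [hC, hw.2] with x h1 h2
    rw [← h1, ← h2]; ring
  refine ⟨hgi, fun x hx => ?_⟩
  have h1 := heq hx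
  have h2 := heq (Set.left_mem_Icc.2 hℓ.le)
  simp only at h1 h2
  rw [h1, h2]
  simp only [W, intervalIntegral.integral_same]
  ring

theorem isWeakDeriv_of_isPrimitive {ℓ : ℝ} (hℓ : 0 < ℓ) {n : ℕ} {u g : L2Interval ℓ n}
    {w : ℝ → EuclideanSpace ℂ (Fin n)} (hu : ∀ᵐ x ∂(volume.restrict (Set.Ioo 0 ℓ)), u x = w x)
    (h : ∀ i, IsPrimitive ℓ (fun x => w x i) (fun x => g x i)) :
    IsWeakDeriv u g ∧ IsContinuousRep u w := by
  refine ⟨fun φ hφ hc hs => ?_, ?_, hu⟩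
  · have hd : Continuous (deriv φ) := hφ.continuous_deriv (by simp)
    ext i
    have e1 := (EuclideanSpace.proj (𝕜 := ℂ) i).integral_comp_comm
      (integrableOn_smul_of_contDiff (L2Interval.integrable u) hd hc.deriv)
    have e2 := (EuclideanSpace.proj (𝕜 := ℂ) i).integral_comp_comm
      (integrableOn_smul_of_contDiff (L2Interval.integrable g) hφ.continuous hc)
    simp only [PiLp.proj_apply, PiLp.smul_apply] at e1 e2
    rw [PiLp.neg_apply, ← e1, ← e2, ← (h i).integral_deriv_smul hℓ hφ hs]
    refine integral_congr_ae ?_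
    filter_upwards [hu] with x hx
    rw [hx]
  · have : ContinuousOn (fun x => WithLp.ofLp (w x)) (Set.Icc 0 ℓ) :=
      continuousOn_pi.2 fun i => (h i).continuousOn hℓ.le
    exact (PiLp.continuous_toLp 2 _).comp_continuousOn this
end

noncomputable section

/-! ### The scalar resolvent equation -/

/-- The complex number is real and nonnegative. -/
def Complex.IsNonnegReal (z : ℂ) : Prop := z.im = 0 ∧ 0 ≤ z.re

namespace Complex.IsNonnegReal

theorem zero : IsNonnegReal 0 := ⟨rfl, le_rfl⟩

theorem ofReal {a : ℝ} (ha : 0 ≤ a) : IsNonnegReal a := ⟨ofReal_im a, by simpa using ha⟩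

theorem add {z z' : ℂ} (h : IsNonnegReal z) (h' : IsNonnegReal z') : IsNonnegReal (z + z') :=
  ⟨by rw [add_im, h.1, h'.1, add_zero], by rw [add_re]; exact add_nonneg h.2 h'.2⟩

theorem mul {z z' : ℂ} (h : IsNonnegReal z) (h' : IsNonnegReal z') : IsNonnegReal (z * z') :=
  ⟨by rw [mul_im, h.1, h'.1]; simp, by rw [mul_re, h.1, h'.1]; simpa using mul_nonneg h.2 h'.2⟩

theorem sum {ι : Type*} (s : Finset ι) (f : ι → ℂ) (h : ∀ i ∈ s, IsNonnegReal (f i)) :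
    IsNonnegReal (∑ i ∈ s, f i) :=
  Finset.sum_induction f IsNonnegReal (fun _ _ => add) zero h

theorem isClosed : IsClosed {z : ℂ | IsNonnegReal z} :=
  (isClosed_eq continuous_im continuous_const).inter (isClosed_le continuous_const continuous_re)

theorem setIntegral {s : Set ℝ} {f : ℝ → ℂ}
    (h : ∀ᵐ x ∂(volume.restrict s), IsNonnegReal (f x)) : IsNonnegReal (∫ x in s, f x) := by
  have e : ∫ x in s, f x = ((∫ x in s, (f x).re : ℝ) : ℂ) := by
    refine (integral_congr_ae (h.mono fun x hx => ?_)).trans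
      (integral_ofReal (𝕜 := ℂ) (f := fun x => (f x).re))
    exact Complex.ext (by simp) (by simpa using hx.1)
  rw [e]
  exact ofReal (integral_nonneg_of_ae (h.mono fun x hx => hx.2))

end Complex.IsNonnegReal

/-- A nonvanishing continuous speed `m` of sign `s` on `[0, ℓ]`; solutions of `u_t = m u_x` enter
at the end point `b` and leave at `o`. -/
structure IsSpeed (ℓ : ℝ) (m : ℝ → ℝ) (s b o : ℝ) : Prop where
  pos : 0 < ℓ
  continuousOn : ContinuousOn m (Set.Icc 0 ℓ)
  sign : ∀ x ∈ Set.Icc 0 ℓ, 0 < s * m x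
  cases : (s = 1 ∧ b = ℓ ∧ o = 0) ∨ (s = -1 ∧ b = 0 ∧ o = ℓ)

/-- `∫₀ˣ 1 / m`, with `m` extended by constants. -/
def travelTime (ℓ : ℝ) (m : ℝ → ℝ) (x : ℝ) : ℝ :=
  ∫ t in (0 : ℝ)..x, (m (max 0 (min ℓ t)))⁻¹

/-- The solution of `m E' = l E` with `E b = 1`. -/
def expSol (ℓ : ℝ) (m : ℝ → ℝ) (b l : ℝ) (x : ℝ) : ℝ :=
  Real.exp (l * (travelTime ℓ m x - travelTime ℓ m b))

namespace IsSpeed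

variable {ℓ : ℝ} {m : ℝ → ℝ} {s b o : ℝ} (h : IsSpeed ℓ m s b o)

include h

theorem clamp_mem (t : ℝ) : max 0 (min ℓ t) ∈ Set.Icc 0 ℓ :=
  ⟨le_max_left _ _, max_le h.pos.le (min_le_left _ _)⟩

omit h in
theorem clamp_eq {x : ℝ} (hx : x ∈ Set.Icc 0 ℓ) : max 0 (min ℓ x) = x := by
  rw [min_eq_right hx.2, max_eq_right hx.1]

theorem ne_zero {x : ℝ} (hx : x ∈ Set.Icc 0 ℓ) : m x ≠ 0 := by
  have := h.sign x hx
  rintro h0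
  rw [h0, mul_zero] at this
  exact lt_irrefl _ this

theorem s_sq : s * s = 1 := by
  rcases h.cases with ⟨hs, -, -⟩ | ⟨hs, -, -⟩ <;> rw [hs] <;> norm_num

theorem abs_eq {x : ℝ} (hx : x ∈ Set.Icc 0 ℓ) : |m x| = s * m x := by
  have := h.sign x hx
  rcases h.cases with ⟨hs, -, -⟩ | ⟨hs, -, -⟩
  · rw [hs, one_mul] at this ⊢; exact abs_of_pos this
  · rw [hs, neg_one_mul] at this ⊢; exact abs_of_neg (by linarith)

theorem b_mem : b ∈ Set.Icc 0 ℓ := by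
  rcases h.cases with ⟨-, hb, -⟩ | ⟨-, hb, -⟩ <;> rw [hb]
  · exact Set.right_mem_Icc.2 h.pos.le
  · exact Set.left_mem_Icc.2 h.pos.le

theorem o_mem : o ∈ Set.Icc 0 ℓ := by
  rcases h.cases with ⟨-, -, hb⟩ | ⟨-, -, hb⟩ <;> rw [hb]
  · exact Set.left_mem_Icc.2 h.pos.le
  · exact Set.right_mem_Icc.2 h.pos.le

theorem neg : IsSpeed ℓ (fun x => -m x) (-s) o b := by
  refine ⟨h.pos, h.continuousOn.neg, fun x hx => by simpa using h.sign x hx, ?_⟩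
  rcases h.cases with ⟨h1, h2, h3⟩ | ⟨h1, h2, h3⟩
  · exact Or.inr ⟨by rw [h1], h3, h2⟩
  · exact Or.inl ⟨by rw [h1]; norm_num, h3, h2⟩

theorem exists_bounds : ∃ c₁ c₂ : ℝ, 0 < c₁ ∧ 0 < c₂ ∧ ∀ x ∈ Set.Icc 0 ℓ,
    c₁ ≤ s * m x ∧ s * m x ≤ c₂ := by
  have hne : (Set.Icc 0 ℓ).Nonempty := ⟨b, h.b_mem⟩
  have hc : ContinuousOn (fun x => s * m x) (Set.Icc 0 ℓ) := h.continuousOn.const_mul s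
  obtain ⟨x, hx, hmin⟩ := isCompact_Icc.exists_isMinOn hne hc
  obtain ⟨y, hy, hmax⟩ := isCompact_Icc.exists_isMaxOn hne hc
  exact ⟨s * m x, s * m y, h.sign x hx, h.sign y hy, fun z hz => ⟨hmin hz, hmax hz⟩⟩

theorem continuous_inv : Continuous fun t => (m (max 0 (min ℓ t)))⁻¹ := by
  have h1 : Continuous fun t : ℝ => m (max 0 (min ℓ t)) :=
    h.continuousOn.comp_continuous (by fun_prop) h.clamp_mem
  exact h1.inv₀ fun t => h.ne_zero (h.clamp_mem t)

theorem travelTime_hasDerivAt {x : ℝ} (hx : x ∈ Set.Icc 0 ℓ) :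
    HasDerivAt (travelTime ℓ m) (m x)⁻¹ x := by
  have hc := h.continuous_inv
  have := intervalIntegral.integral_hasDerivAt_right (a := 0) (b := x)
    (hc.intervalIntegrable _ _) (hc.stronglyMeasurableAtFilter _ _) hc.continuousAt
  rwa [clamp_eq hx] at this

theorem travelTime_sub_ge {c₂ : ℝ} (hc₂ : ∀ x ∈ Set.Icc 0 ℓ, s * m x ≤ c₂) {x y : ℝ}
    (hxy : x ≤ y) : (y - x) / c₂ ≤ s * (travelTime ℓ m y - travelTime ℓ m x) := by
  have hc := h.continuous_inv
  have e : travelTime ℓ m y - travelTime ℓ m x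
      = ∫ t in x..y, (m (max 0 (min ℓ t)))⁻¹ :=
    intervalIntegral.integral_interval_sub_left (hc.intervalIntegrable _ _)
      (hc.intervalIntegrable _ _)
  rw [e, ← intervalIntegral.integral_const_mul]
  have h1 : (y - x) / c₂ = ∫ _ in x..y, c₂⁻¹ := by
    rw [intervalIntegral.integral_const, smul_eq_mul]; rfl
  rw [h1]
  refine intervalIntegral.integral_mono_on hxy (by simp)
    ((hc.intervalIntegrable _ _).const_mul s) fun t _ => ?_
  have h2 := h.sign _ (h.clamp_mem t)
  have h3 := hc₂ _ (h.clamp_mem t)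
  have h4 : s * (m (max 0 (min ℓ t)))⁻¹ = (s * m (max 0 (min ℓ t)))⁻¹ := by
    have := h.s_sq
    have h5 := h.ne_zero (h.clamp_mem t)
    have h6 : s ≠ 0 := by rintro rfl; norm_num at this
    rw [mul_inv]
    congr 1
    field_simp
    nlinarith
  rw [h4]
  exact inv_anti₀ h2 h3

theorem exists_travelTime_pos : 0 < travelTime ℓ m b - travelTime ℓ m o := by
  obtain ⟨c₁, c₂, -, hc2, hc⟩ := h.exists_bounds
  have h1 := h.travelTime_sub_ge (fun x hx => (hc x hx).2) h.pos.le
  have h2 : 0 < (ℓ - 0) / c₂ := div_pos (by linarith [h.pos]) hc2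
  rcases h.cases with ⟨h3, h4, h5⟩ | ⟨h3, h4, h5⟩ <;> rw [h4, h5] <;> rw [h3] at h1
  · linarith
  · linarith

theorem expSol_hasDerivAt (l : ℝ) {x : ℝ} (hx : x ∈ Set.Icc 0 ℓ) :
    HasDerivAt (expSol ℓ m b l) (l * (m x)⁻¹ * expSol ℓ m b l x) x := by
  have := (((h.travelTime_hasDerivAt hx).sub_const (travelTime ℓ m b)).const_mul l).exp
  refine this.congr_deriv ?_
  simp only [expSol]; ring

omit h in
theorem expSol_pos (l x : ℝ) : 0 < expSol ℓ m b l x := Real.exp_pos _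

omit h in
theorem expSol_b (l : ℝ) : expSol ℓ m b l b = 1 := by simp [expSol]

/-- `E(o)` is in fact exponentially small in `l`; the bound `e^y ≥ 1 + y` keeps the decay `1/l`, and
no more is needed. -/
theorem expSol_o_le {l : ℝ} (hl : 0 < l) :
    expSol ℓ m b l o ≤ (travelTime ℓ m b - travelTime ℓ m o)⁻¹ / l := by
  set τ := travelTime ℓ m b - travelTime ℓ m o with hτ
  have hτ0 : 0 < τ := h.exists_travelTime_pos
  have e : expSol ℓ m b l o = (Real.exp (l * τ))⁻¹ := by
    rw [expSol, ← Real.exp_neg, hτ]; congr 1; ring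
  rw [e, ← one_div, ← one_div, div_div, div_le_div_iff₀ (Real.exp_pos _) (by positivity)]
  have := Real.add_one_le_exp (l * τ)
  linarith

theorem continuousOn_expSol (l : ℝ) : ContinuousOn (expSol ℓ m b l) (Set.Icc 0 ℓ) :=
  fun _ hx => (h.expSol_hasDerivAt l hx).continuousAt.continuousWithinAt

theorem continuousOn_inv : ContinuousOn (fun x => (m x)⁻¹) (Set.Icc 0 ℓ) :=
  h.continuousOn.inv₀ fun _ hx => h.ne_zero hx

/-- Solution of the resolvent equation `l w - m w' = f` with prescribed inflow value. -/
theorem exists_solution (l : ℝ) {f : ℝ → ℂ} (hf : IntervalIntegrable f volume 0 ℓ) :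
    ∃ z : ℂ, ((∀ᵐ x ∂(volume.restrict (Set.Ioo 0 ℓ)), (f x).IsNonnegReal) → z.IsNonnegReal) ∧
      ∀ a : ℂ, ∃ w g : ℝ → ℂ, IsPrimitive ℓ w g ∧ (∀ x ∈ Set.Icc 0 ℓ, m x * g x = l * w x - f x) ∧
        w b = a ∧ w o = expSol ℓ m b l o * a + z ∧
        ((∀ᵐ x ∂(volume.restrict (Set.Ioo 0 ℓ)), (f x).IsNonnegReal) → a.IsNonnegReal →
          ∀ x ∈ Set.Icc 0 ℓ, (w x).IsNonnegReal) := by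
  set E := expSol ℓ m b l with hE
  have hE0 : ∀ x, E x ≠ 0 := fun x => (expSol_pos l x).ne'
  have hℓ := h.pos.le
  -- Variation of constants: `w = E (a + p)` solves the equation when `p' = -q` with `q = f / (m
  -- E)`, and `p(b) = 0` makes `a` the inflow value.
  let q : ℝ → ℂ := fun x => (((E x)⁻¹ * (m x)⁻¹ : ℝ) : ℂ) * f x
  have hqc : ContinuousOn (fun x => (((E x)⁻¹ * (m x)⁻¹ : ℝ) : ℂ)) (Set.uIcc 0 ℓ) := by
    rw [Set.uIcc_of_le hℓ]
    exact Complex.continuous_ofReal.comp_continuousOn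
      (((h.continuousOn_expSol l).inv₀ fun x _ => hE0 x).mul h.continuousOn_inv)
  have hq : IntervalIntegrable q volume 0 ℓ := hf.continuousOn_mul hqc
  have hsub : ∀ {x y : ℝ}, x ∈ Set.Icc 0 ℓ → y ∈ Set.Icc 0 ℓ → IntervalIntegrable q volume x y := by
    intro x y hx hy
    refine hq.mono_set ?_
    rw [Set.uIcc_of_le hℓ]
    exact Set.uIcc_subset_Icc hx hy
  let p : ℝ → ℂ := fun x => -∫ t in b..x, q t
  have hp : ∀ a, IsPrimitive ℓ (fun x => a + p x) (fun x => -q x) := by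
    intro a
    refine ⟨hq.neg, fun x hx => ?_⟩
    have h0 : (0 : ℝ) ∈ Set.Icc 0 ℓ := Set.left_mem_Icc.2 hℓ
    have := intervalIntegral.integral_add_adjacent_intervals (hsub h.b_mem h0) (hsub h0 hx)
    simp only [p]
    rw [intervalIntegral.integral_neg, ← this]
    ring
  have hEp : IsPrimitive ℓ (fun x => (E x : ℂ)) (fun x => ((l * (m x)⁻¹ * E x : ℝ) : ℂ)) := by
    refine IsPrimitive.of_hasDerivAt hℓ (fun x hx => (h.expSol_hasDerivAt l hx).ofReal_comp) ?_
    exact Complex.continuous_ofReal.comp_continuousOn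
      ((continuousOn_const.mul h.continuousOn_inv).mul (h.continuousOn_expSol l))
  have hpos : (∀ᵐ x ∂(volume.restrict (Set.Ioo 0 ℓ)), (f x).IsNonnegReal) →
      ∀ x ∈ Set.Icc 0 ℓ, (p x).IsNonnegReal := by
    intro hfn x hx
    have hfn1 : ∀ᵐ x ∂(volume.restrict (Set.Ioc 0 ℓ)), (f x).IsNonnegReal := by
      rwa [restrict_Ioo_eq_restrict_Ioc] at hfn
    have hsign : ∀ᵐ t ∂(volume.restrict (Set.Ioc 0 ℓ)), ((s : ℂ) * q t).IsNonnegReal := by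
      have hmem : ∀ᵐ t ∂(volume.restrict (Set.Ioc 0 ℓ)), t ∈ Set.Ioc 0 ℓ :=
        ae_restrict_mem measurableSet_Ioc
      filter_upwards [hfn1, hmem] with t ht htm
      have ht' : t ∈ Set.Icc 0 ℓ := Set.Ioc_subset_Icc_self htm
      have e : (s : ℂ) * q t = ((s * ((E t)⁻¹ * (m t)⁻¹) : ℝ) : ℂ) * f t := by
        simp only [q]; push_cast; ring
      rw [e]
      refine (Complex.IsNonnegReal.ofReal ?_).mul ht
      have h1 := h.sign t ht'
      have h2 := h.ne_zero ht'
      have h3 : s * ((E t)⁻¹ * (m t)⁻¹) = (E t)⁻¹ * (s * m t) * ((m t)⁻¹ * (m t)⁻¹) := by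
        field_simp
      rw [h3]
      have h4 : 0 ≤ (m t)⁻¹ * (m t)⁻¹ := mul_self_nonneg _
      have h5 : 0 < (E t)⁻¹ := inv_pos.2 (expSol_pos l t)
      positivity
    have hint : ∀ {u v : ℝ}, 0 ≤ u → u ≤ v → v ≤ ℓ →
        ((s : ℂ) * ∫ t in u..v, q t).IsNonnegReal := by
      intro u v hu huv hv
      rw [← intervalIntegral.integral_const_mul, intervalIntegral.integral_of_le huv]
      exact Complex.IsNonnegReal.setIntegral
        (ae_restrict_of_ae_restrict_of_subset (Set.Ioc_subset_Ioc hu hv) hsign)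
    simp only [p]
    -- `s q` is nonnegative, and the inflow end lies to the right of `x` for `s = 1` and to the left
    -- for `s = -1`; in both cases `p x` is `s` times an integral of `q` over an interval traversed
    -- from left to right.
    rcases h.cases with ⟨h3, h4, h5⟩ | ⟨h3, h4, h5⟩
    · have := hint hx.1 hx.2 le_rfl
      rw [h3] at this
      rw [h4, intervalIntegral.integral_symm, neg_neg]
      simpa using this
    · have := hint le_rfl hx.1 hx.2
      rw [h3] at this
      rw [h4]
      simpa using this
  refine ⟨E o * p o, fun hfn => (Complex.IsNonnegReal.ofReal (expSol_pos l o).le).mul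
    (hpos hfn o h.o_mem), fun a => ⟨fun x => E x * (a + p x), _, hEp.mul (hp a) hℓ, ?_, ?_, ?_, ?_⟩⟩
  · intro x hx
    have h2 : (m x : ℂ) ≠ 0 := by exact_mod_cast h.ne_zero hx
    have h3 : (E x : ℂ) ≠ 0 := by exact_mod_cast hE0 x
    simp only [q]
    push_cast
    field_simp
    ring
  · simp [p, hE, expSol_b]
  · ring
  · intro hfn ha x hx
    exact (Complex.IsNonnegReal.ofReal (expSol_pos l x).le).mul (ha.add (hpos hfn x hx))

/-- Functions concentrated at the inflow end point that almost solve `l χ - m χ' = 0`. -/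
theorem exists_testFunction : ∃ D c l₀ : ℝ, 0 ≤ D ∧ 0 < c ∧ 0 < l₀ ∧ ∀ l ≥ l₀, ∃ χ χ' : ℝ → ℝ,
    (∀ x ∈ Set.Icc 0 ℓ, HasDerivAt χ (χ' x) x) ∧ ContinuousOn χ' (Set.Icc 0 ℓ) ∧
    χ b = 1 ∧ χ o = 0 ∧ (∀ x ∈ Set.Icc 0 ℓ, |l * χ x - m x * χ' x| ≤ D) ∧
    c / l ≤ ∫ x in (0 : ℝ)..ℓ, χ x ^ 2 := by
  obtain ⟨c₁, c₂, hc1, hc2, hc⟩ := h.exists_bounds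
  set C := (travelTime ℓ m b - travelTime ℓ m o)⁻¹ with hC
  have hC0 : 0 < C := inv_pos.2 h.exists_travelTime_pos
  have hℓ := h.pos
  have hob : |o - b| = ℓ := by
    rcases h.cases with ⟨h3, h4, h5⟩ | ⟨h3, h4, h5⟩ <;> rw [h4, h5]
    · rw [zero_sub, abs_neg, abs_of_pos hℓ]
    · rw [sub_zero, abs_of_pos hℓ]
  have hob0 : o - b ≠ 0 := by
    intro h0; rw [h0, abs_zero] at hob; exact hℓ.ne hob
  have hlin : ∀ x ∈ Set.Icc 0 ℓ, |(x - b) / (o - b)| ≤ 1 := by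
    intro x hx
    rw [abs_div, hob, div_le_one hℓ, abs_le]
    have hb := h.b_mem
    exact ⟨by linarith [hx.1, hb.2], by linarith [hx.2, hb.1]⟩
  -- With `r = E(o) ≤ C / l`, the three summands of the threshold ensure `l ≥ 1`, `r ≤ 1/2` and `ℓ
  -- r² ≤ c₁ / (16 l)` in turn.
  refine ⟨C + C * c₂ / ℓ, c₁ / 16, 1 + 2 * C + 16 * ℓ * C ^ 2 / c₁, by positivity, by positivity,
    by positivity, fun l hl => ?_⟩
  have hl1 : 1 ≤ l := by
    have : 0 ≤ 2 * C + 16 * ℓ * C ^ 2 / c₁ := by positivity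
    linarith
  have hl2 : 2 * C ≤ l := by
    have : 0 ≤ 16 * ℓ * C ^ 2 / c₁ := by positivity
    linarith
  have hl3 : 16 * ℓ * C ^ 2 / c₁ ≤ l := by linarith
  have hl0 : 0 < l := by linarith
  set E := expSol ℓ m b l with hE
  set r := E o with hr
  have hr0 : 0 < r := expSol_pos l o
  have hrC : r ≤ C / l := h.expSol_o_le hl0
  have hr2 : r ≤ 1 / 2 := hrC.trans (by rw [div_le_div_iff₀ hl0 two_pos]; linarith)
  have hEd : ∀ x ∈ Set.Icc 0 ℓ, HasDerivAt E (l * (m x)⁻¹ * E x) x :=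
    fun x hx => h.expSol_hasDerivAt l hx
  have hEc : ContinuousOn E (Set.Icc 0 ℓ) := h.continuousOn_expSol l
  -- `E` solves `l E - m E' = 0` exactly and equals `1` at `b`; the affine correction makes it
  -- vanish at `o`. As `l r` is bounded, the residual caused by the correction stays bounded in `l`.
  refine ⟨fun x => E x - r * ((x - b) / (o - b)), fun x => l * (m x)⁻¹ * E x - r * (1 / (o - b)),
    ?_, ?_, ?_, ?_, ?_, ?_⟩
  · intro x hx
    exact (hEd x hx).sub ((((hasDerivAt_id x).sub_const b).div_const (o - b)).const_mul r)
  · exact ((continuousOn_const.mul h.continuousOn_inv).mul hEc).sub continuousOn_const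
  · simp [hE, expSol_b]
  · show E o - r * ((o - b) / (o - b)) = 0
    rw [div_self hob0, hr]; ring
  · intro x hx
    have hm := h.ne_zero hx
    have e : l * (E x - r * ((x - b) / (o - b))) - m x * (l * (m x)⁻¹ * E x - r * (1 / (o - b)))
        = r * m x / (o - b) - l * r * ((x - b) / (o - b)) := by
      field_simp; ring
    rw [e]
    have h1 : |r * m x / (o - b)| ≤ C * c₂ / ℓ := by
      rw [abs_div, hob, abs_mul, abs_of_pos hr0, h.abs_eq hx]
      have : r ≤ C := hrC.trans (div_le_self hC0.le hl1)
      have h2 := (hc x hx).2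
      have h3 := h.sign x hx
      gcongr
    have h2 : |l * r * ((x - b) / (o - b))| ≤ C := by
      rw [abs_mul, abs_of_pos (mul_pos hl0 hr0)]
      have h3 : l * r ≤ C := by
        rw [le_div_iff₀ hl0] at hrC; linarith
      calc _ ≤ l * r * 1 := by gcongr; exact hlin x hx
        _ ≤ C := by linarith
    calc _ ≤ |r * m x / (o - b)| + |l * r * ((x - b) / (o - b))| := abs_sub _ _
      _ ≤ _ := by linarith
  · have hE2 : ∫ x in (0 : ℝ)..ℓ, s * (m x)⁻¹ * E x ^ 2 = (1 - r ^ 2) / (2 * l) := by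
      rw [intervalIntegral.integral_eq_sub_of_hasDerivAt
        (f := fun x => s * (E x ^ 2 / (2 * l)))]
      · rcases h.cases with ⟨h3, h4, h5⟩ | ⟨h3, h4, h5⟩
        · have e1 : E ℓ = 1 := by rw [← h4]; exact expSol_b l
          have e2 : E 0 = r := by rw [hr, h5]
          rw [e1, e2, h3]; ring
        · have e1 : E 0 = 1 := by rw [← h4]; exact expSol_b l
          have e2 : E ℓ = r := by rw [hr, h5]
          rw [e1, e2, h3]; ring
      · intro x hx
        rw [Set.uIcc_of_le hℓ.le] at hx
        have := (((hEd x hx).pow 2).div_const (2 * l)).const_mul s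
        refine this.congr_deriv ?_
        have := h.ne_zero hx
        field_simp
        simp
        ring
      · refine ContinuousOn.intervalIntegrable ?_
        rw [Set.uIcc_of_le hℓ.le]
        exact (continuousOn_const.mul h.continuousOn_inv).mul (hEc.pow 2)
    -- Pointwise, `(E - r y)² ≥ E² / 2 - r²` for `|y| ≤ 1`, and `c₁ s / m ≤ 1`.
    have hmono : ∫ x in (0 : ℝ)..ℓ, (c₁ / 2 * (s * (m x)⁻¹ * E x ^ 2) - r ^ 2)
        ≤ ∫ x in (0 : ℝ)..ℓ, (E x - r * ((x - b) / (o - b))) ^ 2 := by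
      refine intervalIntegral.integral_mono_on hℓ.le ?_ ?_ fun x hx => ?_
      · refine ContinuousOn.intervalIntegrable ?_
        rw [Set.uIcc_of_le hℓ.le]
        exact (continuousOn_const.mul ((continuousOn_const.mul h.continuousOn_inv).mul
          (hEc.pow 2))).sub continuousOn_const
      · refine ContinuousOn.intervalIntegrable ?_
        rw [Set.uIcc_of_le hℓ.le]
        exact (hEc.sub (by fun_prop)).pow 2
      · have h1 : c₁ * (s * (m x)⁻¹) ≤ 1 := by
          have h2 := (hc x hx).1
          have h3 := h.sign x hx
          have h4 : s * (m x)⁻¹ = (s * m x)⁻¹ := by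
            have := h.s_sq
            have h5 := h.ne_zero hx
            have h6 : s ≠ 0 := by rintro rfl; norm_num at this
            rw [mul_inv]
            congr 1
            field_simp
            nlinarith
          rw [h4, mul_inv_le_iff₀ h3]; linarith
        have h2 := hlin x hx
        set y := (x - b) / (o - b)
        have h3 : y ^ 2 ≤ 1 := by rw [sq_le_one_iff_abs_le_one]; exact h2
        have h4 : c₁ / 2 * (s * (m x)⁻¹ * E x ^ 2) ≤ E x ^ 2 / 2 := by
          have := mul_le_mul_of_nonneg_right h1 (sq_nonneg (E x))
          linarith
        have h5 : r ^ 2 * y ^ 2 ≤ r ^ 2 * 1 := by gcongr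
        nlinarith [sq_nonneg (E x - 2 * (r * y))]
    refine le_trans ?_ hmono
    rw [intervalIntegral.integral_sub, intervalIntegral.integral_const_mul, hE2,
      intervalIntegral.integral_const, sub_zero, smul_eq_mul]
    · have h1 : r ^ 2 ≤ (C / l) ^ 2 := by gcongr
      have h2 : r ^ 2 ≤ 1 / 4 := by nlinarith
      have h3 : ℓ * r ^ 2 ≤ c₁ / 16 / l := by
        calc ℓ * r ^ 2 ≤ ℓ * (C / l) ^ 2 := by gcongr
          _ = (16 * ℓ * C ^ 2 / c₁) * (c₁ / 16 / l) / l := by field_simp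
          _ ≤ l * (c₁ / 16 / l) / l := by gcongr
          _ = c₁ / 16 / l := by field_simp
      have h4 : c₁ / 8 / l ≤ c₁ / 2 * ((1 - r ^ 2) / (2 * l)) := by
        rw [div_mul_div_comm, div_div, div_le_div_iff₀ (by positivity) (by positivity)]
        have : 0 < c₁ * l := by positivity
        nlinarith
      have h5 : c₁ / 8 / l = 2 * (c₁ / 16 / l) := by ring
      linarith
    · refine ContinuousOn.intervalIntegrable ?_
      rw [Set.uIcc_of_le hℓ.le]
      exact continuousOn_const.mul ((continuousOn_const.mul h.continuousOn_inv).mul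
          (hEc.pow 2))
    · exact intervalIntegrable_const

end IsSpeed
end

noncomputable section

set_option linter.unusedSectionVars false

/-! ### Inflow and outflow end points -/

namespace Network

variable {V E : Type*} [Fintype V] [DecidableEq V] [Fintype E] [DecidableEq E]
variable (G : Network V E) (s : ∀ e, Fin (G.k e) → ℝ)

/-- The vertex where the component `i` on the edge `e`, of sign `s e i`, leaves the edge. -/
def outV (e : E) (i : Fin (G.k e)) : V := if s e i = 1 then G.init e else G.term e

/-- The vertex where the component `i` on the edge `e`, of sign `s e i`, enters the edge. -/
def inV (e : E) (i : Fin (G.k e)) : V := if s e i = 1 then G.term e else G.init e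

/-- The coordinate of the outflow end point. -/
def outflow (e : E) (i : Fin (G.k e)) : ℝ := if s e i = 1 then 0 else G.ℓ e

/-- The coordinate of the inflow end point. -/
def inflow (e : E) (i : Fin (G.k e)) : ℝ := if s e i = 1 then G.ℓ e else 0

/-- The index belongs to a component that leaves its edge at `v`. -/
def IsOut {v : V} (p : G.VIdx v) : Prop := G.outV s p.1.1 p.2 = v

instance {v : V} (p : G.VIdx v) : Decidable (G.IsOut s p) :=
  inferInstanceAs (Decidable (_ = _))

theorem incident_outV (e : E) (i : Fin (G.k e)) :
    G.init e = G.outV s e i ∨ G.term e = G.outV s e i := by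
  unfold outV; split_ifs <;> simp

theorem incident_inV (e : E) (i : Fin (G.k e)) :
    G.init e = G.inV s e i ∨ G.term e = G.inV s e i := by
  unfold inV; split_ifs <;> simp

variable {G s}

/-- The absence of loops makes the two end points of an edge different, so at an incident vertex
each component either leaves or enters, and not both. -/
theorem not_isOut_iff {v : V} (p : G.VIdx v) : ¬ G.IsOut s p ↔ G.inV s p.1.1 p.2 = v := by
  have h := p.1.2
  have h' := G.loopless p.1.1
  unfold IsOut outV inV
  split_ifs
  · exact ⟨h.resolve_left, fun h1 h2 => h' (h2.trans h1.symm)⟩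
  · exact ⟨h.resolve_right, fun h1 h2 => h' (h1.trans h2.symm)⟩

theorem coord_of_isOut {v : V} {p : G.VIdx v} (h : G.IsOut s p) :
    G.coord v p.1.1 = G.outflow s p.1.1 p.2 := by
  have h' := G.loopless p.1.1
  unfold IsOut outV at h
  unfold coord outflow
  split_ifs at h ⊢ <;> simp_all

theorem coord_of_not_isOut {v : V} {p : G.VIdx v} (h : ¬ G.IsOut s p) :
    G.coord v p.1.1 = G.inflow s p.1.1 p.2 := by
  rw [not_isOut_iff] at h
  have h' := G.loopless p.1.1
  unfold inV at h
  unfold coord inflow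
  split_ifs at h ⊢ <;> simp_all

/-- Assigning to each component one of its end points partitions the components by vertex. Applied
to outflow and to inflow ends, it converts sums over vertices into sums over edges. -/
theorem sum_vIdx {R : Type*} [AddCommMonoid R] (a : ∀ e, Fin (G.k e) → V)
    (ha : ∀ e i, G.init e = a e i ∨ G.term e = a e i) (F : ∀ e, Fin (G.k e) → R) :
    ∑ v, ∑ p : G.VIdx v, (if a p.1.1 p.2 = v then F p.1.1 p.2 else 0) = ∑ e, ∑ i, F e i := by
  have h1 : ∀ v, ∑ p : G.VIdx v, (if a p.1.1 p.2 = v then F p.1.1 p.2 else 0)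
      = ∑ e, ∑ i, if a e i = v then F e i else 0 := by
    intro v
    rw [Fintype.sum_sigma]
    · rw [← Finset.sum_filter_add_sum_filter_not Finset.univ
        (fun e => G.init e = v ∨ G.term e = v) (fun e => ∑ i, if a e i = v then F e i else 0)]
      rw [Finset.sum_eq_zero (s := Finset.univ.filter fun e => ¬ (G.init e = v ∨ G.term e = v)),
        add_zero]
      · refine (Finset.sum_subtype _ (fun e => by rw [Finset.mem_filter]; simp)
          (fun e => ∑ i, if a e i = v then F e i else 0)).symm
      · intro e he
        refine Finset.sum_eq_zero fun i _ => if_neg fun h => ?_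
        rw [Finset.mem_filter] at he
        exact he.2 (h ▸ ha e i)
  simp_rw [h1]
  rw [Finset.sum_comm]
  refine Finset.sum_congr rfl fun e _ => ?_
  rw [Finset.sum_comm]
  refine Finset.sum_congr rfl fun i _ => ?_
  rw [Finset.sum_ite_eq]
  simp

variable (w : ∀ e, ℝ → EuclideanSpace ℂ (Fin (G.k e)))

theorem trace_of_isOut {v : V} {p : G.VIdx v} (h : G.IsOut s p) :
    G.trace w v p = w p.1.1 (G.outflow s p.1.1 p.2) p.2 := by
  rw [← coord_of_isOut h]; rfl

theorem trace_of_not_isOut {v : V} {p : G.VIdx v} (h : ¬ G.IsOut s p) :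
    G.trace w v p = w p.1.1 (G.inflow s p.1.1 p.2) p.2 := by
  rw [← coord_of_not_isOut h]; rfl

theorem sum_isOut {R : Type*} [AddCommMonoid R] (F : ∀ e, Fin (G.k e) → R) :
    ∑ v, ∑ p : G.VIdx v, (if G.IsOut s p then F p.1.1 p.2 else 0) = ∑ e, ∑ i, F e i :=
  sum_vIdx (G.outV s) (G.incident_outV s) F

theorem sum_not_isOut {R : Type*} [AddCommMonoid R] (F : ∀ e, Fin (G.k e) → R) :
    ∑ v, ∑ p : G.VIdx v, (if G.IsOut s p then 0 else F p.1.1 p.2) = ∑ e, ∑ i, F e i := by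
  rw [← sum_vIdx (G.inV s) (G.incident_inV s) F]
  refine Finset.sum_congr rfl fun v _ => Finset.sum_congr rfl fun p _ => ?_
  by_cases h : G.IsOut s p
  · have : ¬ G.inV s p.1.1 p.2 = v := fun h' => (not_isOut_iff p).2 h' h
    rw [if_pos h, if_neg this]
  · rw [if_neg h, if_pos ((not_isOut_iff p).1 h)]

/-! ### Diagonal coefficients: real speeds of constant sign -/

namespace HypSystem

/-- The matrices `M` and `Q` are diagonal with entries `m` and `q`, where `m` is a speed of
sign `s` and `q` is positive. -/
structure IsDiagonal (S : G.HypSystem) (m q : ∀ e, Fin (G.k e) → ℝ → ℝ)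
    (s : ∀ e, Fin (G.k e) → ℝ) : Prop where
  M_eq : ∀ e, ∀ x ∈ Set.Icc 0 (G.ℓ e), S.M e x = Matrix.diagonal fun i => (m e i x : ℂ)
  Q_eq : ∀ e, ∀ x ∈ Set.Icc 0 (G.ℓ e), S.Q e x = Matrix.diagonal fun i => (q e i x : ℂ)
  q_pos : ∀ e i, ∀ x ∈ Set.Icc 0 (G.ℓ e), 0 < q e i x
  speed : ∀ e i, IsSpeed (G.ℓ e) (m e i) (s e i) (G.inflow s e i) (G.outflow s e i)

variable {S : G.HypSystem}

theorem eqOn_zero_of_ae {ℓ : ℝ} (hℓ : 0 < ℓ) {f : ℝ → ℂ} {K : ℝ≥0}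
    (hf : LipschitzOnWith K f (Set.Icc 0 ℓ)) (h : ∀ᵐ x ∂(volume.restrict (Set.Icc 0 ℓ)), f x = 0) :
    ∀ x ∈ Set.Icc 0 ℓ, f x = 0 :=
  fun _ hx => Measure.eqOn_Icc_of_ae_eq volume hℓ.ne (g := fun _ => 0) h hf.continuousOn
    continuousOn_const hx

/-- Lipschitz continuity upgrades diagonality from almost every point to every point, end points
included. Since `Q M` is Hermitian and `Q` has positive diagonal, the entries of `M` are real;
invertibility and the intermediate value theorem fix their signs. -/
theorem exists_isDiagonal
    (hM : ∀ e, ∀ᵐ x ∂(volume.restrict (Set.Icc 0 (G.ℓ e))), (S.M e x).IsDiag)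
    (hQ : ∀ e, ∀ᵐ x ∂(volume.restrict (Set.Icc 0 (G.ℓ e))), (S.Q e x).IsDiag) :
    ∃ m q s, S.IsDiagonal m q s := by
  have hM' : ∀ e, ∀ x ∈ Set.Icc 0 (G.ℓ e), ∀ i j, i ≠ j → S.M e x i j = 0 := by
    intro e x hx i j hij
    obtain ⟨K, hK⟩ := S.M_lipschitz e
    exact eqOn_zero_of_ae (G.ℓ_pos e) (hK i j) ((hM e).mono fun y hy => hy hij) x hx
  have hQ' : ∀ e, ∀ x ∈ Set.Icc 0 (G.ℓ e), ∀ i j, i ≠ j → S.Q e x i j = 0 := by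
    intro e x hx i j hij
    obtain ⟨K, hK⟩ := S.Q_lipschitz e
    exact eqOn_zero_of_ae (G.ℓ_pos e) (hK i j) ((hQ e).mono fun y hy => hy hij) x hx
  have hQpos : ∀ e i, ∀ x ∈ Set.Icc 0 (G.ℓ e), 0 < (S.Q e x i i).re := by
    intro e i x hx
    obtain ⟨c, hc, h⟩ := S.Q_posDef e
    have := h x hx (EuclideanSpace.single i 1)
    rw [EuclideanSpace.inner_single_left] at this
    simp only [map_one, one_mul, Matrix.toLpLin_apply, PiLp.norm_single, norm_one] at this
    simp [Matrix.mulVec_single] at this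
    linarith
  have hQim : ∀ e i, ∀ x ∈ Set.Icc 0 (G.ℓ e), (S.Q e x i i).im = 0 := by
    intro e i x hx
    exact Complex.conj_eq_iff_im.1 ((S.Q_hermitian e x hx).apply i i)
  have hMim : ∀ e i, ∀ x ∈ Set.Icc 0 (G.ℓ e), (S.M e x i i).im = 0 := by
    intro e i x hx
    have h1 := Complex.conj_eq_iff_im.1 ((S.QM_hermitian e x hx).apply i i)
    rw [Matrix.mul_apply, Finset.sum_eq_single i (fun j _ hj => by rw [hQ' e x hx i j hj.symm,
      zero_mul]) (by simp), Complex.mul_im, hQim e i x hx, zero_mul, add_zero] at h1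
    exact (mul_eq_zero.1 h1).resolve_left (hQpos e i x hx).ne'
  have hMd : ∀ e, ∀ x ∈ Set.Icc 0 (G.ℓ e),
      S.M e x = Matrix.diagonal fun i => (((S.M e x i i).re : ℝ) : ℂ) := by
    intro e x hx
    ext i j
    by_cases hij : i = j
    · subst hij
      rw [Matrix.diagonal_apply_eq]
      exact Complex.ext (by simp) (by simpa using hMim e i x hx)
    · rw [Matrix.diagonal_apply_ne _ hij, hM' e x hx i j hij]
  have hM0 : ∀ e i, ∀ x ∈ Set.Icc 0 (G.ℓ e), (S.M e x i i).re ≠ 0 := by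
    intro e i x hx h0
    have h1 := (Matrix.isUnit_iff_isUnit_det _).1 (S.M_invertible e x hx)
    rw [hMd e x hx, Matrix.det_diagonal, isUnit_iff_ne_zero, Finset.prod_ne_zero_iff] at h1
    exact h1 i (Finset.mem_univ _) (by rw [h0]; rfl)
  have hMc : ∀ e i, ContinuousOn (fun x => (S.M e x i i).re) (Set.Icc 0 (G.ℓ e)) := by
    intro e i
    obtain ⟨K, hK⟩ := S.M_lipschitz e
    exact Complex.continuous_re.comp_continuousOn (hK i i).continuousOn
  refine ⟨fun e i x => (S.M e x i i).re, fun e i x => (S.Q e x i i).re,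
    fun e i => if 0 < (S.M e 0 i i).re then 1 else -1, hMd, ?_, hQpos, fun e i => ?_⟩
  · intro e x hx
    ext i j
    by_cases hij : i = j
    · subst hij
      rw [Matrix.diagonal_apply_eq]
      exact Complex.ext (by simp) (by simpa using hQim e i x hx)
    · rw [Matrix.diagonal_apply_ne _ hij, hQ' e x hx i j hij]
  · have h0 : (0 : ℝ) ∈ Set.Icc 0 (G.ℓ e) := Set.left_mem_Icc.2 (G.ℓ_pos e).le
    have hp := isPreconnected_Icc.image _ (hMc e i)
    refine ⟨G.ℓ_pos e, hMc e i, fun x hx => ?_, ?_⟩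
    · have hsub := hp.Icc_subset (Set.mem_image_of_mem _ h0) (Set.mem_image_of_mem _ hx)
      have hsub' := hp.Icc_subset (Set.mem_image_of_mem _ hx) (Set.mem_image_of_mem _ h0)
      have hx0 := hM0 e i x hx
      have h00 := hM0 e i 0 h0
      split_ifs with hs
      · rw [one_mul]
        by_contra hn
        obtain ⟨y, hy, hy0⟩ := hsub' ⟨not_lt.1 hn, hs.le⟩
        exact hM0 e i y hy hy0
      · rw [neg_one_mul, neg_pos]
        by_contra hn
        obtain ⟨y, hy, hy0⟩ := hsub ⟨not_lt.1 hs, not_lt.1 hn⟩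
        exact hM0 e i y hy hy0
    · by_cases hs : 0 < (S.M e 0 i i).re
      · simp [inflow, outflow, hs]
      · have : ¬ ((-1 : ℝ) = 1) := by norm_num
        simp [inflow, outflow, hs, this]

theorem coord_mem {v : V} (p : G.VIdx v) : G.coord v p.1.1 ∈ Set.Icc 0 (G.ℓ p.1.1) := by
  have := (G.ℓ_pos p.1.1).le
  unfold coord
  split_ifs
  · exact Set.right_mem_Icc.2 this
  · exact Set.left_mem_Icc.2 this

variable {m q : ∀ e, Fin (G.k e) → ℝ → ℝ}

/-- The incidence number `ι` equals `-s` at the outflow end and `s` at the inflow end, while `q > 0`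
and `s m > 0`. So the signs of the diagonal matrix `T_v` separate outflow from inflow indices. -/
theorem IsDiagonal.exists_T (h : S.IsDiagonal m q s) (v : V) : ∃ t : G.VIdx v → ℝ,
    (∀ ξ p, S.T v ξ p = t p * ξ p) ∧ (∀ p, G.IsOut s p → t p < 0) ∧
      ∀ p, ¬ G.IsOut s p → 0 < t p := by
  let ι : E → ℝ := fun e => (if G.term e = v then 1 else 0) - (if G.init e = v then 1 else 0)
  refine ⟨fun p => ι p.1.1 * (q p.1.1 p.2 (G.coord v p.1.1) * m p.1.1 p.2 (G.coord v p.1.1)),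
    fun ξ p => ?_, fun p hp => ?_, fun p hp => ?_⟩
  · have e : (fun e : G.Incident v =>
        G.incidence v e.1 • (S.Q e.1 (G.coord v e.1) * S.M e.1 (G.coord v e.1)))
        = fun e : G.Incident v => Matrix.diagonal fun i => ((ι e.1 * (q e.1 i (G.coord v e.1)
          * m e.1 i (G.coord v e.1)) : ℝ) : ℂ) := by
      funext e
      have hx := coord_mem (⟨e, ⟨0, G.k_pos e.1⟩⟩ : G.VIdx v)
      rw [h.M_eq e.1 _ hx, h.Q_eq e.1 _ hx, Matrix.diagonal_mul_diagonal, ← Matrix.diagonal_smul]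
      congr 1
      funext i
      simp only [Pi.smul_apply, smul_eq_mul, incidence, ι]
      push_cast
      simp only [apply_ite (Complex.ofReal), Complex.ofReal_one, Complex.ofReal_zero]
    unfold T
    rw [e, Matrix.blockDiagonal'_diagonal, Matrix.toLpLin_apply]
    simp only [Matrix.mulVec_diagonal]
  · have hm := (h.speed p.1.1 p.2).sign _ (coord_mem p)
    have hq := h.q_pos p.1.1 p.2 _ (coord_mem p)
    have hs : ι p.1.1 = - s p.1.1 p.2 := by
      have h' := G.loopless p.1.1
      unfold IsOut outV at hp
      rcases (h.speed p.1.1 p.2).cases with ⟨h1, -, -⟩ | ⟨h1, -, -⟩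
      · rw [h1, if_pos rfl] at hp
        have : G.term p.1.1 ≠ v := fun h2 => h' (hp.trans h2.symm)
        simp [ι, hp, this, h1]
      · rw [h1, if_neg (by norm_num)] at hp
        have : G.init p.1.1 ≠ v := fun h2 => h' (h2.trans hp.symm)
        simp [ι, hp, this, h1]
    show ι p.1.1 * _ < 0
    rw [hs]
    nlinarith [mul_pos hq hm]
  · have hm := (h.speed p.1.1 p.2).sign _ (coord_mem p)
    have hq := h.q_pos p.1.1 p.2 _ (coord_mem p)
    have hs : ι p.1.1 = s p.1.1 p.2 := by
      have h' := G.loopless p.1.1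
      rw [not_isOut_iff] at hp
      unfold inV at hp
      rcases (h.speed p.1.1 p.2).cases with ⟨h1, -, -⟩ | ⟨h1, -, -⟩
      · rw [h1, if_pos rfl] at hp
        have : G.init p.1.1 ≠ v := fun h2 => h' (h2.trans hp.symm)
        simp [ι, hp, this, h1]
      · rw [h1, if_neg (by norm_num)] at hp
        have : G.term p.1.1 ≠ v := fun h2 => h' (hp.trans h2.symm)
        simp [ι, hp, this, h1]
    show 0 < ι p.1.1 * _
    rw [hs]
    nlinarith [mul_pos hq hm]

end HypSystem

end Network
end

noncomputable section

set_option linter.unusedSectionVars false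

/-! ### Outflow coordinates on the vertex spaces -/

/-- A linear map into a product is onto if its range has no nonzero normal vector. -/
theorem LinearMap.prod_surjective_of_forall_inner {W F ι : Type*} [AddCommGroup W] [Module ℂ W]
    [NormedAddCommGroup F] [InnerProductSpace ℂ F] [FiniteDimensional ℂ F] [Fintype ι]
    (L : W →ₗ[ℂ] F) (L' : W →ₗ[ℂ] (ι → ℂ))
    (h : ∀ (y : F) (η : ι → ℂ),
      (∀ ξ, inner ℂ (L ξ) y + ∑ i, η i * (starRingEnd ℂ) (L' ξ i) = 0) → y = 0 ∧ η = 0) :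
    Function.Surjective (L.prod L') := by
  let Φ : W →ₗ[ℂ] WithLp 2 (F × EuclideanSpace ℂ ι) :=
    (WithLp.linearEquiv 2 ℂ (F × EuclideanSpace ℂ ι)).symm.toLinearMap ∘ₗ
      (L.prod ((WithLp.linearEquiv 2 ℂ (ι → ℂ)).symm.toLinearMap ∘ₗ L'))
  have hΦ : LinearMap.range Φ = ⊤ := by
    rw [← Submodule.orthogonal_eq_bot_iff, Submodule.eq_bot_iff]
    intro z hz
    obtain ⟨h1, h2⟩ := h z.fst (fun i => z.snd i) fun ξ => by
      have := (Submodule.mem_orthogonal _ _).1 hz _ (LinearMap.mem_range_self Φ ξ)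
      rw [WithLp.prod_inner_apply, PiLp.inner_apply] at this
      exact this
    refine WithLp.ofLp_injective 2 (Prod.ext h1 ?_)
    ext i
    exact congrFun h2 i
  rintro ⟨y, η⟩
  obtain ⟨ξ, hξ⟩ := LinearMap.range_eq_top.1 hΦ (WithLp.toLp 2 (y, WithLp.toLp 2 η))
  exact ⟨ξ, Prod.ext (congrArg (fun z : WithLp 2 (F × EuclideanSpace ℂ ι) => z.fst) hξ)
    (congrArg (fun z : WithLp 2 (F × EuclideanSpace ℂ ι) => WithLp.ofLp z.snd) hξ)⟩

namespace Network.HypSystem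

variable {V E : Type*} [Fintype V] [DecidableEq V] [Fintype E] [DecidableEq E]
variable {G : Network V E} (S : G.HypSystem) (s : ∀ e, Fin (G.k e) → ℝ)

/-- The map `ξ ↦ (P_v^{(d)} ξ, ξ|Out_v)` on `Y_v`, where `Out_v` consists of the components that
leave their edge at `v`. -/
def outflowMap (v : V) : S.Y v →ₗ[ℂ] S.Yd v × ({p : G.VIdx v // G.IsOut s p} → ℂ) :=
  (S.Pd v ∘ₗ (S.Y v).subtype).prod
    { toFun := fun ξ p => (ξ : G.VSpace v) p.1
      map_add' := fun _ _ => rfl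
      map_smul' := fun _ _ => rfl }

/-- The outflow values and the projections onto `Y_v^{(d)}` are coordinates on each `Y_v`. -/
def HasOutflowCoordinates : Prop := ∀ v, Function.Bijective (S.outflowMap s v)

variable {S s}

theorem inner_Pd {v : V} (ξ : G.VSpace v) (y : S.Yd v) :
    inner ℂ (S.Pd v ξ) y = inner ℂ ξ (y : G.VSpace v) :=
  Submodule.inner_orthogonalProjectionOnto_eq_of_mem_right y ξ

theorem outflowMap_injective {v : V}
    (h : ∀ ξ ∈ S.Y v, S.Pd v ξ = 0 → (∀ p : G.VIdx v, G.IsOut s p → ξ p = 0) → ξ = 0) :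
    Function.Injective (S.outflowMap s v) := by
  refine (injective_iff_map_eq_zero _).2 fun ξ hξ => Subtype.ext (h ξ ξ.2 ?_ fun p hp => ?_)
  · exact congrArg Prod.fst hξ
  · exact congrFun (congrArg Prod.snd hξ) ⟨p, hp⟩

/-- A normal vector `(y, z)` of the range gives, on extending `z` by zero, a vector `η` supported on
outflow indices that pairs with `Y_v` as `-y` does. Once `η = 0`, also `y = 0`, because `y` itself
belongs to `Y_v`. -/
theorem outflowMap_surjective {v : V}
    (h : ∀ (η : G.VSpace v) (y : S.Yd v), (∀ p : G.VIdx v, ¬ G.IsOut s p → η p = 0) →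
      (∀ ξ ∈ S.Y v, inner ℂ η ξ = inner ℂ (y : G.VSpace v) ξ) → η = 0) :
    Function.Surjective (S.outflowMap s v) := by
  refine LinearMap.prod_surjective_of_forall_inner (F := S.Yd v)
    (ι := {p : G.VIdx v // G.IsOut s p}) _ _ fun y z hz => ?_
  let η : G.VSpace v := WithLp.toLp 2 fun p => if hp : G.IsOut s p then z ⟨p, hp⟩ else 0
  have hη0 : ∀ p : G.VIdx v, ¬ G.IsOut s p → η p = 0 := fun p hp => dif_neg hp
  have hη1 : ∀ p : {p : G.VIdx v // G.IsOut s p}, η p.1 = z p := fun p => dif_pos p.2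
  have hin : ∀ ξ : S.Y v,
      inner ℂ (ξ : G.VSpace v) (y : G.VSpace v) + inner ℂ (ξ : G.VSpace v) η = 0 := by
    intro ξ
    rw [← hz ξ]
    refine congrArg₂ (· + ·) (inner_Pd (ξ : G.VSpace v) y).symm ?_
    rw [PiLp.inner_apply]
    rw [← Finset.sum_filter_add_sum_filter_not Finset.univ (fun p : G.VIdx v => G.IsOut s p),
      Finset.sum_eq_zero (s := Finset.univ.filter fun p : G.VIdx v => ¬ G.IsOut s p), add_zero,
      Finset.sum_subtype (p := fun p : G.VIdx v => G.IsOut s p) _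
        (fun p => by rw [Finset.mem_filter]; simp)]
    · exact Finset.sum_congr rfl fun p _ => by rw [hη1 p]; rfl
    · intro p hp
      rw [Finset.mem_filter] at hp
      rw [hη0 p hp.2, inner_zero_right]
  have h1 : η = 0 := by
    refine h η (-y) hη0 fun ξ hξ => ?_
    have := congrArg (starRingEnd ℂ) (hin ⟨ξ, hξ⟩)
    rw [map_add, inner_conj_symm, inner_conj_symm, map_zero] at this
    rw [Submodule.coe_neg, inner_neg_left]
    exact (neg_eq_of_add_eq_zero_right this).symm
  refine ⟨?_, ?_⟩
  · have := hin ⟨y, S.Yd_le v y.2⟩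
    rw [h1, inner_zero_right, add_zero] at this
    exact Subtype.ext (inner_self_eq_zero.1 this)
  · ext p
    rw [← hη1 p, h1]; rfl

theorem re_inner_T {v : V} {t : G.VIdx v → ℝ} (ht : ∀ ξ p, S.T v ξ p = t p * ξ p)
    (ξ : G.VSpace v) : (inner ℂ ξ (S.T v ξ)).re = ∑ p, t p * ‖ξ p‖ ^ 2 := by
  rw [PiLp.inner_apply, Complex.re_sum]
  refine Finset.sum_congr rfl fun p _ => ?_
  rw [ht, RCLike.inner_apply, mul_assoc, Complex.mul_conj, Complex.normSq_eq_norm_sq,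
    ← Complex.ofReal_mul, Complex.ofReal_re]

variable {m q : ∀ e, Fin (G.k e) → ℝ → ℝ}

/-- Every term of the vertex form containing `P_v^{(d)} ξ` disappears on the kernel, whatever `μ`
is, as does the pairing of `ξ` with `Y_v^{(d)}`. What remains is the form of `T_v` on inflow
indices, where it is positive definite. -/
theorem IsDiagonal.outflowMap_injective (h : S.IsDiagonal m q s) {v : V}
    (hform : ∃ μ : ℝ, 0 ≤ μ ∧ ∀ ξ : S.Y v, S.vertexForm v μ ξ ≤ 0) :
    Function.Injective (S.outflowMap s v) := by
  obtain ⟨t, ht, -, hin⟩ := h.exists_T v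
  obtain ⟨μ, -, hμ⟩ := hform
  refine HypSystem.outflowMap_injective fun ξ hξ hP hout => ?_
  have h1 := hμ ⟨ξ, hξ⟩
  unfold vertexForm at h1
  simp only [hP, map_zero, Submodule.coe_zero, smul_zero, sub_zero, add_zero] at h1
  have h0 : inner ℂ ξ (S.Qv v (S.B v ⟨ξ, hξ⟩) : G.VSpace v) = 0 := by
    rw [← inner_Pd, hP]; exact inner_zero_left (𝕜 := ℂ) (E := S.Yd v) _
  rw [inner_add_right, h0, add_zero, re_inner_T ht] at h1
  have hnn : ∀ p ∈ Finset.univ, 0 ≤ t p * ‖ξ p‖ ^ 2 := by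
    intro p _
    by_cases hp : G.IsOut s p
    · rw [hout p hp]; simp
    · have := hin p hp
      positivity
  have h2 := (Finset.sum_eq_zero_iff_of_nonneg hnn).1
    (le_antisymm h1 (Finset.sum_nonneg hnn))
  ext p
  by_cases hp : G.IsOut s p
  · exact hout p hp
  · have := h2 p (Finset.mem_univ _)
    have h3 := (mul_eq_zero.1 this).resolve_left (hin p hp).ne'
    simpa using h3

/-- Surjectivity is dual to injectivity: for `y = 0` and `κ = 0` the adjoint form is that of `-T_v`,
which is positive definite on outflow indices. A term `-κ |ξ|²` would spoil the argument. -/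
theorem IsDiagonal.hasOutflowCoordinates_of_strongAdjoint (h : S.IsDiagonal m q s)
    (hW : S.StrongAdjointAssumption) : S.HasOutflowCoordinates s := by
  intro v
  refine ⟨h.outflowMap_injective (hW v).1, outflowMap_surjective fun η y hη hy => ?_⟩
  obtain ⟨t, ht, hout, hin⟩ := h.exists_T v
  obtain ⟨μ, -, hμ⟩ := (hW v).2
  have ht0 : ∀ p, t p ≠ 0 := fun p => by
    by_cases hp : G.IsOut s p
    · exact (hout p hp).ne
    · exact (hin p hp).ne'
  -- `ζ = T_v⁻¹ η`. Since `η` pairs with `Y_v` as `y ∈ Y_v^{(d)}` does, its projection onto the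
  -- complement of `Y_v^{(d)}` in `Y_v` vanishes, so `(ζ, 0)` lies in `𝕐_v^*`.
  let ζ : G.VSpace v := WithLp.toLp 2 fun p => η p / t p
  have hζ : S.T v ζ = η := by
    ext p
    rw [ht]
    have : (t p : ℂ) ≠ 0 := by exact_mod_cast ht0 p
    exact mul_div_cancel₀ _ this
  have h1 := hμ ζ 0 (by
    unfold InYstar
    simp only [map_zero, Submodule.coe_zero, add_zero, hζ]
    rw [Submodule.orthogonalProjectionOnto_eq_zero_iff, Submodule.mem_orthogonal']
    intro z hz
    rw [hy z hz.2]
    exact Submodule.mem_orthogonal _ _ |>.1 hz.1 y y.2)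
  unfold adjointForm at h1
  have h0 : ∀ z : S.Yd v, inner ℂ (0 : S.Yd v) z = 0 := fun z =>
    inner_zero_left (𝕜 := ℂ) (E := S.Yd v) z
  simp only [h0, Submodule.coe_zero, map_zero, add_zero, Complex.ofReal_zero, zero_smul, sub_zero,
    inner_neg_right, Complex.neg_re, re_inner_T ht] at h1
  have hζ0 : ∀ p, ¬ G.IsOut s p → ζ p = 0 := fun p hp => by
    show η p / t p = 0
    rw [hη p hp, zero_div]
  have hnn : ∀ p ∈ Finset.univ, 0 ≤ -(t p * ‖ζ p‖ ^ 2) := by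
    intro p _
    by_cases hp : G.IsOut s p
    · have := hout p hp
      nlinarith [sq_nonneg ‖ζ p‖]
    · rw [hζ0 p hp]; simp
  have h2 := (Finset.sum_eq_zero_iff_of_nonneg hnn).1
    (le_antisymm (by rw [Finset.sum_neg_distrib]; exact h1) (Finset.sum_nonneg hnn))
  have h3 : ζ = 0 := by
    ext p
    have := h2 p (Finset.mem_univ _)
    have h3 := (mul_eq_zero.1 (neg_eq_zero.1 this)).resolve_left (ht0 p)
    simpa using h3
  rw [← hζ, h3, map_zero]

theorem finrank_outSpace (v : V) :
    Module.finrank ℂ (S.Yd v × ({p : G.VIdx v // G.IsOut s p} → ℂ))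
    = Module.finrank ℂ (S.Yd v) + ∑ p : G.VIdx v, if G.IsOut s p then 1 else 0 := by
  rw [Module.finrank_prod, Module.finrank_fintype_fun_eq_card, Fintype.card_subtype,
    Finset.card_filter]

theorem inner_Badj_right {v : V} (ξ : S.Y v) (y : S.Yd v) :
    inner ℂ ξ (S.Badj v y) = inner ℂ (S.B v ξ) y := by
  unfold Badj
  rw [LinearMap.adjoint_inner_right]

/-- `B_v` is injective on the range of its adjoint, since `B B^* y = 0` implies `B^* y = 0`;
rank-nullity for the adjoint then gives the bound. -/
theorem finrank_Yd_le (S : G.HypSystem) (v : V) : Module.finrank ℂ (S.Yd v)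
    ≤ Module.finrank ℂ (LinearMap.range (S.B v)) + Module.finrank ℂ (LinearMap.ker (S.Badj v)) := by
  rw [← (S.Badj v).finrank_range_add_finrank_ker]
  refine Nat.add_le_add_right (LinearMap.finrank_le_finrank_of_injective
    (f := (S.B v).rangeRestrict ∘ₗ (LinearMap.range (S.Badj v)).subtype)
    ((injective_iff_map_eq_zero _).2 ?_)) _
  rintro ⟨_, y, rfl⟩ hy
  have h1 : S.B v (S.Badj v y) = 0 := congrArg Subtype.val hy
  have h2 := inner_Badj_right (S.Badj v y) y
  rw [h1, Submodule.coe_inner, Submodule.coe_inner, Submodule.coe_zero, inner_zero_left] at h2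
  exact Subtype.ext (Subtype.ext (inner_self_eq_zero.1 h2))

/-- Of the basis property only the total number of basis vectors matters: it equals the number of
components, and hence of inflow ends. Together with injectivity at every vertex this leaves no room
for a dimension gap at any of them. -/
theorem IsDiagonal.hasOutflowCoordinates_of_primal (h : S.IsDiagonal m q s)
    (hW : S.PrimalAssumption) : S.HasOutflowCoordinates s := by
  obtain ⟨⟨b₁, b₂, b₃, b, -⟩, hform⟩ := hW
  have hinj : ∀ v, Function.Injective (S.outflowMap s v) :=
    fun v => h.outflowMap_injective (hform v)
  let a : V → ℕ := fun v => Module.finrank ℂ (S.Y v)ᗮ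
    + Module.finrank ℂ (LinearMap.range (S.B v)) + Module.finrank ℂ (LinearMap.ker (S.Badj v))
  let inn : V → ℕ := fun v => ∑ p : G.VIdx v, if G.IsOut s p then 0 else 1
  let out : V → ℕ := fun v => ∑ p : G.VIdx v, if G.IsOut s p then 1 else 0
  have hcard : ∀ v, Module.finrank ℂ (G.VSpace v) = inn v + out v := by
    intro v
    rw [finrank_euclideanSpace, ← Finset.sum_add_distrib, ← Finset.card_univ,
      Finset.card_eq_sum_ones]
    exact Finset.sum_congr rfl fun p _ => by split_ifs <;> rfl
  -- Both sides equal `k`: the left by the size of a basis of `ℂ^k`, the right because every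
  -- component has exactly one inflow end.
  have hsum : ∑ v, a v = ∑ v, inn v := by
    have h1 : ∑ v, inn v = ∑ e, ∑ i : Fin (G.k e), 1 := sum_not_isOut (s := s) fun _ _ => 1
    have h2 := Module.finrank_eq_card_basis b
    rw [Module.finrank_fintype_fun_eq_card] at h2
    simp only [Fintype.card_sigma, Fintype.card_fin, Fintype.card_sum] at h2
    rw [h1, ← h2]
    simp
  have hdim : ∀ v, Module.finrank ℂ (S.Y v) + a v ≥ inn v + out v + Module.finrank ℂ (S.Yd v) := by
    intro v
    have h1 := (S.Y v).finrank_add_finrank_orthogonal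
    rw [hcard] at h1
    have h2 := S.finrank_Yd_le v
    simp only [a]
    omega
  have hle : ∀ v, Module.finrank ℂ (S.Y v) ≤ Module.finrank ℂ (S.Yd v) + out v := by
    intro v
    rw [← finrank_outSpace]
    exact LinearMap.finrank_le_finrank_of_injective (hinj v)
  -- Injectivity yields `inn v ≤ a v` at each vertex; since the sums agree, so do all the terms.
  have heq : ∀ v, a v = inn v := by
    have hle' : ∀ v ∈ Finset.univ, inn v ≤ a v := fun v _ => by
      have := hdim v; have := hle v; omega
    exact fun v => ((Finset.sum_eq_sum_iff_of_le hle').1 hsum.symm v (Finset.mem_univ _)).symm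
  intro v
  refine ⟨hinj v, (LinearMap.injective_iff_surjective_of_finrank_eq_finrank ?_).1 (hinj v)⟩
  rw [finrank_outSpace]
  have := hdim v
  have := hle v
  have := heq v
  show _ = _ + out v
  omega

end Network.HypSystem
end

noncomputable section

set_option linter.unusedSectionVars false

/-! ### Coordinates of square integrable functions -/

theorem ContinuousOn.memLp_top {ℓ : ℝ} {f : ℝ → ℂ} (hf : ContinuousOn f (Set.Icc 0 ℓ)) :
    MemLp f ⊤ (volume.restrict (Set.Ioo 0 ℓ)) := by
  obtain ⟨C, hC⟩ := isCompact_Icc.exists_bound_of_continuousOn hf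
  refine memLp_top_of_bound
    ((hf.mono Set.Ioo_subset_Icc_self).aestronglyMeasurable measurableSet_Ioo) C ?_
  filter_upwards [ae_restrict_mem measurableSet_Ioo] with x hx
  exact hC x (Set.Ioo_subset_Icc_self hx)

theorem ContinuousOn.memLp_two {ℓ : ℝ} {f : ℝ → ℂ} (hf : ContinuousOn f (Set.Icc 0 ℓ)) :
    MemLp f 2 (volume.restrict (Set.Ioo 0 ℓ)) :=
  hf.memLp_top.mono_exponent le_top

theorem memLp_sum_smul_const {ι F : Type*} [Fintype ι] [NormedAddCommGroup F] [NormedSpace ℂ F]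
    {μ : Measure ℝ} {A : ℝ → Matrix ι ι ℂ} (hA : ∀ i j, MemLp (fun x => A x i j) ⊤ μ)
    (K : ι → ι → F) : MemLp (fun x => ∑ i, ∑ j, A x i j • K i j) ⊤ μ :=
  memLp_finsetSum _ fun i _ => memLp_finsetSum _ fun j _ =>
    (ContinuousLinearMap.toSpanSingleton ℂ (K i j)).comp_memLp' (hA i j)

namespace L2Interval

variable {ℓ : ℝ} {n : ℕ}

theorem exists_coord {f : Fin n → ℝ → ℂ}
    (hf : ∀ i, MemLp (f i) 2 (volume.restrict (Set.Ioo 0 ℓ))) :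
    ∃ u : L2Interval ℓ n, ∀ᵐ x ∂(volume.restrict (Set.Ioo 0 ℓ)), ∀ i, u x i = f i x := by
  have h : MemLp (fun x => (WithLp.toLp 2 fun i => f i x : EuclideanSpace ℂ (Fin n))) 2
      (volume.restrict (Set.Ioo 0 ℓ)) := MemLp.of_eval_piLp hf
  refine ⟨h.toLp, ?_⟩
  filter_upwards [h.coeFn_toLp] with x hx i
  rw [hx]

theorem ext_coord {u u' : L2Interval ℓ n}
    (h : ∀ᵐ x ∂(volume.restrict (Set.Ioo 0 ℓ)), ∀ i, u x i = u' x i) : u = u' :=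
  Lp.ext (h.mono fun _ hx => PiLp.ext hx)

theorem add_coord (u u' : L2Interval ℓ n) :
    ∀ᵐ x ∂(volume.restrict (Set.Ioo 0 ℓ)), ∀ i, (u + u') x i = u x i + u' x i := by
  filter_upwards [Lp.coeFn_add u u'] with x hx i
  rw [hx]; rfl

theorem sub_coord (u u' : L2Interval ℓ n) :
    ∀ᵐ x ∂(volume.restrict (Set.Ioo 0 ℓ)), ∀ i, (u - u') x i = u x i - u' x i := by
  filter_upwards [Lp.coeFn_sub u u'] with x hx i
  rw [hx]; rfl

theorem smul_coord (c : ℂ) (u : L2Interval ℓ n) :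
    ∀ᵐ x ∂(volume.restrict (Set.Ioo 0 ℓ)), ∀ i, (c • u) x i = c * u x i := by
  filter_upwards [Lp.coeFn_smul c u] with x hx i
  rw [hx]; rfl

theorem zero_coord :
    ∀ᵐ x ∂(volume.restrict (Set.Ioo 0 ℓ)), ∀ i, (0 : L2Interval ℓ n) x i = 0 := by
  filter_upwards [Lp.coeFn_zero (EuclideanSpace ℂ (Fin n)) 2
    (volume.restrict (Set.Ioo 0 ℓ))] with x hx i
  rw [hx]; rfl

theorem inner_eq (u u' : L2Interval ℓ n) :
    inner ℂ u u' = ∑ i, ∫ x in Set.Ioo 0 ℓ, (starRingEnd ℂ) (u x i) * u' x i := by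
  rw [L2.inner_def, ← integral_finsetSum]
  · refine integral_congr_ae (Eventually.of_forall fun x => ?_)
    simp only [PiLp.inner_apply, RCLike.inner_apply]
    exact Finset.sum_congr rfl fun i _ => mul_comm _ _
  · intro i _
    exact (memLp_coord u i).star.integrable_mul (memLp_coord u' i)

theorem norm_sq_eq (u : L2Interval ℓ n) :
    ‖u‖ ^ 2 = ∑ i, ∫ x in Set.Ioo 0 ℓ, ‖u x i‖ ^ 2 := by
  have h := inner_self_eq_norm_sq_to_K (𝕜 := ℂ) u
  rw [inner_eq] at h
  have e : ∀ i, ∫ x in Set.Ioo 0 ℓ, (starRingEnd ℂ) (u x i) * u x i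
      = ((∫ x in Set.Ioo 0 ℓ, ‖u x i‖ ^ 2 : ℝ) : ℂ) := by
    intro i
    rw [← integral_complex_ofReal]
    refine integral_congr_ae (Eventually.of_forall fun x => ?_)
    simp only [Complex.conj_mul', Complex.ofReal_pow]
  simp_rw [e] at h
  rw [← Complex.ofReal_sum] at h
  exact Complex.ofReal_injective ((Complex.ofReal_pow _ _).trans h.symm)

theorem norm_sq_le (hℓ : 0 ≤ ℓ) {u : L2Interval ℓ n} {c : ℝ}
    (h : ∀ᵐ x ∂(volume.restrict (Set.Ioo 0 ℓ)), ∀ i, ‖u x i‖ ≤ c) : ‖u‖ ^ 2 ≤ n * (ℓ * c ^ 2) := by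
  have e : (n : ℝ) * (ℓ * c ^ 2) = ∑ _ : Fin n, ∫ _ in Set.Ioo 0 ℓ, c ^ 2 := by
    simp [hℓ]
  rw [norm_sq_eq, e]
  refine Finset.sum_le_sum fun i _ => integral_mono_ae ?_ (integrable_const _) ?_
  · exact (memLp_coord u i).integrable_norm_pow (by norm_num)
  · filter_upwards [h] with x hx
    have := hx i
    gcongr

theorem integral_le_norm_sq (u : L2Interval ℓ n) (i : Fin n) :
    ∫ x in Set.Ioo 0 ℓ, ‖u x i‖ ^ 2 ≤ ‖u‖ ^ 2 := by
  rw [norm_sq_eq]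
  exact Finset.single_le_sum (f := fun i => ∫ x in Set.Ioo 0 ℓ, ‖u x i‖ ^ 2)
    (fun i _ => integral_nonneg fun x => by positivity) (Finset.mem_univ i)

/-- Multiplication by a bounded matrix valued function. -/
theorem exists_mul {A : ℝ → Matrix (Fin n) (Fin n) ℂ}
    (hA : ∀ i j, MemLp (fun x => A x i j) ⊤ (volume.restrict (Set.Ioo 0 ℓ))) :
    ∃ L : L2Interval ℓ n →L[ℂ] L2Interval ℓ n, ∀ u, ∀ᵐ x ∂(volume.restrict (Set.Ioo 0 ℓ)),
      ∀ i, L u x i = ∑ j, A x i j * u x j := by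
  let K : Fin n → Fin n → EuclideanSpace ℂ (Fin n) →L[ℂ] EuclideanSpace ℂ (Fin n) :=
    fun i j => (EuclideanSpace.proj (𝕜 := ℂ) j).smulRight (EuclideanSpace.single i 1)
  have h := memLp_sum_smul_const hA K
  refine ⟨(ContinuousLinearMap.id ℂ (EuclideanSpace ℂ (Fin n) →L[ℂ]
    EuclideanSpace ℂ (Fin n))).holderL (volume.restrict (Set.Ioo 0 ℓ)) ⊤ 2 2 h.toLp, fun u => ?_⟩
  filter_upwards [(ContinuousLinearMap.id ℂ (EuclideanSpace ℂ (Fin n) →L[ℂ]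
    EuclideanSpace ℂ (Fin n))).coeFn_holder (r := 2) h.toLp u, h.coeFn_toLp] with x hx hx' i
  refine (congrArg (fun z : EuclideanSpace ℂ (Fin n) => z i) hx).trans ?_
  rw [hx']
  simp [K, Finset.sum_apply, Pi.single_apply]

end L2Interval

end

noncomputable section

set_option linter.unusedSectionVars false

/-! ### The operator in components -/

namespace Network

variable {V E : Type*} [Fintype V] [DecidableEq V] [Fintype E] [DecidableEq E]
variable {G : Network V E}

/-- The boundary values at `v` of a family of scalar functions. -/
def traceVec (G : Network V E) (w : ∀ e, Fin (G.k e) → ℝ → ℂ) (v : V) : G.VSpace v :=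
  G.trace (fun e x => WithLp.toLp 2 fun i => w e i x) v

theorem traceVec_of_isOut {s : ∀ e, Fin (G.k e) → ℝ} (w : ∀ e, Fin (G.k e) → ℝ → ℂ) {v : V}
    {p : G.VIdx v} (h : G.IsOut s p) :
    G.traceVec w v p = w p.1.1 p.2 (G.outflow s p.1.1 p.2) := trace_of_isOut _ h

theorem traceVec_of_not_isOut {s : ∀ e, Fin (G.k e) → ℝ} (w : ∀ e, Fin (G.k e) → ℝ → ℂ) {v : V}
    {p : G.VIdx v} (h : ¬ G.IsOut s p) :
    G.traceVec w v p = w p.1.1 p.2 (G.inflow s p.1.1 p.2) := trace_of_not_isOut _ h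

namespace HypSystem

variable (S : G.HypSystem)

/-- The element of `𝐋²_d` with the given components. -/
def mkSpace (u : ∀ e, L2Interval (G.ℓ e) (G.k e)) (x : ∀ v, S.Yd v) : S.Space :=
  WithLp.toLp 2 (WithLp.toLp 2 u, WithLp.toLp 2 x)

variable {S}

theorem space_ext {U U' : S.Space} (h : ∀ e, U.fst e = U'.fst e) (h' : ∀ v, U.snd v = U'.snd v) :
    U = U' :=
  WithLp.ofLp_injective 2 (Prod.ext (PiLp.ext h) (PiLp.ext h'))

theorem space_norm_sq (U : S.Space) :
    ‖U‖ ^ 2 = ∑ e, ‖U.fst e‖ ^ 2 + ∑ v, ‖U.snd v‖ ^ 2 := by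
  rw [WithLp.prod_norm_sq_eq_of_L2, PiLp.norm_sq_eq_of_L2, PiLp.norm_sq_eq_of_L2]

set_option synthInstance.maxHeartbeats 400000 in
instance spaceInnerProductSpace : InnerProductSpace ℂ S.Space := inferInstance

theorem space_inner (U U' : S.Space) :
    inner ℂ U U' = ∑ e, inner ℂ (U.fst e) (U'.fst e)
      + ∑ v, inner ℂ (U.snd v : G.VSpace v) (U'.snd v : G.VSpace v) := by
  rw [WithLp.prod_inner_apply, PiLp.inner_apply, PiLp.inner_apply]
  rfl

variable (S) in
/-- The operator acting by the given operators on the components of `𝐋²_d`. -/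
def diagOp (L : ∀ e, L2Interval (G.ℓ e) (G.k e) →L[ℂ] L2Interval (G.ℓ e) (G.k e)) (c : ℂ) :
    S.Space →L[ℂ] S.Space :=
  (WithLp.prodContinuousLinearEquiv 2 ℂ _ _).symm.toContinuousLinearMap ∘L
    (((PiLp.continuousLinearEquiv 2 ℂ _).symm.toContinuousLinearMap ∘L
      ContinuousLinearMap.piMap L ∘L
        (PiLp.continuousLinearEquiv 2 ℂ _).toContinuousLinearMap).prodMap
      (c • ContinuousLinearMap.id ℂ _)) ∘L
    (WithLp.prodContinuousLinearEquiv 2 ℂ _ _).toContinuousLinearMap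

theorem diagOp_fst (L : ∀ e, L2Interval (G.ℓ e) (G.k e) →L[ℂ] L2Interval (G.ℓ e) (G.k e)) (c : ℂ)
    (U : S.Space) (e : E) : (S.diagOp L c U).fst e = L e (U.fst e) := rfl

theorem diagOp_snd (L : ∀ e, L2Interval (G.ℓ e) (G.k e) →L[ℂ] L2Interval (G.ℓ e) (G.k e)) (c : ℂ)
    (U : S.Space) (v : V) : (S.diagOp L c U).snd v = c • U.snd v := rfl

/-- The functions `w`, `g` and the values `F` are, respectively, the components of `u`, those
of `u'`, and the value of the operator `(u, x) ↦ (M u', L γ(u))` at `U = (u, x)`. -/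
structure IsComponents (m : ∀ e, Fin (G.k e) → ℝ → ℝ) (L : ∀ v, S.Y v →ₗ[ℂ] S.Yd v)
    (U F : S.Space) (w g : ∀ e, Fin (G.k e) → ℝ → ℂ) : Prop where
  prim : ∀ e i, IsPrimitive (G.ℓ e) (w e i) (g e i)
  fst : ∀ e, ∀ᵐ x ∂(volume.restrict (Set.Ioo 0 (G.ℓ e))), ∀ i, U.fst e x i = w e i x
  fst' : ∀ e, ∀ᵐ x ∂(volume.restrict (Set.Ioo 0 (G.ℓ e))), ∀ i, F.fst e x i = m e i x * g e i x
  mem : ∀ v, G.traceVec w v ∈ S.Y v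
  snd : ∀ v, U.snd v = S.Pd v (G.traceVec w v)
  snd' : ∀ v, F.snd v = L v ⟨G.traceVec w v, mem v⟩

variable (S) in
/-- The graph of the operator `(u, x) ↦ (M u', L γ(u))` with diagonal `M`. -/
def transportGraph (m : ∀ e, Fin (G.k e) → ℝ → ℝ) (L : ∀ v, S.Y v →ₗ[ℂ] S.Yd v)
    (U F : S.Space) : Prop := ∃ w g, IsComponents m L U F w g

variable (S) in
/-- The operator `B_v + C_v P_v^{(d)} + c P_v^{(d)}`. -/
def shiftedBCP (c : ℝ) (v : V) : S.Y v →ₗ[ℂ] S.Yd v :=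
  S.BCP v + (c : ℂ) • (S.Pd v ∘ₗ (S.Y v).subtype)

theorem shiftedBCP_apply (c : ℝ) {v : V} (ξ : S.Y v) :
    S.shiftedBCP c v ξ = S.B v ξ + S.C v (S.Pd v ξ) + (c : ℂ) • S.Pd v ξ := rfl

theorem N_bounded_Ioo (S : G.HypSystem) (e : E) (i j : Fin (G.k e)) :
    MemLp (fun x => S.N e x i j) ⊤ (volume.restrict (Set.Ioo 0 (G.ℓ e))) :=
  (S.N_bounded e i j).mono_measure (Measure.restrict_mono Set.Ioo_subset_Icc_self le_rfl)

variable (S) in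
/-- The operator `(u, x) ↦ ((N + c) u, 0)` is bounded. -/
theorem exists_lowerOrder (c : ℝ) : ∃ P : S.Space →L[ℂ] S.Space, (∀ U v, (P U).snd v = 0) ∧
    ∀ U e, ∀ᵐ x ∂(volume.restrict (Set.Ioo 0 (G.ℓ e))), ∀ i,
      (P U).fst e x i = ∑ j, S.N e x i j * U.fst e x j + c * U.fst e x i := by
  choose L hL using fun e => L2Interval.exists_mul (S.N_bounded_Ioo e)
  refine ⟨S.diagOp (fun e => L e + (c : ℂ) • ContinuousLinearMap.id ℂ _) 0, fun U v => ?_,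
    fun U e => ?_⟩
  · rw [diagOp_snd, zero_smul]
  · have h : (S.diagOp (fun e => L e + (c : ℂ) • ContinuousLinearMap.id ℂ _) 0 U).fst e
        = L e (U.fst e) + (c : ℂ) • U.fst e := rfl
    rw [h]
    filter_upwards [L2Interval.add_coord (L e (U.fst e)) ((c : ℂ) • U.fst e),
      L2Interval.smul_coord (c : ℂ) (U.fst e), hL e (U.fst e)] with x h1 h2 h3 i
    rw [h1, h2, h3]

variable {m q : ∀ e, Fin (G.k e) → ℝ → ℝ} {s : ∀ e, Fin (G.k e) → ℝ}

theorem toEuclideanLin_coord {n : ℕ} (A : Matrix (Fin n) (Fin n) ℂ) (ξ : EuclideanSpace ℂ (Fin n))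
    (i : Fin n) : Matrix.toEuclideanLin A ξ i = ∑ j, A i j * ξ j := rfl

theorem IsDiagonal.toEuclideanLin_M (h : S.IsDiagonal m q s) {e : E} {x : ℝ}
    (hx : x ∈ Set.Icc 0 (G.ℓ e)) (ξ : EuclideanSpace ℂ (Fin (G.k e))) (i : Fin (G.k e)) :
    Matrix.toEuclideanLin (S.M e x) ξ i = m e i x * ξ i := by
  rw [h.M_eq e x hx, Matrix.toLpLin_apply]
  simp [Matrix.mulVec_diagonal]

/-- Writes `𝔸` as the transport part with shifted vertex operator, plus the bounded operator `(N +
c, 0)`, minus `c`. The shifts cancel; they are there to make both pieces preserve positivity when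
`c` is large. -/
theorem IsDiagonal.opGraph_iff (h : S.IsDiagonal m q s) {c : ℝ} {P : S.Space →L[ℂ] S.Space}
    (hP0 : ∀ U v, (P U).snd v = 0)
    (hP : ∀ U e, ∀ᵐ x ∂(volume.restrict (Set.Ioo 0 (G.ℓ e))), ∀ i,
      (P U).fst e x i = ∑ j, S.N e x i j * U.fst e x j + c * U.fst e x i) (U F : S.Space) :
    S.opGraph U F ↔ S.transportGraph m (S.shiftedBCP c) U (F + (c : ℂ) • U - P U) := by
  have hfst : ∀ e, ∀ᵐ x ∂(volume.restrict (Set.Ioo 0 (G.ℓ e))), ∀ i,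
      (F + (c : ℂ) • U - P U).fst e x i = F.fst e x i - ∑ j, S.N e x i j * U.fst e x j := by
    intro e
    have h0 : (F + (c : ℂ) • U - P U).fst e = F.fst e + (c : ℂ) • U.fst e - (P U).fst e := rfl
    rw [h0]
    filter_upwards [L2Interval.sub_coord (F.fst e + (c : ℂ) • U.fst e) ((P U).fst e),
      L2Interval.add_coord (F.fst e) ((c : ℂ) • U.fst e),
      L2Interval.smul_coord (c : ℂ) (U.fst e), hP U e] with x h1 h2 h3 h4 i
    rw [h1, h2, h3, h4]; ring
  have hsnd : ∀ v, (F + (c : ℂ) • U - P U).snd v = F.snd v + (c : ℂ) • U.snd v := by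
    intro v
    have h0 : (F + (c : ℂ) • U - P U).snd v = F.snd v + (c : ℂ) • U.snd v - (P U).snd v := rfl
    rw [h0, hP0, sub_zero]
  constructor
  · rintro ⟨g, w, hY, hw, hx, hF, hF'⟩
    refine ⟨fun e i x => w e x i, fun e i x => g e x i,
      fun e i => isPrimitive_of_isWeakDeriv (G.ℓ_pos e) (hw e).1 (hw e).2 i, fun e => ?_,
      fun e => ?_, hY, hx, fun v => ?_⟩
    · exact (hw e).2.2.mono fun x hx i => by rw [hx]
    · filter_upwards [hF e, hfst e, ae_restrict_mem measurableSet_Ioo] with x h1 h2 h3 i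
      rw [h2, h1, PiLp.add_apply, toEuclideanLin_coord (S.N e x), add_sub_cancel_right,
        h.toEuclideanLin_M (Set.Ioo_subset_Icc_self h3)]
    · rw [hsnd, hF' v, hx v]; rfl
  · rintro ⟨w, g, hc⟩
    -- The derivative is only known to be integrable; it is square integrable because `m g` is and
    -- `1 / m` is bounded.
    have hg : ∀ e i, MemLp (g e i) 2 (volume.restrict (Set.Ioo 0 (G.ℓ e))) := by
      intro e i
      have hi : ContinuousOn (fun x => (((m e i x)⁻¹ : ℝ) : ℂ)) (Set.Icc 0 (G.ℓ e)) :=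
        Complex.continuous_ofReal.comp_continuousOn (h.speed e i).continuousOn_inv
      have := (L2Interval.memLp_coord ((F + (c : ℂ) • U - P U).fst e) i).mul' (r := 2) hi.memLp_top
      refine this.ae_eq ?_
      filter_upwards [hc.fst' e, ae_restrict_mem measurableSet_Ioo] with x h1 h2
      have h3 : (m e i x : ℂ) ≠ 0 := by
        exact_mod_cast (h.speed e i).ne_zero (Set.Ioo_subset_Icc_self h2)
      rw [h1, Complex.ofReal_inv, inv_mul_cancel_left₀ h3]
    choose g' hg' using fun e => L2Interval.exists_coord (hg e)
    refine ⟨g', fun e x => WithLp.toLp 2 fun i => w e i x, hc.mem, fun e => ?_, hc.snd,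
      fun e => ?_, fun v => ?_⟩
    · refine isWeakDeriv_of_isPrimitive (G.ℓ_pos e) ((hc.fst e).mono fun x hx => PiLp.ext hx)
        fun i => (hc.prim e i).congr (G.ℓ_pos e).le (fun x _ => rfl) ?_
      exact (hg' e).mono fun x hx => hx i
    · filter_upwards [hfst e, hc.fst' e, hg' e, ae_restrict_mem measurableSet_Ioo]
        with x h1 h2 h3 h4
      ext i
      rw [PiLp.add_apply, toEuclideanLin_coord (S.N e x),
        h.toEuclideanLin_M (Set.Ioo_subset_Icc_self h4), h3, ← h2, h1, sub_add_cancel]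
    · have h1 := hc.snd' v
      rw [hsnd, shiftedBCP_apply, hc.snd v] at h1
      rw [hc.snd v]
      exact add_right_cancel h1

end HypSystem

end Network
end

noncomputable section

set_option linter.unusedSectionVars false

/-! ### Outflow coordinates from well-posedness -/

namespace C0Semigroup.IsGeneratedBy

variable {H : Type*} [NormedAddCommGroup H] [InnerProductSpace ℂ H] [CompleteSpace H]
  {T : C0Semigroup H} {A : H → H → Prop}

/-- The estimate for `A - P`: the extra term `(M / l) ‖P‖ ‖U‖` is at most `‖U‖ / 2` once `l ≥ 2 M (1
+ ‖P‖)`. -/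
theorem norm_le_of_perturbation (hT : T.IsGeneratedBy A) (P : H →L[ℂ] H) :
    ∃ M : ℝ, 1 ≤ M ∧ ∀ l : ℝ, M ≤ l → ∀ U F, A U (F + P U) →
      ‖U‖ ≤ M / l * ‖(l : ℂ) • U - F‖ := by
  obtain ⟨M, hM, H⟩ := hT.norm_le
  refine ⟨2 * M * (1 + ‖P‖), by nlinarith [norm_nonneg P], fun l hl U F hUF => ?_⟩
  have hPn := norm_nonneg P
  have hl1 : M ≤ l := by nlinarith
  have hl0 : 0 < l := by linarith
  have h1 := H l hl1 U (F + P U) hUF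
  have h2 : ‖(l : ℂ) • U - (F + P U)‖ ≤ ‖(l : ℂ) • U - F‖ + ‖P‖ * ‖U‖ := by
    rw [← sub_sub]
    exact (norm_sub_le _ _).trans (by gcongr; exact P.le_opNorm U)
  have h3 : M / l * (‖P‖ * ‖U‖) ≤ ‖U‖ / 2 := by
    have : M / l * ‖P‖ ≤ 1 / 2 := by
      rw [div_mul_eq_mul_div, div_le_iff₀ hl0]; nlinarith
    nlinarith [norm_nonneg U]
  have h4 : ‖U‖ ≤ M / l * ‖(l : ℂ) • U - F‖ + M / l * (‖P‖ * ‖U‖) := by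
    rw [← mul_add]; exact h1.trans (by gcongr)
  have h5 : 2 * (M / l * ‖(l : ℂ) • U - F‖)
      ≤ 2 * M * (1 + ‖P‖) / l * ‖(l : ℂ) • U - F‖ := by
    have : 2 * (M / l) ≤ 2 * M * (1 + ‖P‖) / l := by
      rw [← mul_div_assoc]
      exact div_le_div_of_nonneg_right (by nlinarith) hl0.le
    nlinarith [norm_nonneg ((l : ℂ) • U - F)]
  linarith

/-- The perturbation raises `κ` by `‖Ψ‖ ‖P‖`, which is absorbed for large `l` in the same way. -/
theorem norm_le_of_dual_of_perturbation (hT : T.IsGeneratedBy A) (P : H →L[ℂ] H) :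
    ∃ M : ℝ, 1 ≤ M ∧ ∀ l : ℝ, M ≤ l → ∀ (Ψ : H) (κ : ℝ), 0 ≤ κ →
      (∀ U F, A U (F + P U) → ‖inner ℂ Ψ ((l : ℂ) • U - F)‖ ≤ κ * ‖U‖) → ‖Ψ‖ ≤ M / l * κ := by
  obtain ⟨M, hM, H⟩ := hT.norm_le_of_dual
  refine ⟨2 * M * (1 + ‖P‖), by nlinarith [norm_nonneg P], fun l hl Ψ κ hκ hΨ => ?_⟩
  have hPn := norm_nonneg P
  have hl1 : M ≤ l := by nlinarith
  have hl0 : 0 < l := by linarith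
  have h1 := H l hl1 Ψ (κ + ‖Ψ‖ * ‖P‖) (by positivity) fun U F hUF => by
    have h2 := hΨ U (F - P U) (by rwa [sub_add_cancel])
    have h3 : (l : ℂ) • U - F = ((l : ℂ) • U - (F - P U)) - P U := by abel
    rw [h3, inner_sub_right, add_mul]
    refine (norm_sub_le _ _).trans (add_le_add h2 ?_)
    rw [mul_assoc]
    exact (norm_inner_le_norm _ _).trans (by gcongr; exact P.le_opNorm U)
  have h3 : M / l * (‖Ψ‖ * ‖P‖) ≤ ‖Ψ‖ / 2 := by
    have : M / l * ‖P‖ ≤ 1 / 2 := by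
      rw [div_mul_eq_mul_div, div_le_iff₀ hl0]; nlinarith
    nlinarith [norm_nonneg Ψ]
  have h5 : 2 * (M / l * κ) ≤ 2 * M * (1 + ‖P‖) / l * κ := by
    have : 2 * (M / l) ≤ 2 * M * (1 + ‖P‖) / l := by
      rw [← mul_div_assoc]
      exact div_le_div_of_nonneg_right (by nlinarith) hl0.le
    nlinarith
  rw [mul_add] at h1
  linarith

end C0Semigroup.IsGeneratedBy

/-- The clash of scales behind both halves of the bijection: a positive quantity of order `1/l`
cannot stay below one of order `1/l²`. -/
theorem nonpos_of_forall_div_le {α L K : ℝ} (hL : 0 < L)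
    (h : ∀ l ≥ L, α / l ≤ (K / l) ^ 2) : α ≤ 0 := by
  by_contra hα
  have hα := not_le.1 hα
  set l := max L (K ^ 2 / α + 1) with hl
  have hl0 : 0 < l := hL.trans_le (le_max_left _ _)
  have h1 := h l (le_max_left _ _)
  rw [div_pow, div_le_div_iff₀ hl0 (by positivity), sq l, ← mul_assoc] at h1
  have h2 : α * l ≤ K ^ 2 := le_of_mul_le_mul_right h1 hl0
  have h3 : K ^ 2 / α + 1 ≤ l := le_max_right _ _
  have h4 : K ^ 2 + α ≤ α * l := by
    calc K ^ 2 + α = α * (K ^ 2 / α + 1) := by field_simp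
      _ ≤ α * l := by gcongr
  linarith

/-- The weight `s / m` cancels the coefficient of the derivative, so integration by parts meets only
`χ`; as `χ` vanishes at the inflow end, the outflow value is the only boundary term. -/
theorem IsSpeed.integral_eq {ℓ : ℝ} {m : ℝ → ℝ} {s b o : ℝ} (h : IsSpeed ℓ m s b o) (l : ℝ)
    {χ χ' : ℝ → ℝ} (hχ : ∀ x ∈ Set.Icc 0 ℓ, HasDerivAt χ (χ' x) x)
    (hχ' : ContinuousOn χ' (Set.Icc 0 ℓ)) (ho : χ o = 1) (hb : χ b = 0) {w g : ℝ → ℂ}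
    (hw : IsPrimitive ℓ w g) :
    ∫ x in Set.Ioo 0 ℓ, ((s * χ x / m x : ℝ) : ℂ) * (l * w x - m x * g x)
      = w o + ∫ x in Set.Ioo 0 ℓ, ((s / m x * (l * χ x + m x * χ' x) : ℝ) : ℂ) * w x := by
  have hℓ := h.pos.le
  have hc : ContinuousOn χ (Set.Icc 0 ℓ) := fun x hx => (hχ x hx).continuousAt.continuousWithinAt
  have hm : ContinuousOn (fun x => (m x : ℂ)) (Set.Icc 0 ℓ) :=
    Complex.continuous_ofReal.comp_continuousOn h.continuousOn
  have hwc := hw.continuousOn hℓ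
  have hp : IsPrimitive ℓ (fun x => (χ x : ℂ) * w x)
      (fun x => ((χ' x : ℝ) : ℂ) * w x + χ x * g x) :=
    (IsPrimitive.of_hasDerivAt hℓ (fun x hx => (hχ x hx).ofReal_comp)
      (Complex.continuous_ofReal.comp_continuousOn hχ')).mul hw hℓ
  have h1 := hp.integral_eq hℓ
  have h2 : -(s : ℂ) * ((χ ℓ : ℂ) * w ℓ - χ 0 * w 0) = w o := by
    rcases h.cases with ⟨h3, h4, h5⟩ | ⟨h3, h4, h5⟩
    · rw [h4] at hb; rw [h5] at ho ⊢; rw [h3, hb, ho]; simp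
    · rw [h4] at hb; rw [h5] at ho ⊢; rw [h3, hb, ho]; simp
  rw [← h2, ← h1, integral_Ioo_eq hℓ, integral_Ioo_eq hℓ, ← intervalIntegral.integral_const_mul,
    ← intervalIntegral.integral_add (hp.integrable.const_mul _)]
  · refine intervalIntegral.integral_congr fun x hx => ?_
    rw [Set.uIcc_of_le hℓ] at hx
    have hm0 : (m x : ℂ) ≠ 0 := by exact_mod_cast h.ne_zero hx
    push_cast
    field_simp
    ring
  · refine ContinuousOn.intervalIntegrable ?_
    rw [Set.uIcc_of_le hℓ]
    refine ContinuousOn.mul (Complex.continuous_ofReal.comp_continuousOn ?_) hwc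
    exact (continuousOn_const.div h.continuousOn fun x hx => h.ne_zero hx).mul
      ((continuousOn_const.mul hc).add (h.continuousOn.mul hχ'))

namespace Network.HypSystem

variable {V E : Type*} [Fintype V] [DecidableEq V] [Fintype E] [DecidableEq E]
variable {G : Network V E} {S : G.HypSystem}

theorem space_norm_sq_le {U : S.Space} {c c' : ℝ}
    (h : ∀ e, ∀ᵐ x ∂(volume.restrict (Set.Ioo 0 (G.ℓ e))), ∀ i, ‖U.fst e x i‖ ≤ c)
    (h' : ∀ v, ‖U.snd v‖ ≤ c') :
    ‖U‖ ^ 2 ≤ ∑ e, G.k e * (G.ℓ e * c ^ 2) + ∑ _ : V, c' ^ 2 := by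
  rw [space_norm_sq]
  refine add_le_add (Finset.sum_le_sum fun e _ => L2Interval.norm_sq_le (G.ℓ_pos e).le (h e))
    (Finset.sum_le_sum fun v _ => ?_)
  have := h' v
  gcongr

theorem fst_norm_sq_le (U : S.Space) (e : E) : ‖U.fst e‖ ^ 2 ≤ ‖U‖ ^ 2 := by
  rw [space_norm_sq]
  have h1 := Finset.single_le_sum (f := fun e => ‖U.fst e‖ ^ 2) (fun e _ => by positivity)
    (Finset.mem_univ e)
  have h2 : 0 ≤ ∑ v, ‖U.snd v‖ ^ 2 := Finset.sum_nonneg fun v _ => by positivity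
  linarith

theorem snd_norm_sq_le (U : S.Space) (v : V) : ‖U.snd v‖ ^ 2 ≤ ‖U‖ ^ 2 := by
  rw [space_norm_sq]
  have h1 := Finset.single_le_sum (f := fun v => ‖U.snd v‖ ^ 2) (fun e _ => by positivity)
    (Finset.mem_univ v)
  have h2 : 0 ≤ ∑ e, ‖U.fst e‖ ^ 2 := Finset.sum_nonneg fun v _ => by positivity
  linarith

variable {m q : ∀ e, Fin (G.k e) → ℝ → ℝ} {s : ∀ e, Fin (G.k e) → ℝ} {T : C0Semigroup S.Space}

theorem IsDiagonal.transport_norm_le (h : S.IsDiagonal m q s) (hT : T.IsGeneratedBy S.opGraph) :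
    ∃ M : ℝ, 1 ≤ M ∧ ∀ l : ℝ, M ≤ l → ∀ U F, S.transportGraph m (S.shiftedBCP 0) U F →
      ‖U‖ ≤ M / l * ‖(l : ℂ) • U - F‖ := by
  obtain ⟨P, hP0, hP⟩ := S.exists_lowerOrder 0
  obtain ⟨M, hM, H⟩ := hT.norm_le_of_perturbation P
  refine ⟨M, hM, fun l hl U F hUF => H l hl U F ((h.opGraph_iff hP0 hP _ _).2 ?_)⟩
  rwa [Complex.ofReal_zero, zero_smul, add_zero, add_sub_cancel_right]

theorem IsDiagonal.transport_norm_le_of_dual (h : S.IsDiagonal m q s)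
    (hT : T.IsGeneratedBy S.opGraph) :
    ∃ M : ℝ, 1 ≤ M ∧ ∀ l : ℝ, M ≤ l → ∀ (Ψ : S.Space) (κ : ℝ), 0 ≤ κ →
      (∀ U F, S.transportGraph m (S.shiftedBCP 0) U F →
        ‖inner ℂ Ψ ((l : ℂ) • U - F)‖ ≤ κ * ‖U‖) → ‖Ψ‖ ≤ M / l * κ := by
  obtain ⟨P, hP0, hP⟩ := S.exists_lowerOrder 0
  obtain ⟨M, hM, H⟩ := hT.norm_le_of_dual_of_perturbation P
  refine ⟨M, hM, fun l hl Ψ κ hκ hΨ => H l hl Ψ κ hκ fun U F hUF => hΨ U F ?_⟩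
  have := (h.opGraph_iff hP0 hP _ _).1 hUF
  rwa [Complex.ofReal_zero, zero_smul, add_zero, add_sub_cancel_right] at this

/-- A kernel vector `ξ` has inflow entries only. Placing them on functions concentrated at the
inflow ends yields elements `U` of the domain for which `(l - A) U` stays bounded while `‖U‖²` is at
least of order `|ξ_p|² / l`; the resolvent estimate makes `‖U‖²` of order `1/l²`, so `ξ = 0`. -/
theorem IsDiagonal.outflowMap_injective_of_isGeneratedBy (h : S.IsDiagonal m q s)
    (hT : T.IsGeneratedBy S.opGraph) (v₀ : V) : Function.Injective (S.outflowMap s v₀) := by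
  refine HypSystem.outflowMap_injective fun ξ hξ hPξ hout => ?_
  let a : ∀ e, Fin (G.k e) → ℂ := fun e i =>
    if hv : G.inV s e i = v₀ then ξ ⟨⟨e, hv ▸ G.incident_inV s e i⟩, i⟩ else 0
  have ha : ∀ p : G.VIdx v₀, ¬ G.IsOut s p → a p.1.1 p.2 = ξ p :=
    fun p hp => dif_pos ((not_isOut_iff p).1 hp)
  have ha' : ∀ v, v ≠ v₀ → ∀ p : G.VIdx v, ¬ G.IsOut s p → a p.1.1 p.2 = 0 :=
    fun v hv p hp => dif_neg fun h' => hv (((not_isOut_iff p).1 hp).symm.trans h')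
  have han : ∀ e i, ‖a e i‖ ≤ ‖ξ‖ := by
    intro e i
    simp only [a]
    split_ifs
    · exact PiLp.norm_apply_le ξ _
    · simp
  choose D c l₀ hD hc hl₀ H using fun e i => (h.speed e i).exists_testFunction
  obtain ⟨M, hM, hest⟩ := h.transport_norm_le hT
  set D₀ := ∑ e, ∑ i, D e i with hD₀
  have hDle : ∀ e i, D e i ≤ D₀ := fun e i =>
    (Finset.single_le_sum (f := D e) (fun i _ => hD e i) (Finset.mem_univ i)).trans
      (Finset.single_le_sum (f := fun e => ∑ i, D e i)
        (fun e _ => Finset.sum_nonneg fun i _ => hD e i) (Finset.mem_univ e))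
  set L := M + ∑ e, ∑ i, l₀ e i with hL
  have hLle : ∀ e i, l₀ e i ≤ L := fun e i => by
    have := (Finset.single_le_sum (f := l₀ e) (fun i _ => (hl₀ e i).le) (Finset.mem_univ i)).trans
      (Finset.single_le_sum (f := fun e => ∑ i, l₀ e i)
        (fun e _ => Finset.sum_nonneg fun i _ => (hl₀ e i).le) (Finset.mem_univ e))
    linarith
  have hML : M ≤ L := by
    have : 0 ≤ ∑ e, ∑ i, l₀ e i :=
      Finset.sum_nonneg fun e _ => Finset.sum_nonneg fun i _ => (hl₀ e i).le
    linarith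
  set N₁ := ‖S.shiftedBCP 0 v₀ ⟨ξ, hξ⟩‖ with hN₁
  -- A bound for `‖(l - A) U‖²` independent of `l`: on the edges it comes from the residuals of the
  -- test functions, at the vertices from the operator applied to `ξ`.
  set K := ∑ e, G.k e * (G.ℓ e * (‖ξ‖ * D₀) ^ 2) + ∑ _ : V, N₁ ^ 2 with hK
  have hK0 : 0 ≤ K := by
    refine add_nonneg (Finset.sum_nonneg fun e _ => ?_) (Finset.sum_nonneg fun v _ => by positivity)
    have := (G.ℓ_pos e).le
    positivity
  have key : ∀ l ≥ L, ∃ U F, S.transportGraph m (S.shiftedBCP 0) U F ∧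
      ‖(l : ℂ) • U - F‖ ^ 2 ≤ K ∧ ∀ e i, ‖a e i‖ ^ 2 * c e i / l ≤ ‖U‖ ^ 2 := by
    intro l hl
    choose χ χ' hχ hχ'c hb ho hχD hχc using fun e i => H e i l ((hLle e i).trans hl)
    let w : ∀ e, Fin (G.k e) → ℝ → ℂ := fun e i x => a e i * χ e i x
    let g : ∀ e, Fin (G.k e) → ℝ → ℂ := fun e i x => a e i * ((χ' e i x : ℝ) : ℂ)
    have hgc : ∀ e i, ContinuousOn (g e i) (Set.Icc 0 (G.ℓ e)) := fun e i =>
      continuousOn_const.mul (Complex.continuous_ofReal.comp_continuousOn (hχ'c e i))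
    have hwp : ∀ e i, IsPrimitive (G.ℓ e) (w e i) (g e i) := fun e i =>
      IsPrimitive.of_hasDerivAt (G.ℓ_pos e).le
        (fun x hx => ((hχ e i x hx).ofReal_comp).const_mul (a e i)) (hgc e i)
    choose u hu using fun e => L2Interval.exists_coord fun i =>
      ((hwp e i).continuousOn (G.ℓ_pos e).le).memLp_two
    choose f hf using fun e => L2Interval.exists_coord fun i =>
      ((Complex.continuous_ofReal.comp_continuousOn (h.speed e i).continuousOn).mul
        (hgc e i)).memLp_two
    -- The profiles are `1` at the inflow and `0` at the outflow ends, so the trace at `v₀`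
    -- reproduces `ξ`, whose outflow entries vanish, and the other traces are zero. In particular `x
    -- = 0`, as the kernel condition on `ξ` requires.
    have htr : G.traceVec w v₀ = ξ := by
      ext p
      by_cases hp : G.IsOut s p
      · rw [traceVec_of_isOut w hp, hout p hp]
        simp [w, ho]
      · rw [traceVec_of_not_isOut w hp, ← ha p hp]
        simp [w, hb]
    have htr' : ∀ v, v ≠ v₀ → G.traceVec w v = 0 := by
      intro v hv
      ext p
      by_cases hp : G.IsOut s p
      · rw [traceVec_of_isOut w hp]
        simp [w, ho]
      · rw [traceVec_of_not_isOut w hp]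
        simp [w, hb, ha' v hv p hp]
    have hmem : ∀ v, G.traceVec w v ∈ S.Y v := by
      intro v
      by_cases hv : v = v₀
      · subst hv; rwa [htr]
      · rw [htr' v hv]; exact zero_mem _
    have hPd : ∀ v, S.Pd v (G.traceVec w v) = 0 := by
      intro v
      by_cases hv : v = v₀
      · subst hv; rwa [htr]
      · rw [htr' v hv, map_zero]
    have hN : ∀ v, ‖S.shiftedBCP 0 v ⟨G.traceVec w v, hmem v⟩‖ ≤ N₁ := by
      intro v
      by_cases hv : v = v₀
      · subst hv
        have : (⟨G.traceVec w v, hmem v⟩ : S.Y v) = ⟨ξ, hξ⟩ := Subtype.ext htr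
        rw [this]
      · have : (⟨G.traceVec w v, hmem v⟩ : S.Y v) = 0 := Subtype.ext (htr' v hv)
        rw [this, map_zero, norm_zero]
        exact norm_nonneg _
    refine ⟨S.mkSpace u 0, S.mkSpace f fun v => S.shiftedBCP 0 v ⟨G.traceVec w v, hmem v⟩,
      ⟨w, g, hwp, hu, hf, hmem, fun v => (hPd v).symm, fun v => rfl⟩, ?_, fun e i => ?_⟩
    · refine space_norm_sq_le (fun e => ?_) fun v => ?_
      · have e1 : ((l : ℂ) • S.mkSpace u 0 - S.mkSpace f fun v =>
            S.shiftedBCP 0 v ⟨G.traceVec w v, hmem v⟩).fst e = (l : ℂ) • u e - f e := rfl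
        rw [e1]
        filter_upwards [L2Interval.sub_coord ((l : ℂ) • u e) (f e),
          L2Interval.smul_coord (l : ℂ) (u e), hu e, hf e, ae_restrict_mem measurableSet_Ioo]
          with x h1 h2 h3 h4 h5 i
        rw [h1, h2, h3, h4]
        have e2 : (l : ℂ) * w e i x - (m e i x : ℂ) * g e i x
            = a e i * ((l * χ e i x - m e i x * χ' e i x : ℝ) : ℂ) := by
          simp only [w, g]; push_cast; ring
        refine (congrArg norm e2).trans_le ?_
        rw [norm_mul, Complex.norm_real, Real.norm_eq_abs]
        exact mul_le_mul (han e i) ((hχD e i x (Set.Ioo_subset_Icc_self h5)).trans (hDle e i))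
          (abs_nonneg _) (norm_nonneg _)
      · have e1 : ((l : ℂ) • S.mkSpace u 0 - S.mkSpace f fun v =>
            S.shiftedBCP 0 v ⟨G.traceVec w v, hmem v⟩).snd v
            = (l : ℂ) • (0 : S.Yd v) - S.shiftedBCP 0 v ⟨G.traceVec w v, hmem v⟩ := rfl
        rw [e1, smul_zero, zero_sub, norm_neg]
        exact hN v
    · refine le_trans ?_ (fst_norm_sq_le (S.mkSpace u 0) e)
      refine le_trans ?_ (L2Interval.integral_le_norm_sq (u e) i)
      have e1 : ∫ x in Set.Ioo 0 (G.ℓ e), ‖u e x i‖ ^ 2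
          = ‖a e i‖ ^ 2 * ∫ x in (0 : ℝ)..G.ℓ e, χ e i x ^ 2 := by
        rw [← intervalIntegral.integral_const_mul, ← integral_Ioo_eq (G.ℓ_pos e).le]
        refine integral_congr_ae ((hu e).mono fun x hx => ?_)
        simp only [hx, w, norm_mul, mul_pow, Complex.norm_real, Real.norm_eq_abs, sq_abs]
      have e2 : (S.mkSpace u 0).fst e = u e := rfl
      rw [e1, mul_div_assoc]
      have := hχc e i
      gcongr
  have ha0 : ∀ e i, a e i = 0 := by
    intro e i
    have h1 : ‖a e i‖ ^ 2 * c e i ≤ 0 := by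
      refine nonpos_of_forall_div_le (L := L) (K := M * Real.sqrt K) (by linarith) fun l hl => ?_
      obtain ⟨U, F, hUF, hn, hlow⟩ := key l hl
      have h2 := hest l (hML.trans hl) U F hUF
      have h3 : ‖(l : ℂ) • U - F‖ ≤ Real.sqrt K := Real.le_sqrt_of_sq_le hn
      have hl0 : 0 < l := by linarith
      refine (hlow e i).trans ?_
      have h4 : ‖U‖ ≤ M * Real.sqrt K / l := by
        rw [mul_div_right_comm]
        exact h2.trans (by gcongr)
      gcongr
    have h2 : ‖a e i‖ ^ 2 ≤ 0 := by
      by_contra hn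
      exact absurd h1 (not_le.2 (mul_pos (not_le.1 hn) (hc e i)))
    exact norm_eq_zero.1 (pow_eq_zero_iff two_ne_zero |>.1 (le_antisymm h2 (by positivity)))
  ext p
  by_cases hp : G.IsOut s p
  · exact hout p hp
  · rw [← ha p hp, ha0]; rfl

end Network.HypSystem
end

/-! ### Surjectivity of the outflow coordinates from the dual resolvent estimate -/

noncomputable section

set_option linter.unusedSectionVars false

namespace Network.HypSystem

variable {V E : Type*} [Fintype V] [DecidableEq V] [Fintype E] [DecidableEq E]
variable {G : Network V E} {S : G.HypSystem}
variable {m q : ∀ e, Fin (G.k e) → ℝ → ℝ} {s : ∀ e, Fin (G.k e) → ℝ} {T : C0Semigroup S.Space}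

theorem mkSpace_inner (u : ∀ e, L2Interval (G.ℓ e) (G.k e)) (U : S.Space) :
    inner ℂ (S.mkSpace u 0) U = ∑ e, inner ℂ (u e) (U.fst e) := by
  have h0 : ∑ v, inner ℂ ((S.mkSpace u 0).snd v : G.VSpace v) (U.snd v : G.VSpace v) = 0 :=
    Finset.sum_eq_zero fun v _ => inner_zero_left _
  rw [space_inner, h0, add_zero]
  rfl

theorem norm_snd_le (U : S.Space) (v : V) : ‖U.snd v‖ ≤ ‖U‖ :=
  abs_le_of_sq_le_sq' (snd_norm_sq_le U v) (norm_nonneg U) |>.2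

theorem norm_space_inner_le (U U' : S.Space) : ‖inner ℂ U U'‖ ≤ ‖U‖ * ‖U'‖ :=
  norm_inner_le_norm (𝕜 := ℂ) U U'

/-- Suppose `η` lives on outflow indices and acts on `Y_v` as some `y ∈ Y_v^{(d)}`. A functional `Ψ`
concentrated at the outflow ends turns `⟨Ψ, (l - A) U⟩` into `⟨η, γ(u)⟩` plus a bounded term. Since
`⟨η, γ(u)⟩ = ⟨y, x⟩` is bounded by `‖U‖` too, the dual estimate gives `‖Ψ‖ = O(1/l)`, although
`‖Ψ‖²` is at least of order `|η_p|² / l`. -/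
theorem IsDiagonal.outflowMap_surjective_of_isGeneratedBy (h : S.IsDiagonal m q s)
    (hT : T.IsGeneratedBy S.opGraph) (v₀ : V) : Function.Surjective (S.outflowMap s v₀) := by
  refine HypSystem.outflowMap_surjective fun η y hη hηy => ?_
  let a : ∀ e, Fin (G.k e) → ℂ := fun e i =>
    if hv : G.outV s e i = v₀ then η ⟨⟨e, hv ▸ G.incident_outV s e i⟩, i⟩ else 0
  have ha : ∀ p : G.VIdx v₀, G.IsOut s p → a p.1.1 p.2 = η p := fun p hp => dif_pos hp
  have ha' : ∀ v, v ≠ v₀ → ∀ p : G.VIdx v, G.IsOut s p → a p.1.1 p.2 = 0 :=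
    fun v hv p hp => dif_neg fun h' => hv (Eq.trans (Eq.symm hp) h')
  have han : ∀ e i, ‖a e i‖ ≤ ‖η‖ := by
    intro e i
    simp only [a]
    split_ifs
    · exact PiLp.norm_apply_le η _
    · simp
  -- Reversing the speed exchanges the two ends, so the profiles now equal `1` at the outflow and
  -- `0` at the inflow end, and almost solve `l χ + m χ' = 0`.
  choose D c l₀ hD hc hl₀ H using fun e i => (h.speed e i).neg.exists_testFunction
  choose c₁ c₂ hc₁ hc₂ hcm using fun e i => (h.speed e i).exists_bounds
  obtain ⟨M, hM, hest⟩ := h.transport_norm_le_of_dual hT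
  set D₀ := ∑ e, ∑ i, D e i / c₁ e i with hD₀
  have hD' : ∀ e i, 0 ≤ D e i / c₁ e i := fun e i => div_nonneg (hD e i) (hc₁ e i).le
  have hDle : ∀ e i, D e i / c₁ e i ≤ D₀ := fun e i =>
    (Finset.single_le_sum (f := fun i => D e i / c₁ e i) (fun i _ => hD' e i)
      (Finset.mem_univ i)).trans
      (Finset.single_le_sum (f := fun e => ∑ i, D e i / c₁ e i)
        (fun e _ => Finset.sum_nonneg fun i _ => hD' e i) (Finset.mem_univ e))
  set L := M + ∑ e, ∑ i, l₀ e i with hL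
  have hLle : ∀ e i, l₀ e i ≤ L := fun e i => by
    have := (Finset.single_le_sum (f := l₀ e) (fun i _ => (hl₀ e i).le) (Finset.mem_univ i)).trans
      (Finset.single_le_sum (f := fun e => ∑ i, l₀ e i)
        (fun e _ => Finset.sum_nonneg fun i _ => (hl₀ e i).le) (Finset.mem_univ e))
    linarith
  have hML : M ≤ L := by
    have : 0 ≤ ∑ e, ∑ i, l₀ e i :=
      Finset.sum_nonneg fun e _ => Finset.sum_nonneg fun i _ => (hl₀ e i).le
    linarith
  set K := ∑ e, G.k e * (G.ℓ e * (‖η‖ * D₀) ^ 2) + ∑ _ : V, (0 : ℝ) ^ 2 with hK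
  have key : ∀ l ≥ L, ∃ Ψ Φ : S.Space, ‖Φ‖ ^ 2 ≤ K ∧
      (∀ U F, S.transportGraph m (S.shiftedBCP 0) U F → inner ℂ Ψ ((l : ℂ) • U - F)
        = inner ℂ Φ U + inner ℂ (y : G.VSpace v₀) (U.snd v₀ : G.VSpace v₀)) ∧
      ∀ e i, ‖a e i‖ ^ 2 * (c e i / c₂ e i ^ 2) / l ≤ ‖Ψ‖ ^ 2 := by
    intro l hl
    choose χ χ' hχ hχ'c hb ho hχD hχc using fun e i => H e i l ((hLle e i).trans hl)
    have hχcont : ∀ e i, ContinuousOn (χ e i) (Set.Icc 0 (G.ℓ e)) :=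
      fun e i x hx => (hχ e i x hx).continuousAt.continuousWithinAt
    -- `ψ` and `φ` are the components of `Ψ` and of the bounded remainder `Φ`, as dictated by
    -- `IsSpeed.integral_eq`.
    let ψ : ∀ e, Fin (G.k e) → ℝ → ℂ := fun e i x =>
      a e i * ((s e i * χ e i x / m e i x : ℝ) : ℂ)
    let φ : ∀ e, Fin (G.k e) → ℝ → ℂ := fun e i x =>
      a e i * ((s e i / m e i x * (l * χ e i x + m e i x * χ' e i x) : ℝ) : ℂ)
    have hψc : ∀ e i, ContinuousOn (ψ e i) (Set.Icc 0 (G.ℓ e)) := fun e i =>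
      continuousOn_const.mul (Complex.continuous_ofReal.comp_continuousOn
        ((continuousOn_const.mul (hχcont e i)).div (h.speed e i).continuousOn
          fun x hx => (h.speed e i).ne_zero hx))
    have hφc : ∀ e i, ContinuousOn (φ e i) (Set.Icc 0 (G.ℓ e)) := fun e i =>
      continuousOn_const.mul (Complex.continuous_ofReal.comp_continuousOn
        ((continuousOn_const.div (h.speed e i).continuousOn
          fun x hx => (h.speed e i).ne_zero hx).mul ((continuousOn_const.mul (hχcont e i)).add
            ((h.speed e i).continuousOn.mul (hχ'c e i)))))
    choose u hu using fun e => L2Interval.exists_coord fun i => (hψc e i).memLp_two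
    choose f hf using fun e => L2Interval.exists_coord fun i => (hφc e i).memLp_two
    refine ⟨S.mkSpace u 0, S.mkSpace f 0, ?_, ?_, fun e i => ?_⟩
    · refine space_norm_sq_le (fun e => ?_) fun v => ?_
      · have e1 : (S.mkSpace f 0).fst e = f e := rfl
        rw [e1]
        filter_upwards [hf e, ae_restrict_mem measurableSet_Ioo] with x h1 h2 i
        have hx := Set.Ioo_subset_Icc_self h2
        rw [h1]
        simp only [φ]
        rw [norm_mul, Complex.norm_real, Real.norm_eq_abs, abs_mul, abs_div, (h.speed e i).abs_eq hx]
        have h3 : |s e i| = 1 := by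
          have := (h.speed e i).s_sq
          rw [← abs_mul_abs_self] at this
          nlinarith [abs_nonneg (s e i)]
        have h4 := hχD e i x hx
        rw [neg_mul, sub_neg_eq_add] at h4
        have h5 := (hcm e i x hx).1
        have h6 := hc₁ e i
        have h7 : 1 / (s e i * m e i x) * |l * χ e i x + m e i x * χ' e i x| ≤ D e i / c₁ e i := by
          rw [one_div, inv_mul_eq_div]
          exact div_le_div₀ (hD e i) h4 h6 h5
        rw [h3]
        have h8 := (h.speed e i).sign x hx
        exact mul_le_mul (han e i) (h7.trans (hDle e i)) (by positivity) (norm_nonneg _)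
      · have e1 : (S.mkSpace f 0).snd v = 0 := rfl
        rw [e1, norm_zero]
    · rintro U F ⟨w, g, hw⟩
      have hterm : ∀ e i, ∫ x in Set.Ioo 0 (G.ℓ e),
          (starRingEnd ℂ) (u e x i) * ((l : ℂ) • U - F).fst e x i
          = (starRingEnd ℂ) (a e i) * w e i (G.outflow s e i)
            + ∫ x in Set.Ioo 0 (G.ℓ e), (starRingEnd ℂ) (f e x i) * U.fst e x i := by
        intro e i
        have h1 := (h.speed e i).integral_eq l (hχ e i) (hχ'c e i) (hb e i) (ho e i) (hw.prim e i)
        have h2 : ∫ x in Set.Ioo 0 (G.ℓ e), (starRingEnd ℂ) (u e x i) * ((l : ℂ) • U - F).fst e x i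
            = (starRingEnd ℂ) (a e i) * ∫ x in Set.Ioo 0 (G.ℓ e),
              ((s e i * χ e i x / m e i x : ℝ) : ℂ) * (l * w e i x - m e i x * g e i x) := by
          rw [← integral_const_mul]
          refine integral_congr_ae ?_
          have e1 : ((l : ℂ) • U - F).fst e = (l : ℂ) • U.fst e - F.fst e := rfl
          rw [e1]
          filter_upwards [L2Interval.sub_coord ((l : ℂ) • U.fst e) (F.fst e),
            L2Interval.smul_coord (l : ℂ) (U.fst e), hu e, hw.fst e, hw.fst' e]
            with x h1 h2 h3 h4 h5
          rw [h1, h2, h3, h4, h5]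
          simp only [ψ]
          rw [map_mul, Complex.conj_ofReal, mul_assoc]
        have h3 : ∫ x in Set.Ioo 0 (G.ℓ e), (starRingEnd ℂ) (f e x i) * U.fst e x i
            = (starRingEnd ℂ) (a e i) * ∫ x in Set.Ioo 0 (G.ℓ e),
              ((s e i / m e i x * (l * χ e i x + m e i x * χ' e i x) : ℝ) : ℂ) * w e i x := by
          rw [← integral_const_mul]
          refine integral_congr_ae ?_
          filter_upwards [hf e, hw.fst e] with x h1 h2
          rw [h1, h2]
          simp only [φ]
          rw [map_mul, Complex.conj_ofReal, mul_assoc]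
        rw [h2, h1, h3, mul_add]
      -- The boundary terms of all edges, regrouped by outflow vertex, survive at `v₀` only and give
      -- the pairing with `η`.
      have hbd : ∑ e, ∑ i, (starRingEnd ℂ) (a e i) * w e i (G.outflow s e i)
          = inner ℂ η (G.traceVec w v₀) := by
        rw [← sum_isOut (s := s), Finset.sum_eq_single v₀, PiLp.inner_apply]
        · refine Finset.sum_congr rfl fun p _ => ?_
          by_cases hp : G.IsOut s p
          · rw [if_pos hp, traceVec_of_isOut w hp, ha p hp, RCLike.inner_apply, mul_comm]
          · rw [if_neg hp, hη p hp, inner_zero_left]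
        · intro v _ hv
          refine Finset.sum_eq_zero fun p _ => ?_
          split_ifs with hp
          · rw [ha' v hv p hp, map_zero, zero_mul]
          · rfl
        · exact fun hv => absurd (Finset.mem_univ v₀) hv
      rw [mkSpace_inner, mkSpace_inner]
      simp_rw [L2Interval.inner_eq, hterm, Finset.sum_add_distrib]
      -- Unlike a trace, `x` is controlled by the norm of `U`; this is why `η` has to be traded for
      -- `y` on `Y_v`.
      rw [hbd, hηy _ (hw.mem v₀), hw.snd v₀, add_comm]
      congr 1
      have h1 := congrArg (starRingEnd ℂ) (inner_Pd (G.traceVec w v₀) y)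
      rw [Submodule.coe_inner, inner_conj_symm, inner_conj_symm] at h1
      exact h1.symm
    · refine le_trans ?_ (fst_norm_sq_le (S.mkSpace u 0) e)
      refine le_trans ?_ (L2Interval.integral_le_norm_sq (u e) i)
      have e1 : ∫ x in Set.Ioo 0 (G.ℓ e), ‖u e x i‖ ^ 2
          = ‖a e i‖ ^ 2 * ∫ x in (0 : ℝ)..G.ℓ e, (χ e i x / m e i x) ^ 2 := by
        rw [← intervalIntegral.integral_const_mul, ← integral_Ioo_eq (G.ℓ_pos e).le]
        refine integral_congr_ae ((hu e).mono fun x hx => ?_)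
        simp only [hx, ψ, norm_mul, mul_pow, Complex.norm_real, Real.norm_eq_abs, sq_abs]
        rw [mul_div_assoc, mul_pow, sq (s e i), (h.speed e i).s_sq, one_mul]
      rw [e1, mul_div_assoc, div_right_comm]
      have h2 : (c e i / l) / c₂ e i ^ 2 ≤ ∫ x in (0 : ℝ)..G.ℓ e, (χ e i x / m e i x) ^ 2 := by
        refine (div_le_div_of_nonneg_right (hχc e i) (by positivity)).trans ?_
        rw [div_eq_inv_mul, ← intervalIntegral.integral_const_mul]
        refine intervalIntegral.integral_mono_on (G.ℓ_pos e).le ?_ ?_ fun x hx => ?_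
        · refine ContinuousOn.intervalIntegrable ?_
          rw [Set.uIcc_of_le (G.ℓ_pos e).le]
          exact continuousOn_const.mul ((hχcont e i).pow 2)
        · refine ContinuousOn.intervalIntegrable ?_
          rw [Set.uIcc_of_le (G.ℓ_pos e).le]
          exact ((hχcont e i).div (h.speed e i).continuousOn
            fun x hx => (h.speed e i).ne_zero hx).pow 2
        · rw [inv_mul_eq_div, div_pow]
          have h3 := (hcm e i x hx).2
          have h4 := (h.speed e i).sign x hx
          rw [← (h.speed e i).abs_eq hx] at h3 h4
          rw [← sq_abs (m e i x)]
          gcongr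
      gcongr
  have ha0 : ∀ e i, a e i = 0 := by
    intro e i
    have h1 : ‖a e i‖ ^ 2 * (c e i / c₂ e i ^ 2) ≤ 0 := by
      refine nonpos_of_forall_div_le (L := L) (K := M * (Real.sqrt K + ‖(y : G.VSpace v₀)‖))
        (by linarith) fun l hl => ?_
      obtain ⟨Ψ, Φ, hn, hin, hlow⟩ := key l hl
      have h3 : ‖Φ‖ ≤ Real.sqrt K := Real.le_sqrt_of_sq_le hn
      have h2 := hest l (hML.trans hl) Ψ (Real.sqrt K + ‖(y : G.VSpace v₀)‖) (by positivity)
        fun U F hUF => by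
          rw [hin U F hUF, add_mul]
          refine (norm_add_le _ _).trans (add_le_add ?_ ?_)
          · exact (norm_space_inner_le _ _).trans (by gcongr)
          · exact (norm_inner_le_norm _ _).trans (by gcongr; exact norm_snd_le U v₀)
      have hl0 : 0 < l := by linarith
      refine (hlow e i).trans ?_
      rw [mul_div_right_comm]
      gcongr
    have h2 : ‖a e i‖ ^ 2 ≤ 0 := by
      by_contra hn
      have h3 := hc e i
      have h4 := hc₂ e i
      exact absurd h1 (not_le.2 (mul_pos (not_le.1 hn) (by positivity)))
    exact norm_eq_zero.1 (pow_eq_zero_iff two_ne_zero |>.1 (le_antisymm h2 (by positivity)))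
  ext p
  by_cases hp : G.IsOut s p
  · rw [← ha p hp, ha0]; rfl
  · exact hη p hp

theorem IsDiagonal.hasOutflowCoordinates_of_isGeneratedBy (h : S.IsDiagonal m q s)
    (hT : T.IsGeneratedBy S.opGraph) : S.HasOutflowCoordinates s :=
  fun v => ⟨h.outflowMap_injective_of_isGeneratedBy hT v,
    h.outflowMap_surjective_of_isGeneratedBy hT v⟩

end Network.HypSystem
end

noncomputable section

set_option linter.unusedSectionVars false

/-! ### The positive cone and the outflow coordinates -/

namespace L2Interval

variable {ℓ : ℝ} {n : ℕ}

/-- A convergent sequence in `L²` has a subsequence that converges almost everywhere. -/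
theorem isClosed_nonneg : IsClosed {u : L2Interval ℓ n |
    ∀ᵐ x ∂(volume.restrict (Set.Ioo 0 ℓ)), ∀ i, (u x i).IsNonnegReal} := by
  refine IsSeqClosed.isClosed fun u u₀ hu hlim => ?_
  obtain ⟨ns, -, hns⟩ := (tendstoInMeasure_of_tendsto_Lp hlim).exists_seq_tendsto_ae
  have hu' : ∀ᵐ x ∂(volume.restrict (Set.Ioo 0 ℓ)), ∀ n i, (u n x i).IsNonnegReal :=
    ae_all_iff.2 hu
  filter_upwards [hns, hu'] with x hx hx' i
  exact Complex.IsNonnegReal.isClosed.mem_of_tendsto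
    (((EuclideanSpace.proj (𝕜 := ℂ) i).continuous.tendsto _).comp hx)
    (Eventually.of_forall fun k => hx' _ i)

end L2Interval

namespace Network

variable {V E : Type*} [Fintype V] [DecidableEq V] [Fintype E] [DecidableEq E]
variable {G : Network V E}

theorem posPart_eq_self {v : V} {ξ : G.VSpace v} (h : ∀ p, (ξ p).IsNonnegReal) :
    G.posPart ξ = ξ := by
  ext p
  show ((max (ξ p).re 0 : ℝ) : ℂ) = ξ p
  rw [max_eq_left (h p).2]
  exact Complex.ext (by simp) (by simpa using (h p).1.symm)

theorem posPart_isNonnegReal {v : V} (ξ : G.VSpace v) (p : G.VIdx v) :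
    (G.posPart ξ p).IsNonnegReal :=
  Complex.IsNonnegReal.ofReal (le_max_right _ _)

namespace HypSystem

variable {S : G.HypSystem}

theorem isClosedCone_isNonneg : IsClosedCone {U : S.Space | S.IsNonneg U} := by
  refine ⟨?_, ⟨fun e => ?_, fun v i => ?_⟩, fun U hU U' hU' => ⟨fun e => ?_, fun v i => ?_⟩,
    fun c hc U hU => ⟨fun e => ?_, fun v i => ?_⟩⟩
  · have e1 : {U : S.Space | S.IsNonneg U}
        = (⋂ e, (fun U : S.Space => U.fst e) ⁻¹' {u | ∀ᵐ x ∂(volume.restrict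
            (Set.Ioo 0 (G.ℓ e))), ∀ i, (u x i).IsNonnegReal})
          ∩ ⋂ v, ⋂ i, (fun U : S.Space => (U.snd v : G.VSpace v) i) ⁻¹' {z | z.IsNonnegReal} := by
      ext U
      simp only [Set.mem_inter_iff, Set.mem_iInter, Set.mem_preimage, Set.mem_ofPred_eq]
      rfl
    rw [e1]
    have hc1 : ∀ e, Continuous fun U : S.Space => U.fst e := fun e =>
      (PiLp.continuous_apply 2 _ e).comp
        (WithLp.prod_continuous_ofLp 2 _ _).fst
    have hc2 : ∀ v i, Continuous fun U : S.Space => (U.snd v : G.VSpace v) i := fun v i =>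
      (PiLp.continuous_apply 2 _ i).comp (continuous_subtype_val.comp
        ((PiLp.continuous_apply 2 _ v).comp (WithLp.prod_continuous_ofLp 2 _ _).snd))
    exact (isClosed_iInter fun e => L2Interval.isClosed_nonneg.preimage (hc1 e)).inter
      (isClosed_iInter fun v => isClosed_iInter fun i =>
        Complex.IsNonnegReal.isClosed.preimage (hc2 v i))
  · filter_upwards [L2Interval.zero_coord (ℓ := G.ℓ e) (n := G.k e)] with x hx i
    have h0 : (0 : S.Space).fst e = 0 := rfl
    rw [h0, hx]; exact Complex.IsNonnegReal.zero
  · exact Complex.IsNonnegReal.zero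
  · have h0 : (U + U').fst e = U.fst e + U'.fst e := rfl
    rw [h0]
    filter_upwards [L2Interval.add_coord (U.fst e) (U'.fst e), hU.1 e, hU'.1 e] with x h1 h2 h3 i
    rw [h1]; exact Complex.IsNonnegReal.add (h2 i) (h3 i)
  · exact Complex.IsNonnegReal.add (hU.2 v i) (hU'.2 v i)
  · have h0 : ((c : ℂ) • U).fst e = (c : ℂ) • U.fst e := rfl
    rw [h0]
    filter_upwards [L2Interval.smul_coord (c : ℂ) (U.fst e), hU.1 e] with x h1 h2 i
    rw [h1]; exact Complex.IsNonnegReal.mul (.ofReal hc) (h2 i)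
  · exact Complex.IsNonnegReal.mul (.ofReal hc) (hU.2 v i)

theorem apply_eq_sum_matrixOf {v : V} {W : Submodule ℂ (G.VSpace v)} (L : W →ₗ[ℂ] S.Yd v) (ξ : W)
    (i : G.VIdx v) :
    (L ξ : G.VSpace v) i = ∑ j, S.matrixOf L i j * (ξ : G.VSpace v) j := by
  have h1 : ξ = ∑ j, (ξ : G.VSpace v) j •
      W.orthogonalProjectionOnto (EuclideanSpace.single j (1 : ℂ)) := by
    conv_lhs => rw [← W.orthogonalProjectionOnto_mem_subspace_eq_self ξ,
      ← (EuclideanSpace.basisFun (G.VIdx v) ℂ).sum_repr (ξ : G.VSpace v)]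
    simp [map_sum]
  conv_lhs => rw [h1]
  rw [map_sum, Submodule.coe_sum, WithLp.ofLp_sum, Finset.sum_apply]
  refine Finset.sum_congr rfl fun j _ => ?_
  rw [map_smul, Submodule.coe_smul, PiLp.smul_apply, smul_eq_mul, mul_comm]
  rfl

theorem isNonnegReal_Pd
    (hP : ∀ v (ξ : G.VSpace v),
      G.posPart (S.Pd v ξ : G.VSpace v) = (S.Pd v (G.posPart ξ) : G.VSpace v))
    {v : V} {ξ : G.VSpace v} (h : ∀ p, (ξ p).IsNonnegReal) (p : G.VIdx v) :
    ((S.Pd v ξ : G.VSpace v) p).IsNonnegReal := by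
  rw [← posPart_eq_self h, ← hP]
  exact posPart_isNonnegReal _ p

/-- `P_v^{(d)} ξ ≥ 0` for `ξ ≥ 0`, because the projector commutes with the positive part. If `B_v +
C_v P_v^{(d)}` is positive, any `c ≥ 0` will do; if `B_v = 0`, a large `c` makes the diagonal of
`C_v + c` nonnegative. -/
theorem exists_isNonnegReal_shiftedBCP
    (hC_real : ∀ v, (S.matrixOf (S.C v)).HasRealEntries)
    (hP : ∀ v (ξ : G.VSpace v),
      G.posPart (S.Pd v ξ : G.VSpace v) = (S.Pd v (G.posPart ξ) : G.VSpace v))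
    (hBC : (∀ v, (S.matrixOf (S.BCP v)).HasNonnegEntries) ∨
      ((∀ v, S.B v = 0) ∧ ∀ v, (S.matrixOf (S.C v)).HasNonnegOffDiag)) :
    ∃ c₀ : ℝ, ∀ c ≥ c₀, ∀ v (ξ : S.Y v), (∀ p, ((ξ : G.VSpace v) p).IsNonnegReal) →
      ∀ p, ((S.shiftedBCP c v ξ : G.VSpace v) p).IsNonnegReal := by
  rcases hBC with hBC | ⟨hB, hC⟩
  · refine ⟨0, fun c hc v ξ hξ p => ?_⟩
    have e1 : (S.shiftedBCP c v ξ : G.VSpace v) p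
        = (S.BCP v ξ : G.VSpace v) p + c * (S.Pd v ξ : G.VSpace v) p := rfl
    rw [e1, apply_eq_sum_matrixOf]
    exact (Complex.IsNonnegReal.sum _ _ fun j _ => (show Complex.IsNonnegReal _ from
      hBC v p j).mul (hξ j)).add ((Complex.IsNonnegReal.ofReal hc).mul (isNonnegReal_Pd hP hξ p))
  · refine ⟨∑ v, ∑ p, ‖S.matrixOf (S.C v) p p‖, fun c hc v ξ hξ p => ?_⟩
    have hx := isNonnegReal_Pd hP hξ
    have e1 : (S.shiftedBCP c v ξ : G.VSpace v) p
        = (S.C v (S.Pd v ξ) : G.VSpace v) p + c * (S.Pd v ξ : G.VSpace v) p := by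
      rw [shiftedBCP_apply, hB v, LinearMap.zero_apply, zero_add]; rfl
    rw [e1, apply_eq_sum_matrixOf, ← Finset.sum_erase_add _ _ (Finset.mem_univ p), add_assoc,
      ← add_mul]
    refine (Complex.IsNonnegReal.sum _ _ fun j hj => ?_).add (Complex.IsNonnegReal.mul ?_ (hx p))
    · exact (show Complex.IsNonnegReal _ from
        hC v p j (Finset.ne_of_mem_erase hj).symm).mul (hx j)
    · refine ⟨by rw [Complex.add_im, hC_real v p p, Complex.ofReal_im, add_zero], ?_⟩
      have h1 : ‖S.matrixOf (S.C v) p p‖ ≤ c :=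
        ((Finset.single_le_sum (f := fun p => ‖S.matrixOf (S.C v) p p‖)
          (fun p _ => norm_nonneg _) (Finset.mem_univ p)).trans
          (Finset.single_le_sum (f := fun v => ∑ p, ‖S.matrixOf (S.C v) p p‖)
          (fun v _ => Finset.sum_nonneg fun p _ => norm_nonneg _) (Finset.mem_univ v))).trans hc
      rw [Complex.add_re, Complex.ofReal_re]
      have := (abs_le.1 (Complex.abs_re_le_norm (S.matrixOf (S.C v) p p))).1
      linarith

/-- Only the diagonal of `N` can be negative, and its essential bound is finite, so a single `c`
repairs the sign on all edges. -/
theorem exists_isNonnegReal_add_N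
    (hN_real : ∀ e, ∀ᵐ x ∂(volume.restrict (Set.Icc 0 (G.ℓ e))), (S.N e x).HasRealEntries)
    (hN : ∀ e, ∀ᵐ x ∂(volume.restrict (Set.Icc 0 (G.ℓ e))), (S.N e x).HasNonnegOffDiag) :
    ∃ c₀ : ℝ, ∀ c ≥ c₀, ∀ e, ∀ᵐ x ∂(volume.restrict (Set.Ioo 0 (G.ℓ e))),
      ∀ ξ : EuclideanSpace ℂ (Fin (G.k e)), (∀ i, (ξ i).IsNonnegReal) →
        ∀ i, (∑ j, S.N e x i j * ξ j + c * ξ i).IsNonnegReal := by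
  let β : E → ℝ := fun e => ∑ i, (eLpNorm (fun x => S.N e x i i) ⊤
    (volume.restrict (Set.Ioo 0 (G.ℓ e)))).toReal
  refine ⟨∑ e, β e, fun c hc e => ?_⟩
  have hsub : ∀ {p : ℝ → Prop}, (∀ᵐ x ∂(volume.restrict (Set.Icc 0 (G.ℓ e))), p x) →
      ∀ᵐ x ∂(volume.restrict (Set.Ioo 0 (G.ℓ e))), p x :=
    fun h => ae_restrict_of_ae_restrict_of_subset Set.Ioo_subset_Icc_self h
  have hb : ∀ᵐ x ∂(volume.restrict (Set.Ioo 0 (G.ℓ e))), ∀ i, ‖S.N e x i i‖ ≤ c := by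
    refine ae_all_iff.2 fun i => ?_
    filter_upwards [ae_le_eLpNormEssSup (f := fun x => S.N e x i i)
      (μ := volume.restrict (Set.Ioo 0 (G.ℓ e)))] with x hx
    have h1 : ‖S.N e x i i‖ ≤ (eLpNorm (fun x => S.N e x i i) ⊤
        (volume.restrict (Set.Ioo 0 (G.ℓ e)))).toReal := by
      rw [eLpNorm_exponent_top, ← toReal_enorm]
      refine ENNReal.toReal_mono ?_ hx
      rw [← eLpNorm_exponent_top]
      exact (S.N_bounded_Ioo e i i).2.ne
    exact h1.trans (((Finset.single_le_sum (f := fun i => (eLpNorm (fun x => S.N e x i i) ⊤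
        (volume.restrict (Set.Ioo 0 (G.ℓ e)))).toReal)
          (fun p _ => ENNReal.toReal_nonneg) (Finset.mem_univ i)).trans
          (Finset.single_le_sum (f := β)
          (fun v _ => Finset.sum_nonneg fun p _ => ENNReal.toReal_nonneg)
          (Finset.mem_univ e))).trans hc)
  filter_upwards [hb, hsub (hN_real e), hsub (hN e)] with x h1 h2 h3 ξ hξ i
  rw [← Finset.sum_erase_add _ _ (Finset.mem_univ i), add_assoc, ← add_mul]
  refine (Complex.IsNonnegReal.sum _ _ fun j hj => ?_).add (Complex.IsNonnegReal.mul ?_ (hξ i))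
  · exact (show Complex.IsNonnegReal _ from h3 i j (Finset.ne_of_mem_erase hj).symm).mul (hξ j)
  · refine ⟨by rw [Complex.add_im, h2 i i, Complex.ofReal_im, add_zero], ?_⟩
    rw [Complex.add_re, Complex.ofReal_re]
    have := (abs_le.1 (Complex.abs_re_le_norm (S.N e x i i))).1
    have := h1 i
    linarith

/-! ### Positivity and bounds for the inverse outflow coordinates -/

variable {m q : ∀ e, Fin (G.k e) → ℝ → ℝ} {s : ∀ e, Fin (G.k e) → ℝ}

/-- The inverse of the outflow coordinates. -/
def HasOutflowCoordinates.lift (h : S.HasOutflowCoordinates s) (v : V) :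
    (S.Yd v × ({p : G.VIdx v // G.IsOut s p} → ℂ)) →ₗ[ℂ] S.Y v :=
  (LinearEquiv.ofBijective _ (h v)).symm.toLinearMap

theorem HasOutflowCoordinates.outflowMap_lift (h : S.HasOutflowCoordinates s) (v : V)
    (z : S.Yd v × ({p : G.VIdx v // G.IsOut s p} → ℂ)) : S.outflowMap s v (h.lift v z) = z :=
  (LinearEquiv.ofBijective _ (h v)).apply_symm_apply z

theorem HasOutflowCoordinates.lift_outflowMap (h : S.HasOutflowCoordinates s) (v : V)
    (ξ : S.Y v) : h.lift v (S.outflowMap s v ξ) = ξ :=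
  (LinearEquiv.ofBijective _ (h v)).symm_apply_apply ξ

/-- If `γ ∈ Y_v` has nonnegative coordinates, then `γ⁺` lies in `Y_v` and has the same coordinates,
because the positive part commutes with `P_v^{(d)}` and acts entrywise. Injectivity gives `γ = γ⁺`.
-/
theorem HasOutflowCoordinates.isNonnegReal_lift (h : S.HasOutflowCoordinates s)
    (hP : ∀ v (ξ : G.VSpace v),
      G.posPart (S.Pd v ξ : G.VSpace v) = (S.Pd v (G.posPart ξ) : G.VSpace v))
    (hY : ∀ v, ∀ ξ ∈ S.Y v, G.posPart ξ ∈ S.Y v) {v : V}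
    {z : S.Yd v × ({p : G.VIdx v // G.IsOut s p} → ℂ)}
    (hz : ∀ p, ((z.1 : G.VSpace v) p).IsNonnegReal) (hz' : ∀ p, (z.2 p).IsNonnegReal)
    (p : G.VIdx v) : ((h.lift v z : G.VSpace v) p).IsNonnegReal := by
  set γ := h.lift v z with hγ
  have h1 : S.outflowMap s v γ = z := h.outflowMap_lift v z
  let γ' : S.Y v := ⟨G.posPart (γ : G.VSpace v), hY v _ γ.2⟩
  have h2 : S.outflowMap s v γ' = z := by
    refine Prod.ext (Subtype.ext ?_) (funext fun r => ?_)
    · show (S.Pd v (G.posPart (γ : G.VSpace v)) : G.VSpace v) = z.1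
      have h3 : S.Pd v (γ : G.VSpace v) = z.1 := congrArg Prod.fst h1
      rw [← hP, h3, posPart_eq_self hz]
    · have h3 : (γ : G.VSpace v) r.1 = z.2 r := congrFun (congrArg Prod.snd h1) r
      show (((max ((γ : G.VSpace v) r.1).re 0 : ℝ)) : ℂ) = z.2 r
      rw [h3, max_eq_left (hz' r).2]
      exact Complex.ext (by simp) (by simpa using (hz' r).1.symm)
  have h3 : γ = γ' := (h v).1 (h1.trans h2.symm)
  rw [h3]
  exact posPart_isNonnegReal _ p

/-- Finite dimension bounds each inverse, and there are finitely many vertices. The linear bound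
drives the contraction for the vertex values; the quadratic one controls inflow traces by outflow
traces and `x` in the energy estimate. -/
theorem HasOutflowCoordinates.exists_norm_le (h : S.HasOutflowCoordinates s) :
    ∃ C : ℝ, 0 < C ∧ ∀ v, (∀ z, ‖h.lift v z‖ ≤ C * ‖z‖) ∧ ∀ ξ : S.Y v,
      ‖ξ‖ ^ 2 ≤ C * (‖S.Pd v ξ‖ ^ 2 + ∑ p, if G.IsOut s p then ‖(ξ : G.VSpace v) p‖ ^ 2 else 0) := by
  choose C hC using fun v => (LinearMap.toContinuousLinearMap (h.lift v)).bound
  have hC0 : ∀ v, 0 ≤ C v + C v ^ 2 := fun v => by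
    have := (hC v).1.le
    positivity
  have hCle : ∀ v, C v + C v ^ 2 ≤ 1 + ∑ v, (C v + C v ^ 2) := fun v => by
    have := Finset.single_le_sum (f := fun v => C v + C v ^ 2) (fun v _ => hC0 v)
      (Finset.mem_univ v)
    linarith
  have hpos : 0 ≤ ∑ v, (C v + C v ^ 2) := Finset.sum_nonneg fun v _ => hC0 v
  refine ⟨1 + ∑ v, (C v + C v ^ 2), by linarith, fun v => ⟨fun z => ?_, fun ξ => ?_⟩⟩
  · refine ((hC v).2 z).trans (mul_le_mul_of_nonneg_right ?_ (norm_nonneg z))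
    have := hCle v
    have := sq_nonneg (C v)
    linarith
  · set R := ‖S.Pd v ξ‖ ^ 2 + ∑ p, if G.IsOut s p then ‖(ξ : G.VSpace v) p‖ ^ 2 else 0 with hR
    have hterm : ∀ p : G.VIdx v, 0 ≤ if G.IsOut s p then ‖(ξ : G.VSpace v) p‖ ^ 2 else 0 :=
      fun p => by split_ifs <;> positivity
    have hsum := Finset.sum_nonneg fun p (_ : p ∈ Finset.univ) => hterm p
    have hR0 : 0 ≤ R := by positivity
    have hz : ‖S.outflowMap s v ξ‖ ≤ Real.sqrt R := by
      refine max_le (Real.le_sqrt_of_sq_le ?_)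
        ((pi_norm_le_iff_of_nonneg (Real.sqrt_nonneg R)).2 fun p => Real.le_sqrt_of_sq_le ?_)
      · exact le_add_of_nonneg_right hsum
      · have := Finset.single_le_sum (fun p _ => hterm p) (Finset.mem_univ p.1)
        rw [if_pos p.2] at this
        exact this.trans (le_add_of_nonneg_left (by positivity))
    have h1 : ‖ξ‖ ≤ C v * Real.sqrt R := by
      have := (hC v).2 (S.outflowMap s v ξ)
      have e1 : LinearMap.toContinuousLinearMap (h.lift v) (S.outflowMap s v ξ) = ξ :=
        h.lift_outflowMap v ξ
      rw [e1] at this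
      exact this.trans (mul_le_mul_of_nonneg_left hz (hC v).1.le)
    calc ‖ξ‖ ^ 2 ≤ (C v * Real.sqrt R) ^ 2 := by gcongr
      _ = C v ^ 2 * R := by rw [mul_pow, Real.sq_sqrt hR0]
      _ ≤ _ := by
        refine mul_le_mul_of_nonneg_right ?_ hR0
        have := hCle v
        have := (hC v).1.le
        linarith

end HypSystem

end Network
end

noncomputable section

set_option linter.unusedSectionVars false

/-! ### Quasi-dissipativity in a weighted norm -/

/-- The affine function with value `ε` at `b` and `1` at `o`. -/
def affineWeight (ε b o x : ℝ) : ℝ := 1 + (ε - 1) * ((x - o) / (b - o))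

namespace IsSpeed

variable {ℓ : ℝ} {m : ℝ → ℝ} {s b o : ℝ} (h : IsSpeed ℓ m s b o)

include h

theorem affineWeight_mem {ε : ℝ} (hε : ε ≤ 1) {x : ℝ} (hx : x ∈ Set.Icc 0 ℓ) :
    affineWeight ε b o x ∈ Set.Icc ε 1 := by
  have h1 : (x - o) / (b - o) ∈ Set.Icc (0 : ℝ) 1 := by
    have hℓ := h.pos
    rcases h.cases with ⟨-, h4, h5⟩ | ⟨-, h4, h5⟩ <;> rw [h4, h5]
    · rw [sub_zero, sub_zero]
      exact ⟨div_nonneg hx.1 hℓ.le, (div_le_one hℓ).2 hx.2⟩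
    · rw [zero_sub, div_neg, ← neg_div, neg_sub]
      exact ⟨div_nonneg (sub_nonneg.2 hx.2) hℓ.le, (div_le_one hℓ).2 (by linarith [hx.1])⟩
  unfold affineWeight
  constructor <;> nlinarith [h1.1, h1.2]

/-- Integration of the derivative of `ρ |w|²`: the sign `s` orients the boundary terms so that the
inflow end counts with `ρ = ε` and the outflow end with `-1`. The slope of `ρ` leaves `(1 - ε) / ℓ`
times the squared norm. -/
theorem energy_le {ε : ℝ} (hε0 : 0 ≤ ε) (hε : ε ≤ 1) {w g : ℝ → ℂ} (hw : IsPrimitive ℓ w g) :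
    2 * (∫ x in Set.Ioo 0 ℓ, ((s * affineWeight ε b o x : ℝ) : ℂ)
        * ((starRingEnd ℂ) (w x) * g x)).re
      ≤ ε * ‖w b‖ ^ 2 - ‖w o‖ ^ 2 + ℓ⁻¹ * ∫ x in Set.Ioo 0 ℓ, ‖w x‖ ^ 2 := by
  have hℓ := h.pos
  have hbo : b - o ≠ 0 := by
    rcases h.cases with ⟨-, h4, h5⟩ | ⟨-, h4, h5⟩ <;> rw [h4, h5]
    · rw [sub_zero]; exact hℓ.ne'
    · rw [zero_sub]; exact neg_ne_zero.2 hℓ.ne'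
  set ρ := affineWeight ε b o with hρ
  set ρ' := (ε - 1) * (1 / (b - o)) with hρ'
  have hρd : ∀ x ∈ Set.Icc 0 ℓ, HasDerivAt (fun x => (ρ x : ℂ)) ((ρ' : ℝ) : ℂ) x := fun x _ =>
    (((((hasDerivAt_id x).sub_const o).div_const (b - o)).const_mul (ε - 1)).const_add 1).ofReal_comp
  have hρc : ContinuousOn (fun x => (ρ x : ℂ)) (Set.uIcc 0 ℓ) := fun x hx =>
    (hρd x (by rwa [Set.uIcc_of_le hℓ.le] at hx)).continuousAt.continuousWithinAt
  have hwc := hw.continuousOn hℓ.le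
  rw [← Set.uIcc_of_le hℓ.le] at hwc
  have hp := (IsPrimitive.of_hasDerivAt hℓ.le hρd continuousOn_const).mul
    (hw.star.mul hw hℓ.le) hℓ.le
  have h1 := hp.integral_eq hℓ.le
  set J := ∫ x in (0 : ℝ)..ℓ, (ρ x : ℂ) * ((starRingEnd ℂ) (w x) * g x) with hJ
  have hi1 : IntervalIntegrable (fun x => (ρ x : ℂ) * ((starRingEnd ℂ) (w x) * g x)) volume 0 ℓ :=
    (hw.integrable.continuousOn_mul (Complex.continuous_conj.comp_continuousOn hwc)).continuousOn_mul
      hρc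
  have hi2 : IntervalIntegrable (fun x => (ρ x : ℂ) * ((starRingEnd ℂ) (g x) * w x)) volume 0 ℓ :=
    (hw.star.integrable.mul_continuousOn hwc).continuousOn_mul hρc
  have hi3 : IntervalIntegrable (fun x => ((ρ' : ℝ) : ℂ) * ((starRingEnd ℂ) (w x) * w x))
      volume 0 ℓ :=
    (continuousOn_const.mul ((Complex.continuous_conj.comp_continuousOn hwc).mul
      hwc)).intervalIntegrable
  have hJ' : ∫ x in (0 : ℝ)..ℓ, (ρ x : ℂ) * ((starRingEnd ℂ) (g x) * w x) = (starRingEnd ℂ) J := by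
    rw [hJ, intervalIntegral.integral_of_le hℓ.le, intervalIntegral.integral_of_le hℓ.le,
      ← integral_conj]
    refine integral_congr_ae (Eventually.of_forall fun x => ?_)
    simp only [map_mul, Complex.conj_ofReal, Complex.conj_conj]
    ring
  have hn : ∀ z : ℂ, (starRingEnd ℂ) z * z = ((‖z‖ ^ 2 : ℝ) : ℂ) := fun z => by
    rw [Complex.conj_mul', Complex.ofReal_pow]
  set I := ∫ x in (0 : ℝ)..ℓ, ‖w x‖ ^ 2 with hI
  have hI0 : 0 ≤ I := intervalIntegral.integral_nonneg hℓ.le fun x _ => by positivity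
  have hI' : ∫ x in (0 : ℝ)..ℓ, ((ρ' : ℝ) : ℂ) * ((starRingEnd ℂ) (w x) * w x)
      = ((ρ' * I : ℝ) : ℂ) := by
    have e0 : ∫ x in (0 : ℝ)..ℓ, (starRingEnd ℂ) (w x) * w x = (I : ℂ) := by
      simp only [hn]
      exact intervalIntegral.integral_ofReal
    rw [intervalIntegral.integral_const_mul, e0, ← Complex.ofReal_mul]
  have h2 : ((ρ' * I : ℝ) : ℂ) + ((starRingEnd ℂ) J + J)
      = ((ρ ℓ * ‖w ℓ‖ ^ 2 - ρ 0 * ‖w 0‖ ^ 2 : ℝ) : ℂ) := by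
    rw [← hI', ← hJ', hJ, ← intervalIntegral.integral_add hi2 hi1,
      ← intervalIntegral.integral_add hi3 (hi2.add hi1)]
    rw [hn, hn] at h1
    push_cast at h1 ⊢
    rw [← h1]
    refine intervalIntegral.integral_congr fun x _ => ?_
    ring
  have h3 := congrArg Complex.re h2
  rw [Complex.ofReal_re, Complex.add_re, Complex.add_re, Complex.conj_re, Complex.ofReal_re] at h3
  have h4 : (∫ x in Set.Ioo 0 ℓ, ((s * ρ x : ℝ) : ℂ) * ((starRingEnd ℂ) (w x) * g x)).re
      = s * J.re := by
    rw [integral_Ioo_eq hℓ.le, hJ, ← Complex.re_ofReal_mul, ← intervalIntegral.integral_const_mul]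
    congr 1
    refine intervalIntegral.integral_congr fun x _ => ?_
    push_cast
    ring
  have hρo : ρ o = 1 := by rw [hρ, affineWeight, sub_self, zero_div, mul_zero, add_zero]
  have hρb : ρ b = ε := by rw [hρ, affineWeight, div_self hbo]; ring
  rw [h4, integral_Ioo_eq hℓ.le]
  have h6 : (ε - 1) * I ≥ -I := by nlinarith
  have h7 : ℓ⁻¹ * ((ε - 1) * I) ≥ ℓ⁻¹ * (-I) := by gcongr
  rcases h.cases with ⟨hs, h4, h5⟩ | ⟨hs, h4, h5⟩
  · rw [h4] at hρb hρ' ⊢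
    rw [h5] at hρo hρ' ⊢
    rw [sub_zero, one_div] at hρ'
    rw [hρb, hρo, hρ'] at h3
    rw [hs]
    nlinarith
  · rw [h4] at hρb hρ' ⊢
    rw [h5] at hρo hρ' ⊢
    rw [zero_sub, one_div, inv_neg] at hρ'
    rw [hρb, hρo, hρ'] at h3
    rw [hs]
    nlinarith

end IsSpeed

namespace Network.HypSystem

variable {V E : Type*} [Fintype V] [DecidableEq V] [Fintype E] [DecidableEq E]
variable {G : Network V E} {S : G.HypSystem}
variable {m q : ∀ e, Fin (G.k e) → ℝ → ℝ} {s : ∀ e, Fin (G.k e) → ℝ}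

/-- The weight `(u, x) ↦ ((ρ / |m|) u, x)`, where `ρ` is `ε` at the inflow and `1` at the outflow
end points. -/
theorem IsDiagonal.exists_weight (h : S.IsDiagonal m q s) {ε : ℝ} (hε0 : 0 < ε) (hε : ε ≤ 1) :
    ∃ (Q : S.Space →L[ℂ] S.Space) (c : ℝ), IsWeight Q c ∧ (∀ U v, (Q U).snd v = U.snd v) ∧
      ∀ U e, ∀ᵐ x ∂(volume.restrict (Set.Ioo 0 (G.ℓ e))), ∀ i, (Q U).fst e x i
        = ((s e i * affineWeight ε (G.inflow s e i) (G.outflow s e i) x / m e i x : ℝ) : ℂ)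
          * U.fst e x i := by
  let ω' : ∀ e, Fin (G.k e) → ℝ → ℝ := fun e i x =>
    s e i * affineWeight ε (G.inflow s e i) (G.outflow s e i) x / m e i x
  have hω : ∀ e i, ContinuousOn (ω' e i) (Set.Icc 0 (G.ℓ e)) := fun e i => by
    refine ContinuousOn.div (Continuous.continuousOn ?_) (h.speed e i).continuousOn
      fun x hx => (h.speed e i).ne_zero hx
    unfold affineWeight
    fun_prop
  choose L hL using fun e => L2Interval.exists_mul (ℓ := G.ℓ e) (n := G.k e)
    (A := fun x => Matrix.diagonal fun i => (ω' e i x : ℂ)) fun i j => by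
      by_cases hij : i = j
      · subst hij
        simp only [Matrix.diagonal_apply_eq]
        exact (Complex.continuous_ofReal.comp_continuousOn (hω e i)).memLp_top
      · simp only [Matrix.diagonal_apply_ne _ hij]
        exact MemLp.zero'
  have hL' : ∀ e u, ∀ᵐ x ∂(volume.restrict (Set.Ioo 0 (G.ℓ e))), ∀ i,
      L e u x i = (ω' e i x : ℂ) * u x i := fun e u => (hL e u).mono fun x hx i => by
    rw [hx i, Finset.sum_eq_single i (fun j _ hj => by
      rw [Matrix.diagonal_apply_ne _ hj.symm, zero_mul]) (by simp), Matrix.diagonal_apply_eq]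
  choose c₁ c₂ hc₁ hc₂ hcm using fun e i => (h.speed e i).exists_bounds
  -- The weight is `ρ / |m| ≥ ε / c₂` on the edges and `1` at the vertices; `κ⁻¹` lies below all of
  -- these.
  let κ : ℝ := 1 + ∑ e, ∑ i, c₂ e i / ε
  have hκ0 : ∀ e i, 0 ≤ c₂ e i / ε := fun e i => div_nonneg (hc₂ e i).le hε0.le
  have hκ : ∀ e i, c₂ e i / ε ≤ κ := fun e i => by
    have := (Finset.single_le_sum (fun i _ => hκ0 e i) (Finset.mem_univ i)).trans
      (Finset.single_le_sum (f := fun e => ∑ i, c₂ e i / ε)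
        (fun e _ => Finset.sum_nonneg fun i _ => hκ0 e i) (Finset.mem_univ e))
    simp only [κ]
    linarith
  have hκ1 : 1 ≤ κ := by
    have : 0 ≤ ∑ e, ∑ i, c₂ e i / ε := Finset.sum_nonneg fun e _ =>
      Finset.sum_nonneg fun i _ => hκ0 e i
    simp only [κ]
    linarith
  have hωκ : ∀ e i, ∀ x ∈ Set.Icc 0 (G.ℓ e), κ⁻¹ ≤ ω' e i x := by
    intro e i x hx
    have h1 := (h.speed e i).affineWeight_mem hε hx
    have h2 := (h.speed e i).sign x hx
    have h3 := (hcm e i x hx).2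
    have h4 : ω' e i x
        = affineWeight ε (G.inflow s e i) (G.outflow s e i) x / (s e i * m e i x) := by
      have h5 := (h.speed e i).ne_zero hx
      have h6 := (h.speed e i).s_sq
      have h7 : s e i ≠ 0 := by rintro h8; rw [h8] at h6; norm_num at h6
      simp only [ω']
      field_simp
      rw [sq, h6, one_mul]
    rw [h4]
    have h5 : ε / c₂ e i ≤ affineWeight ε (G.inflow s e i) (G.outflow s e i) x / (s e i * m e i x) :=
      div_le_div₀ (hε0.le.trans h1.1) h1.1 h2 h3
    refine le_trans ?_ h5
    rw [← inv_div]
    exact inv_anti₀ (div_pos (hc₂ e i) hε0) (hκ e i)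
  have hint : ∀ e (u u' : L2Interval (G.ℓ e) (G.k e)), inner ℂ (L e u) u'
      = ∑ i, ∫ x in Set.Ioo 0 (G.ℓ e), (ω' e i x : ℂ) * ((starRingEnd ℂ) (u x i) * u' x i) := by
    intro e u u'
    rw [L2Interval.inner_eq]
    refine Finset.sum_congr rfl fun i _ => integral_congr_ae ?_
    filter_upwards [hL' e u] with x hx
    rw [hx, map_mul, Complex.conj_ofReal, mul_assoc]
  refine ⟨S.diagOp L 1, κ⁻¹, ⟨by positivity, fun U F => ?_, fun U => ?_⟩, fun U v => ?_,
    fun U e => hL' e (U.fst e)⟩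
  · rw [space_inner, space_inner]
    congr 1
    · refine Finset.sum_congr rfl fun e _ => ?_
      rw [diagOp_fst, diagOp_fst, hint, L2Interval.inner_eq]
      refine Finset.sum_congr rfl fun i _ => integral_congr_ae ?_
      filter_upwards [hL' e (F.fst e)] with x hx
      rw [hx]; ring
    · refine Finset.sum_congr rfl fun v _ => ?_
      rw [diagOp_snd, diagOp_snd, one_smul, one_smul]
  · rw [space_inner, space_norm_sq, Complex.add_re, mul_add, Complex.re_sum, Complex.re_sum,
      Finset.mul_sum, Finset.mul_sum]
    refine add_le_add (Finset.sum_le_sum fun e _ => ?_) (Finset.sum_le_sum fun v _ => ?_)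
    · rw [diagOp_fst, hint, L2Interval.norm_sq_eq, Complex.re_sum, Finset.mul_sum]
      refine Finset.sum_le_sum fun i _ => ?_
      have hn : ∀ z : ℂ, (starRingEnd ℂ) z * z = ((‖z‖ ^ 2 : ℝ) : ℂ) := fun z => by
        rw [Complex.conj_mul', Complex.ofReal_pow]
      simp_rw [hn, ← Complex.ofReal_mul]
      rw [integral_complex_ofReal, Complex.ofReal_re, ← integral_const_mul]
      have hu2 : Integrable (fun x => ‖U.fst e x i‖ ^ 2) (volume.restrict (Set.Ioo 0 (G.ℓ e))) :=
        (L2Interval.memLp_coord (U.fst e) i).integrable_norm_pow (by norm_num)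
      refine setIntegral_mono_on (hu2.const_mul _) ?_ measurableSet_Ioo fun x hx => ?_
      · obtain ⟨C, hC⟩ := isCompact_Icc.exists_bound_of_continuousOn (hω e i)
        refine hu2.bdd_mul (c := C) (((hω e i).mono
          Set.Ioo_subset_Icc_self).aestronglyMeasurable measurableSet_Ioo) ?_
        filter_upwards [ae_restrict_mem measurableSet_Ioo] with x hx
        exact hC x (Set.Ioo_subset_Icc_self hx)
      · exact mul_le_mul_of_nonneg_right (hωκ e i x (Set.Ioo_subset_Icc_self hx)) (by positivity)
    · rw [diagOp_snd, one_smul, inner_self_eq_norm_sq_to_K]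
      have h1 : ((((‖(U.snd v : G.VSpace v)‖ : ℝ) : ℂ)) ^ 2).re = ‖U.snd v‖ ^ 2 := by
        rw [← Complex.ofReal_pow, Complex.ofReal_re]; rfl
      refine le_trans ?_ h1.ge
      exact mul_le_of_le_one_left (by positivity) (inv_le_one_of_one_le₀ hκ1)
  · rw [diagOp_snd, one_smul]

theorem exists_norm_le_of_linearMap (L : ∀ v, S.Y v →ₗ[ℂ] S.Yd v) :
    ∃ N : ℝ, 0 ≤ N ∧ ∀ v ξ, ‖L v ξ‖ ≤ N * ‖ξ‖ := by
  choose C hC using fun v => (LinearMap.toContinuousLinearMap (L v)).bound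
  refine ⟨∑ v, C v, Finset.sum_nonneg fun v _ => (hC v).1.le, fun v ξ =>
    ((hC v).2 ξ).trans (mul_le_mul_of_nonneg_right ?_ (norm_nonneg ξ))⟩
  exact Finset.single_le_sum (fun v _ => (hC v).1.le) (Finset.mem_univ v)

/-- Summed over the network, the energy balance sets incoming energy, discounted by `ε`, against
outgoing energy. The outflow coordinates bound the former by the latter and `|x|²`, so a small `ε`
leaves only bounded terms. -/
theorem IsDiagonal.exists_isQuasiDissipative (h : S.IsDiagonal m q s)
    (hS : S.HasOutflowCoordinates s) (L : ∀ v, S.Y v →ₗ[ℂ] S.Yd v) :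
    ∃ (Q : S.Space →L[ℂ] S.Space) (c w₀ : ℝ), IsWeight Q c ∧
      IsQuasiDissipative Q w₀ (S.transportGraph m L) := by
  obtain ⟨C, hC0, hC⟩ := hS.exists_norm_le
  obtain ⟨N, hN0, hN⟩ := exists_norm_le_of_linearMap L
  -- `ε C ≤ 1/2` is what lets half of the outgoing energy absorb `ε ‖γ‖²`.
  set ε := min 1 (1 / (2 * C)) with hε
  have hε0 : 0 < ε := lt_min one_pos (by positivity)
  have hε1 : ε ≤ 1 := min_le_left _ _
  have hεC : ε * C ≤ 1 / 2 := by
    calc ε * C ≤ 1 / (2 * C) * C := mul_le_mul_of_nonneg_right (min_le_right _ _) hC0.le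
      _ = 1 / 2 := by field_simp
  obtain ⟨Q, c, hQ, hQs, hQf⟩ := h.exists_weight hε0 hε1
  set Λ := ∑ e, (G.ℓ e)⁻¹ with hΛ
  have hΛe : ∀ e, (G.ℓ e)⁻¹ ≤ Λ := fun e =>
    Finset.single_le_sum (f := fun e => (G.ℓ e)⁻¹) (fun e _ => (inv_pos.2 (G.ℓ_pos e)).le)
      (Finset.mem_univ e)
  have hΛ0 : 0 ≤ Λ := Finset.sum_nonneg fun e _ => (inv_pos.2 (G.ℓ_pos e)).le
  set R := 1 / 2 + N ^ 2 / (2 * ε) with hR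
  have hR0 : 0 ≤ R := by positivity
  refine ⟨Q, c, (Λ + R) / c, hQ, fun U F ⟨w, g, hw⟩ => ?_⟩
  have hmain : (inner ℂ (Q U) F).re ≤ (Λ + R) * ‖U‖ ^ 2 := by
    have hedge : ∀ e, (inner ℂ ((Q U).fst e) (F.fst e)).re
        ≤ ∑ i, (1 / 2 * (ε * ‖w e i (G.inflow s e i)‖ ^ 2)
          - 1 / 2 * ‖w e i (G.outflow s e i)‖ ^ 2) + Λ * ‖U.fst e‖ ^ 2 := by
      intro e
      rw [L2Interval.inner_eq, Complex.re_sum, L2Interval.norm_sq_eq, Finset.mul_sum,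
        ← Finset.sum_add_distrib]
      refine Finset.sum_le_sum fun i _ => ?_
      have h1 := (h.speed e i).energy_le hε0.le hε1 (hw.prim e i)
      have h2 : ∫ x in Set.Ioo 0 (G.ℓ e), (starRingEnd ℂ) ((Q U).fst e x i) * F.fst e x i
          = ∫ x in Set.Ioo 0 (G.ℓ e),
            ((s e i * affineWeight ε (G.inflow s e i) (G.outflow s e i) x : ℝ) : ℂ)
              * ((starRingEnd ℂ) (w e i x) * g e i x) := by
        refine integral_congr_ae ?_
        filter_upwards [hQf U e, hw.fst e, hw.fst' e, ae_restrict_mem measurableSet_Ioo]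
          with x h1 h2 h3 h4
        have h5 : (m e i x : ℂ) ≠ 0 := by
          exact_mod_cast (h.speed e i).ne_zero (Set.Ioo_subset_Icc_self h4)
        rw [h1, h2, h3, map_mul, Complex.conj_ofReal]
        push_cast
        field_simp
      have h3 : ∫ x in Set.Ioo 0 (G.ℓ e), ‖U.fst e x i‖ ^ 2
          = ∫ x in Set.Ioo 0 (G.ℓ e), ‖w e i x‖ ^ 2 :=
        integral_congr_ae ((hw.fst e).mono fun x hx => by simp only [hx])
      have h4 : 0 ≤ ∫ x in Set.Ioo 0 (G.ℓ e), ‖w e i x‖ ^ 2 :=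
        integral_nonneg fun x => by positivity
      have h5 := mul_le_mul_of_nonneg_right (hΛe e) h4
      have h6 := mul_nonneg hΛ0 h4
      rw [h2, h3]
      linarith
    have hvert : ∀ v, (inner ℂ ((Q U).snd v : G.VSpace v) (F.snd v : G.VSpace v)).re
        + (∑ p : G.VIdx v, (if G.IsOut s p then 0
            else 1 / 2 * (ε * ‖w p.1.1 p.2 (G.inflow s p.1.1 p.2)‖ ^ 2))
          - ∑ p : G.VIdx v, (if G.IsOut s p then
            1 / 2 * ‖w p.1.1 p.2 (G.outflow s p.1.1 p.2)‖ ^ 2 else 0)) ≤ R * ‖U.snd v‖ ^ 2 := by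
      intro v
      set γ : S.Y v := ⟨G.traceVec w v, hw.mem v⟩ with hγ
      set O := ∑ p, if G.IsOut s p then ‖(γ : G.VSpace v) p‖ ^ 2 else 0 with hO
      have h1 := (hC v).2 γ
      have hx : S.Pd v γ = U.snd v := (hw.snd v).symm
      rw [hx] at h1
      have h2 : (inner ℂ ((Q U).snd v : G.VSpace v) (F.snd v : G.VSpace v)).re
          ≤ ‖U.snd v‖ * (N * ‖γ‖) := by
        rw [hQs, hw.snd' v]
        refine (Complex.re_le_norm _).trans ((norm_inner_le_norm _ _).trans ?_)
        exact mul_le_mul_of_nonneg_left (hN v γ) (norm_nonneg _)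
      have h3 : ∑ p : G.VIdx v, (if G.IsOut s p then 0
            else 1 / 2 * (ε * ‖w p.1.1 p.2 (G.inflow s p.1.1 p.2)‖ ^ 2))
          ≤ 1 / 2 * (ε * ‖γ‖ ^ 2) := by
        have h4 : ‖γ‖ ^ 2 = ∑ p, ‖(γ : G.VSpace v) p‖ ^ 2 :=
          PiLp.norm_sq_eq_of_L2 _ (γ : G.VSpace v)
        rw [h4, Finset.mul_sum, Finset.mul_sum]
        refine Finset.sum_le_sum fun p _ => ?_
        split_ifs with hp
        · positivity
        · rw [← traceVec_of_not_isOut w hp]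
      have h5 : ∑ p : G.VIdx v, (if G.IsOut s p then
            1 / 2 * ‖w p.1.1 p.2 (G.outflow s p.1.1 p.2)‖ ^ 2 else 0) = 1 / 2 * O := by
        rw [hO, Finset.mul_sum]
        refine Finset.sum_congr rfl fun p _ => ?_
        split_ifs with hp
        · rw [← traceVec_of_isOut w hp]
        · rw [mul_zero]
      -- Young's inequality, with constants chosen to spend the second half of `ε ‖γ‖²`; the inflow
      -- sum has used the first.
      have h6 : ‖U.snd v‖ * (N * ‖γ‖) ≤ 1 / 2 * (ε * ‖γ‖ ^ 2) + N ^ 2 / (2 * ε) * ‖U.snd v‖ ^ 2 := by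
        have h7 : 1 / 2 * (ε * ‖γ‖ ^ 2) + N ^ 2 / (2 * ε) * ‖U.snd v‖ ^ 2
            - ‖U.snd v‖ * (N * ‖γ‖) = 1 / (2 * ε) * (ε * ‖γ‖ - N * ‖U.snd v‖) ^ 2 := by
          field_simp
          ring
        have h8 : 0 ≤ 1 / (2 * ε) * (ε * ‖γ‖ - N * ‖U.snd v‖) ^ 2 := by positivity
        linarith
      have hO0 : 0 ≤ O := Finset.sum_nonneg fun p _ => by split_ifs <;> positivity
      have h7 : ε * ‖γ‖ ^ 2 ≤ 1 / 2 * (‖U.snd v‖ ^ 2 + O) := by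
        calc ε * ‖γ‖ ^ 2 ≤ ε * (C * (‖U.snd v‖ ^ 2 + O)) := mul_le_mul_of_nonneg_left h1 hε0.le
          _ = ε * C * (‖U.snd v‖ ^ 2 + O) := by ring
          _ ≤ _ := mul_le_mul_of_nonneg_right hεC (by positivity)
      rw [h5, hR, add_mul]
      linarith
    rw [space_inner, Complex.add_re, Complex.re_sum, Complex.re_sum, space_norm_sq]
    have h1 := Finset.sum_le_sum fun e (_ : e ∈ Finset.univ) => hedge e
    have h2 := Finset.sum_le_sum fun v (_ : v ∈ Finset.univ) => hvert v
    simp only [Finset.sum_add_distrib, Finset.sum_sub_distrib, ← Finset.mul_sum] at h1 h2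
    have h3 := sum_not_isOut (s := s) fun e i => 1 / 2 * (ε * ‖w e i (G.inflow s e i)‖ ^ 2)
    have h4 := sum_isOut (s := s) fun e i => 1 / 2 * ‖w e i (G.outflow s e i)‖ ^ 2
    simp only [← Finset.mul_sum] at h3 h4
    rw [h3, h4] at h2
    have h5 : 0 ≤ ∑ e, ‖U.fst e‖ ^ 2 := Finset.sum_nonneg fun e _ => by positivity
    have h6 : 0 ≤ ∑ v, ‖U.snd v‖ ^ 2 := Finset.sum_nonneg fun e _ => by positivity
    nlinarith [mul_nonneg hR0 h5, mul_nonneg hΛ0 h6]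
  refine hmain.trans ?_
  have h1 := hQ.coercive U
  have hc := hQ.pos
  rw [div_mul_eq_mul_div, le_div_iff₀ hc, mul_assoc, mul_comm (‖U‖ ^ 2)]
  exact mul_le_mul_of_nonneg_left h1 (by positivity)

end Network.HypSystem
end

noncomputable section

set_option linter.unusedSectionVars false

/-! ### Generation of positive semigroups -/

theorem IsPrimitive.add {ℓ : ℝ} {w g w' g' : ℝ → ℂ} (h : IsPrimitive ℓ w g)
    (h' : IsPrimitive ℓ w' g') : IsPrimitive ℓ (fun x => w x + w' x) (fun x => g x + g' x) := by
  refine ⟨h.integrable.add h'.integrable, fun x hx => ?_⟩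
  have hsub : Set.uIcc 0 x ⊆ Set.uIcc 0 ℓ := by
    rw [Set.uIcc_of_le hx.1, Set.uIcc_of_le (hx.1.trans hx.2)]
    exact Set.Icc_subset_Icc_right hx.2
  rw [intervalIntegral.integral_add (h.integrable.mono_set hsub) (h'.integrable.mono_set hsub),
    h.eq_add x hx, h'.eq_add x hx]
  ring

theorem IsPrimitive.const_mul {ℓ : ℝ} {w g : ℝ → ℂ} (h : IsPrimitive ℓ w g) (c : ℂ) :
    IsPrimitive ℓ (fun x => c * w x) (fun x => c * g x) :=
  ⟨h.integrable.const_mul c, fun x hx => by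
    rw [intervalIntegral.integral_const_mul, h.eq_add x hx]; ring⟩

/-- Makes the transport graph single-valued: `u = 0` in `L²` forces its derivative and its end point
values to vanish. -/
theorem IsPrimitive.eq_zero_of_ae {ℓ : ℝ} (hℓ : 0 < ℓ) {w g : ℝ → ℂ} (h : IsPrimitive ℓ w g)
    (h0 : ∀ᵐ x ∂(volume.restrict (Set.Ioo 0 ℓ)), w x = 0) : (∀ x ∈ Set.Icc 0 ℓ, w x = 0) ∧
      ∀ᵐ x ∂(volume.restrict (Set.Ioo 0 ℓ)), g x = 0 := by
  have h1 : ∀ x ∈ Set.Icc 0 ℓ, w x = 0 := by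
    have h2 : ∀ᵐ x ∂(volume.restrict (Set.Icc 0 ℓ)), w x = 0 := by
      rwa [← restrict_Ioo_eq_restrict_Icc]
    exact fun x hx => Measure.eqOn_Icc_of_ae_eq volume hℓ.ne (g := fun _ => 0) h2
      (h.continuousOn hℓ.le) continuousOn_const hx
  refine ⟨h1, ?_⟩
  filter_upwards [ae_restrict_of_ae (h.ae_hasDerivAt hℓ.le), ae_restrict_mem measurableSet_Ioo]
    with x hx hxm
  have h2 : HasDerivAt w 0 x := (hasDerivAt_const x (0 : ℂ)).congr_of_eventuallyEq
    (by filter_upwards [Ioo_mem_nhds hxm.1 hxm.2] with y hy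
        exact h1 y (Set.Ioo_subset_Icc_self hy))
  exact (hx hxm).unique h2

namespace Network.HypSystem

variable {V E : Type*} [Fintype V] [DecidableEq V] [Fintype E] [DecidableEq E]
variable {G : Network V E} {S : G.HypSystem}
variable {m q : ∀ e, Fin (G.k e) → ℝ → ℝ} {s : ∀ e, Fin (G.k e) → ℝ}

theorem isLinearGraph_transportGraph (L : ∀ v, S.Y v →ₗ[ℂ] S.Yd v) :
    IsLinearGraph (S.transportGraph m L) := by
  refine ⟨?_, ?_, ?_, ?_⟩
  · rintro U F U' F' ⟨w, g, h⟩ ⟨w', g', h'⟩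
    have htr : ∀ v, G.traceVec (fun e i x => w e i x + w' e i x) v
        = G.traceVec w v + G.traceVec w' v := fun v => rfl
    have hmem : ∀ v, G.traceVec (fun e i x => w e i x + w' e i x) v ∈ S.Y v := fun v => by
      rw [htr]; exact add_mem (h.mem v) (h'.mem v)
    refine ⟨fun e i x => w e i x + w' e i x, fun e i x => g e i x + g' e i x,
      fun e i => (h.prim e i).add (h'.prim e i), fun e => ?_, fun e => ?_, hmem,
      fun v => ?_, fun v => ?_⟩
    · have e1 : (U + U').fst e = U.fst e + U'.fst e := rfl
      rw [e1]
      filter_upwards [L2Interval.add_coord (U.fst e) (U'.fst e), h.fst e, h'.fst e]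
        with x h1 h2 h3 i
      rw [h1, h2, h3]
    · have e1 : (F + F').fst e = F.fst e + F'.fst e := rfl
      rw [e1]
      filter_upwards [L2Interval.add_coord (F.fst e) (F'.fst e), h.fst' e, h'.fst' e]
        with x h1 h2 h3 i
      rw [h1, h2, h3, mul_add]
    · rw [htr, map_add, ← h.snd v, ← h'.snd v]; rfl
    · have e1 : (F + F').snd v = F.snd v + F'.snd v := rfl
      rw [e1, h.snd' v, h'.snd' v, ← map_add]
      rfl
  · rintro c U F ⟨w, g, h⟩
    have htr : ∀ v, G.traceVec (fun e i x => c * w e i x) v = c • G.traceVec w v := fun v => rfl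
    have hmem : ∀ v, G.traceVec (fun e i x => c * w e i x) v ∈ S.Y v := fun v => by
      rw [htr]; exact Submodule.smul_mem _ c (h.mem v)
    refine ⟨fun e i x => c * w e i x, fun e i x => c * g e i x,
      fun e i => (h.prim e i).const_mul c, fun e => ?_, fun e => ?_, hmem,
      fun v => ?_, fun v => ?_⟩
    · have e1 : (c • U).fst e = c • U.fst e := rfl
      rw [e1]
      filter_upwards [L2Interval.smul_coord c (U.fst e), h.fst e] with x h1 h2 i
      rw [h1, h2]
    · have e1 : (c • F).fst e = c • F.fst e := rfl
      rw [e1]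
      filter_upwards [L2Interval.smul_coord c (F.fst e), h.fst' e] with x h1 h2 i
      rw [h1, h2, mul_left_comm]
    · rw [htr, map_smul, ← h.snd v]; rfl
    · have e1 : (c • F).snd v = c • F.snd v := rfl
      rw [e1, h.snd' v, ← map_smul]
      rfl
  · have htr : ∀ v, G.traceVec (fun _ _ _ => (0 : ℂ)) v = 0 := fun v => rfl
    refine ⟨fun _ _ _ => 0, fun _ _ _ => 0, fun e i => ⟨intervalIntegrable_const, by simp⟩,
      fun e => L2Interval.zero_coord, fun e => ?_, fun v => by rw [htr]; exact zero_mem _,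
      fun v => by rw [htr, map_zero]; rfl, fun v => ?_⟩
    · refine (L2Interval.zero_coord (ℓ := G.ℓ e) (n := G.k e)).mono fun x hx i => ?_
      rw [mul_zero]; exact hx i
    · exact (map_zero (L v)).symm
  · rintro F ⟨w, g, h⟩
    have hw : ∀ e i, (∀ x ∈ Set.Icc 0 (G.ℓ e), w e i x = 0) ∧
        ∀ᵐ x ∂(volume.restrict (Set.Ioo 0 (G.ℓ e))), g e i x = 0 := fun e i => by
      refine (h.prim e i).eq_zero_of_ae (G.ℓ_pos e) ?_
      have h0 : (0 : S.Space).fst e = 0 := rfl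
      have h1 := h.fst e
      rw [h0] at h1
      filter_upwards [h1, L2Interval.zero_coord (ℓ := G.ℓ e) (n := G.k e)] with x h1 h2
      rw [← h1, h2]
    refine space_ext (fun e => L2Interval.ext_coord ?_) fun v => ?_
    · have h0 : (0 : S.Space).fst e = 0 := rfl
      rw [h0]
      filter_upwards [h.fst' e, L2Interval.zero_coord (ℓ := G.ℓ e) (n := G.k e),
        ae_all_iff.2 fun i => (hw e i).2] with x h1 h2 h3 i
      rw [h1, h2, h3, mul_zero]
    · rw [h.snd' v]
      have h0 : (⟨G.traceVec w v, h.mem v⟩ : S.Y v) = 0 := Subtype.ext (by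
        ext p
        exact (hw p.1.1 p.2).1 _ (coord_mem p))
      rw [h0, map_zero]; rfl

/-! ### The resolvent equation on the network -/

/-- The values at the inflow endpoints that a family of vertex values prescribes. -/
def inflowValue (s : ∀ e, Fin (G.k e) → ℝ) (γ : ∀ v, S.Y v) (e : E) (i : Fin (G.k e)) : ℂ :=
  (γ (G.inV s e i) : G.VSpace (G.inV s e i)) ⟨⟨e, G.incident_inV s e i⟩, i⟩

theorem inflowValue_of_not_isOut (γ : ∀ v, S.Y v) {v : V} {p : G.VIdx v} (hp : ¬ G.IsOut s p) :
    S.inflowValue s γ p.1.1 p.2 = (γ v : G.VSpace v) p := by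
  have key : ∀ e i v he, G.inV s e i = v →
      S.inflowValue s γ e i = (γ v : G.VSpace v) ⟨⟨e, he⟩, i⟩ := by
    rintro e i v he rfl
    rfl
  exact key p.1.1 p.2 v p.1.2 ((not_isOut_iff p).1 hp)

theorem norm_inflowValue_le (γ : ∀ v, S.Y v) (e : E) (i : Fin (G.k e)) :
    ‖S.inflowValue s γ e i‖ ≤ ‖γ‖ :=
  (PiLp.norm_apply_le _ _).trans (norm_le_pi_norm γ _)

/-- The outflow data produced by vertex values: the dynamic part is `b` times `L`, and the inflow
values are damped by `r`. -/
def outflowData (s : ∀ e, Fin (G.k e) → ℝ) (L : ∀ v, S.Y v →ₗ[ℂ] S.Yd v) (b : ℝ)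
    (r : ∀ e, Fin (G.k e) → ℝ) (v : V) :
    (∀ v, S.Y v) →ₗ[ℂ] (S.Yd v × ({p : G.VIdx v // G.IsOut s p} → ℂ)) :=
  LinearMap.prod ((b : ℂ) • (L v ∘ₗ LinearMap.proj v))
    { toFun := fun γ p => (r p.1.1.1 p.1.2 : ℂ) * S.inflowValue s γ p.1.1.1 p.1.2
      map_add' := fun _ _ => funext fun _ => mul_add _ _ _
      map_smul' := fun _ _ => funext fun _ => mul_left_comm _ _ _ }

theorem norm_outflowData_le {L : ∀ v, S.Y v →ₗ[ℂ] S.Yd v} {N : ℝ}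
    (hN : ∀ v (ξ : S.Y v), ‖L v ξ‖ ≤ N * ‖ξ‖) {b ρ : ℝ} {r : ∀ e, Fin (G.k e) → ℝ} (hb : 0 ≤ b)
    (hρ0 : 0 ≤ ρ) (hbρ : b * N ≤ ρ) (hr : ∀ e i, 0 ≤ r e i) (hrρ : ∀ e i, r e i ≤ ρ) (v : V)
    (γ : ∀ v, S.Y v) : ‖S.outflowData s L b r v γ‖ ≤ ρ * ‖γ‖ := by
  have hN' : ‖L v (γ v)‖ ≤ N * ‖γ v‖ := hN v _
  refine max_le ?_ ((pi_norm_le_iff_of_nonneg (by positivity)).2 fun p => ?_)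
  · show ‖(b : ℂ) • L v (γ v)‖ ≤ _
    rw [norm_smul, Complex.norm_real, Real.norm_of_nonneg hb]
    calc b * ‖L v (γ v)‖ ≤ b * (N * ‖γ v‖) := mul_le_mul_of_nonneg_left hN' hb
      _ = (b * N) * ‖γ v‖ := (mul_assoc _ _ _).symm
      _ ≤ ρ * ‖γ‖ := mul_le_mul hbρ (norm_le_pi_norm γ v) (norm_nonneg _) hρ0
  · show ‖(r p.1.1.1 p.1.2 : ℂ) * S.inflowValue s γ p.1.1.1 p.1.2‖ ≤ _
    rw [norm_mul, Complex.norm_real, Real.norm_of_nonneg (hr _ _)]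
    exact mul_le_mul (hrρ _ _) (norm_inflowValue_le γ _ _) (norm_nonneg _) hρ0

theorem isClosed_nonneg_vertexValues :
    IsClosed {γ : ∀ v, S.Y v | ∀ v p, ((γ v : G.VSpace v) p).IsNonnegReal} := by
  have e1 : {γ : ∀ v, S.Y v | ∀ v p, ((γ v : G.VSpace v) p).IsNonnegReal}
      = ⋂ v, ⋂ p, (fun γ : ∀ v, S.Y v => (γ v : G.VSpace v) p) ⁻¹' {z | z.IsNonnegReal} := by
    ext γ
    simp only [Set.mem_iInter]
    rfl
  rw [e1]
  exact isClosed_iInter fun v => isClosed_iInter fun p =>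
    Complex.IsNonnegReal.isClosed.preimage ((PiLp.continuous_apply 2 _ p).comp
      (continuous_subtype_val.comp (continuous_apply v)))

theorem exists_fixedPoint_of_dist_le {H : Type*} [MetricSpace H] [CompleteSpace H] {K : Set H}
    (hK : IsClosed K) {f : H → H} {c : ℝ} (hc0 : 0 ≤ c) (hc1 : c < 1)
    (hf : ∀ x y, dist (f x) (f y) ≤ c * dist x y) (x₀ : H) :
    ∃ z, f z = z ∧ (x₀ ∈ K → (∀ x ∈ K, f x ∈ K) → z ∈ K) := by
  have : Nonempty H := ⟨x₀⟩
  have hf' : ContractingWith ⟨c, hc0⟩ f := ⟨by exact_mod_cast hc1, LipschitzWith.of_dist_le_mul hf⟩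
  refine ⟨hf'.fixedPoint f, hf'.fixedPoint_isFixedPt, fun h0 hfK => ?_⟩
  refine hK.mem_of_tendsto (hf'.tendsto_iterate_fixedPoint x₀) (Filter.Eventually.of_forall fun n => ?_)
  induction n with
  | zero => exact h0
  | succ n ih => rw [Function.iterate_succ_apply']; exact hfK _ ih

/-- In outflow coordinates the vertex equations read `γ = lift (outflowData γ + data)`. The linear
part has norm at most `C ρ < 1` in the supremum norm over the vertices, so Banach's theorem applies.
-/
theorem HasOutflowCoordinates.exists_vertexValues (hS : S.HasOutflowCoordinates s)
    (hP : ∀ v (ξ : G.VSpace v),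
      G.posPart (S.Pd v ξ : G.VSpace v) = (S.Pd v (G.posPart ξ) : G.VSpace v))
    (hY : ∀ v, ∀ ξ ∈ S.Y v, G.posPart ξ ∈ S.Y v) (L : ∀ v, S.Y v →ₗ[ℂ] S.Yd v)
    (hL : ∀ v (ξ : S.Y v), (∀ p, ((ξ : G.VSpace v) p).IsNonnegReal) →
      ∀ p, ((L v ξ : G.VSpace v) p).IsNonnegReal) {C N b ρ : ℝ} (hC0 : 0 < C)
    (hC : ∀ v z, ‖hS.lift v z‖ ≤ C * ‖z‖)
    (hN : ∀ v (ξ : S.Y v), ‖L v ξ‖ ≤ N * ‖ξ‖) {r : ∀ e, Fin (G.k e) → ℝ} (hb : 0 ≤ b)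
    (hρ0 : 0 ≤ ρ) (hbρ : b * N ≤ ρ) (hr : ∀ e i, 0 ≤ r e i) (hrρ : ∀ e i, r e i ≤ ρ)
    (hCρ : C * ρ < 1) (d : ∀ v, S.Yd v) (z : ∀ e, Fin (G.k e) → ℂ) :
    ∃ γ : ∀ v, S.Y v,
      (∀ v, S.Pd v (γ v : G.VSpace v) = (b : ℂ) • L v (γ v) + d v) ∧
      (∀ v (p : G.VIdx v), G.IsOut s p → (γ v : G.VSpace v) p
        = (r p.1.1 p.2 : ℂ) * S.inflowValue s γ p.1.1 p.2 + z p.1.1 p.2) ∧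
      ((∀ v p, ((d v : G.VSpace v) p).IsNonnegReal) → (∀ e i, (z e i).IsNonnegReal) →
        ∀ v p, ((γ v : G.VSpace v) p).IsNonnegReal) := by
  let f : (∀ v, S.Y v) → ∀ v, S.Y v := fun γ v =>
    hS.lift v (S.outflowData s L b r v γ + (d v, fun p => z p.1.1.1 p.1.2))
  have hf : ∀ γ γ', dist (f γ) (f γ') ≤ (C * ρ) * dist γ γ' := by
    intro γ γ'
    refine (dist_pi_le_iff (by positivity)).2 fun v => ?_
    rw [dist_eq_norm, dist_eq_norm, ← map_sub, add_sub_add_right_eq_sub, ← map_sub, mul_assoc]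
    exact (hC v _).trans (mul_le_mul_of_nonneg_left
      (norm_outflowData_le hN hb hρ0 hbρ hr hrρ v _) hC0.le)
  obtain ⟨γ, hγ, hγK⟩ := exists_fixedPoint_of_dist_le isClosed_nonneg_vertexValues
    (by positivity) hCρ hf 0
  have hγv : ∀ v, S.outflowMap s v (γ v)
      = S.outflowData s L b r v γ + (d v, fun p => z p.1.1.1 p.1.2) := by
    intro v
    have h1 : γ v = hS.lift v (S.outflowData s L b r v γ + (d v, fun p => z p.1.1.1 p.1.2)) :=
      (congrFun hγ v).symm
    exact (congrArg (S.outflowMap s v) h1).trans (hS.outflowMap_lift _ _)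
  refine ⟨γ, fun v => congrArg Prod.fst (hγv v), fun v p hp => ?_, fun hd hz => ?_⟩
  · exact congrFun (congrArg Prod.snd (hγv v)) ⟨p, hp⟩
  -- The iteration starts at `γ = 0`, and each step maps nonnegative vertex values to nonnegative
  -- ones by positivity of `lift`, of `L` and of the damping factors.
  · refine hγK (fun v p => Complex.IsNonnegReal.zero) fun γ' hγ' v p => ?_
    have e1 : f γ' v = hS.lift v ((b : ℂ) • L v (γ' v) + d v, fun p =>
      (r p.1.1.1 p.1.2 : ℂ) * S.inflowValue s γ' p.1.1.1 p.1.2 + z p.1.1.1 p.1.2) := rfl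
    rw [e1]
    exact hS.isNonnegReal_lift hP hY
      (fun p => ((Complex.IsNonnegReal.ofReal hb).mul (hL v _ (hγ' v) p)).add (hd v p))
      (fun p => ((Complex.IsNonnegReal.ofReal (hr _ _)).mul (hγ' _ _)).add (hz _ _)) p

/-- The edge equations express outflow values as `E(o)` times the inflow values plus a term from the
data, and the dynamic equation reads `P_v^{(d)} γ = l⁻¹ (L γ + F)`. Both dependences on `γ` are
`O(1/l)`, so the vertex values exist for large `l`, and the edge functions are then recovered from
them. -/
theorem IsDiagonal.isResolvable (h : S.IsDiagonal m q s) (hS : S.HasOutflowCoordinates s)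
    (hP : ∀ v (ξ : G.VSpace v),
      G.posPart (S.Pd v ξ : G.VSpace v) = (S.Pd v (G.posPart ξ) : G.VSpace v))
    (hY : ∀ v, ∀ ξ ∈ S.Y v, G.posPart ξ ∈ S.Y v) (L : ∀ v, S.Y v →ₗ[ℂ] S.Yd v)
    (hL : ∀ v (ξ : S.Y v), (∀ p, ((ξ : G.VSpace v) p).IsNonnegReal) →
      ∀ p, ((L v ξ : G.VSpace v) p).IsNonnegReal) :
    IsResolvable {U : S.Space | S.IsNonneg U} (S.transportGraph m L) := by
  obtain ⟨C, hC0, hC⟩ := hS.exists_norm_le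
  obtain ⟨N, hN0, hN⟩ := exists_norm_le_of_linearMap L
  let τ : ∀ e, Fin (G.k e) → ℝ := fun e i =>
    (travelTime (G.ℓ e) (m e i) (G.inflow s e i) - travelTime (G.ℓ e) (m e i) (G.outflow s e i))⁻¹
  have hτ0 : ∀ e i, 0 ≤ τ e i := fun e i => (inv_pos.2 (h.speed e i).exists_travelTime_pos).le
  obtain ⟨R, hR0, hNR, hτR⟩ : ∃ R, 0 ≤ R ∧ N ≤ R ∧ ∀ e i, τ e i ≤ R := by
    have h0 : 0 ≤ ∑ e, ∑ i, τ e i := Finset.sum_nonneg fun e _ => Finset.sum_nonneg fun i _ => hτ0 e i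
    refine ⟨N + ∑ e, ∑ i, τ e i, by linarith, by linarith, fun e i => ?_⟩
    have := (Finset.single_le_sum (fun i _ => hτ0 e i) (Finset.mem_univ i)).trans
      (Finset.single_le_sum (f := fun e => ∑ i, τ e i)
        (fun e _ => Finset.sum_nonneg fun i _ => hτ0 e i) (Finset.mem_univ e))
    linarith
  -- `R` dominates the norm bound of `L` and the reciprocal travel times, so `R / l` bounds both
  -- couplings; this threshold makes the contraction factor `C R / l` less than `1`.
  refine ⟨1 + 2 * (C * R), fun l hl F => ?_⟩
  have hCR : 0 ≤ C * R := mul_nonneg hC0.le hR0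
  have hl0 : 0 < l := by linarith
  have hl1 : 0 ≤ l⁻¹ := inv_nonneg.2 hl0.le
  have hr : ∀ e i, expSol (G.ℓ e) (m e i) (G.inflow s e i) l (G.outflow s e i) ≤ R / l :=
    fun e i => ((h.speed e i).expSol_o_le hl0).trans (div_le_div_of_nonneg_right (hτR e i) hl0.le)
  choose z hz hsol using fun e i => (h.speed e i).exists_solution l
    (f := fun x => F.fst e x i) ((intervalIntegrable_iff_integrableOn_Ioo_of_le
      (G.ℓ_pos e).le).2 (L2Interval.integrable_coord (F.fst e) i))
  obtain ⟨γ, hγd, hγo, hγK⟩ := hS.exists_vertexValues hP hY L hL hC0 (fun v => (hC v).1) hN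
    hl1 (div_nonneg hR0 hl0.le)
    (by rw [div_eq_inv_mul]; exact mul_le_mul_of_nonneg_left hNR hl1)
    (fun e i => (IsSpeed.expSol_pos _ _).le) hr
    (by rw [← mul_div_assoc, div_lt_one hl0]; linarith)
    (fun v => ((l⁻¹ : ℝ) : ℂ) • F.snd v) z
  choose w g hw hwg hwb hwo hwpos using fun e i => hsol e i (S.inflowValue s γ e i)
  have htr : ∀ v, G.traceVec w v = (γ v : G.VSpace v) := by
    intro v
    ext p
    by_cases hp : G.IsOut s p
    · rw [traceVec_of_isOut w hp, hwo, hγo v p hp]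
    · rw [traceVec_of_not_isOut w hp, hwb, inflowValue_of_not_isOut γ hp]
  choose u hu using fun e => L2Interval.exists_coord fun i =>
    ((hw e i).continuousOn (G.ℓ_pos e).le).memLp_two
  have hmem : ∀ v, G.traceVec w v ∈ S.Y v := fun v => by rw [htr]; exact (γ v).2
  refine ⟨S.mkSpace u fun v => S.Pd v (γ v : G.VSpace v), ⟨w, g, hw, hu, fun e => ?_, hmem,
    fun v => by rw [htr]; rfl, fun v => ?_⟩, fun hF => ?_⟩
  · have e1 : ((l : ℂ) • S.mkSpace u (fun v => S.Pd v (γ v : G.VSpace v)) - F).fst e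
        = (l : ℂ) • u e - F.fst e := rfl
    rw [e1]
    filter_upwards [L2Interval.sub_coord ((l : ℂ) • u e) (F.fst e),
      L2Interval.smul_coord (l : ℂ) (u e), hu e, ae_restrict_mem measurableSet_Ioo]
      with x h1 h2 h3 h4 i
    rw [h1, h2, h3, hwg e i x (Set.Ioo_subset_Icc_self h4)]
  · have e1 : ((l : ℂ) • S.mkSpace u (fun v => S.Pd v (γ v : G.VSpace v)) - F).snd v
        = (l : ℂ) • S.Pd v (γ v : G.VSpace v) - F.snd v := rfl
    have e2 : (⟨G.traceVec w v, hmem v⟩ : S.Y v) = γ v := Subtype.ext (htr v)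
    have h2 : (l : ℂ) * ((l⁻¹ : ℝ) : ℂ) = 1 := by
      rw [← Complex.ofReal_mul, mul_inv_cancel₀ hl0.ne', Complex.ofReal_one]
    rw [e1, e2, hγd v, ← smul_add, smul_smul, h2, one_smul, add_sub_cancel_right]
  · have hγ0 := hγK (fun v p => (Complex.IsNonnegReal.ofReal hl1).mul (hF.2 v p))
      (fun e i => hz e i ((hF.1 e).mono fun x hx => hx i))
    refine ⟨fun e => ?_, fun v => isNonnegReal_Pd hP (hγ0 v)⟩
    have e1 : (S.mkSpace u (fun v => S.Pd v (γ v : G.VSpace v))).fst e = u e := rfl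
    rw [e1]
    filter_upwards [hu e, ae_restrict_mem measurableSet_Ioo] with x h1 h2 i
    rw [h1]
    exact hwpos e i ((hF.1 e).mono fun x hx => hx i) (hγ0 _ _) x (Set.Ioo_subset_Icc_self h2)

/-- The shifted transport operator generates a semigroup preserving the cone. Adding the positive
bounded operator `(N + c, 0)` and subtracting `c` recovers `𝔸`; subtracting `c` only shifts the
resolvent parameter. -/
theorem IsDiagonal.exists_positive_semigroup (h : S.IsDiagonal m q s)
    (hS : S.HasOutflowCoordinates s)
    (hN_real : ∀ e, ∀ᵐ x ∂(volume.restrict (Set.Icc 0 (G.ℓ e))), (S.N e x).HasRealEntries)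
    (hC_real : ∀ v, (S.matrixOf (S.C v)).HasRealEntries)
    (hP : ∀ v (ξ : G.VSpace v),
      G.posPart (S.Pd v ξ : G.VSpace v) = (S.Pd v (G.posPart ξ) : G.VSpace v))
    (hY : ∀ v, ∀ ξ ∈ S.Y v, G.posPart ξ ∈ S.Y v)
    (hN : ∀ e, ∀ᵐ x ∂(volume.restrict (Set.Icc 0 (G.ℓ e))), (S.N e x).HasNonnegOffDiag)
    (hBC : (∀ v, (S.matrixOf (S.BCP v)).HasNonnegEntries) ∨
      ((∀ v, S.B v = 0) ∧ ∀ v, (S.matrixOf (S.C v)).HasNonnegOffDiag)) :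
    ∃ T : C0Semigroup S.Space, T.IsGeneratedBy S.opGraph ∧ S.IsPositiveSemigroup T := by
  obtain ⟨c₁, hc₁⟩ := exists_isNonnegReal_shiftedBCP hC_real hP hBC
  obtain ⟨c₂, hc₂⟩ := exists_isNonnegReal_add_N hN_real hN
  -- One shift must serve both the vertex operator and `N`, since it has to cancel against a single
  -- multiple of the identity.
  set c := max c₁ c₂
  obtain ⟨P, hP0, hPf⟩ := S.exists_lowerOrder c
  have hPpos : ∀ U, S.IsNonneg U → S.IsNonneg (P U) := fun U hU => by
    refine ⟨fun e => ?_, fun v i => by rw [hP0]; exact Complex.IsNonnegReal.zero⟩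
    filter_upwards [hPf U e, hc₂ c (le_max_right _ _) e, hU.1 e] with x h1 h2 h3 i
    rw [h1]
    exact h2 _ h3 i
  obtain ⟨Q, κ, w₀, hQ, hdiss⟩ := h.exists_isQuasiDissipative hS (S.shiftedBCP c)
  obtain ⟨T, hT, hpos⟩ := exists_semigroup_of_perturbation hQ
    (isLinearGraph_transportGraph (S.shiftedBCP c)) hdiss isClosedCone_isNonneg
    (h.isResolvable hS hP hY _ (hc₁ c (le_max_left _ _))) P hPpos c
  refine ⟨T, ?_, hpos⟩
  have e1 : S.opGraph = fun U F => S.transportGraph m (S.shiftedBCP c) U (F + (c : ℂ) • U - P U) :=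
    funext fun U => funext fun F => propext (h.opGraph_iff hP0 hPf U F)
  rw [e1]
  exact hT

end Network.HypSystem
end

/-! ### The main theorem -/

theorem mainTheorem7 {V E : Type*} [Fintype V] [DecidableEq V] [Fintype E] [DecidableEq E]
    (G : Network V E) (S : G.HypSystem)
    -- real coefficients
    (hN_real : ∀ e, ∀ᵐ x ∂(volume.restrict (Set.Icc 0 (G.ℓ e))), (S.N e x).HasRealEntries)
    (hQ_real : ∀ e, ∀ᵐ x ∂(volume.restrict (Set.Icc 0 (G.ℓ e))), (S.Q e x).HasRealEntries)
    (hQv_real : ∀ v, (S.matrixOf (S.Qv v)).HasRealEntries)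
    (hB_real : ∀ v, (S.matrixOf (S.B v)).HasRealEntries)
    (hC_real : ∀ v, (S.matrixOf (S.C v)).HasRealEntries)
    -- diagonal coefficients
    (hM_diag : ∀ e, ∀ᵐ x ∂(volume.restrict (Set.Icc 0 (G.ℓ e))), (S.M e x).IsDiag)
    (hQ_diag : ∀ e, ∀ᵐ x ∂(volume.restrict (Set.Icc 0 (G.ℓ e))), (S.Q e x).IsDiag)
    (hQv_diag : ∀ v, (S.matrixOf (S.Qv v)).IsDiag)
    -- the projector onto the positive cone commutes with the projector onto `Y_v^{(d)}`
    (hP : ∀ v (ξ : G.VSpace v),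
      G.posPart (S.Pd v ξ : G.VSpace v) = (S.Pd v (G.posPart ξ) : G.VSpace v))
    -- `Y_v` and `Y_v^{(d)}` are lattice-closed
    (hY : ∀ v, ∀ ξ ∈ S.Y v, G.posPart ξ ∈ S.Y v)
    (hYd : ∀ v, ∀ y ∈ S.Yd v, G.posPart y ∈ S.Yd v)
    -- sign conditions
    (hN : ∀ e, ∀ᵐ x ∂(volume.restrict (Set.Icc 0 (G.ℓ e))), (S.N e x).HasNonnegOffDiag)
    (hBC : (∀ v, (S.matrixOf (S.BCP v)).HasNonnegEntries) ∨
      ((∀ v, S.B v = 0) ∧ ∀ v, (S.matrixOf (S.C v)).HasNonnegOffDiag)) :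
    (S.PrimalAssumption ∨ S.StrongAdjointAssumption →
      ∃ T : C0Semigroup S.Space, T.IsGeneratedBy S.opGraph) ∧
    (S.PrimalAssumption ∨ S.WeakAdjointAssumption →
      ∀ T : C0Semigroup S.Space, T.IsGeneratedBy S.opGraph → S.IsPositiveSemigroup T) := by
  obtain ⟨m, q, s, hd⟩ := Network.HypSystem.exists_isDiagonal hM_diag hQ_diag
  refine ⟨fun hW => ?_, fun _ T hT => ?_⟩
  · have hS : S.HasOutflowCoordinates s :=
      hW.elim hd.hasOutflowCoordinates_of_primal hd.hasOutflowCoordinates_of_strongAdjoint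
    obtain ⟨T, hT, -⟩ :=
      hd.exists_positive_semigroup hS hN_real hC_real hP hY hN hBC
    exact ⟨T, hT⟩
  -- The given semigroup supplies the outflow coordinates through its generator; the positive
  -- semigroup constructed from them has that same generator and so coincides with it.
  · obtain ⟨T', hT', hpos⟩ := hd.exists_positive_semigroup
      (hd.hasOutflowCoordinates_of_isGeneratedBy hT) hN_real hC_real hP hY hN hBC
    intro t U hU
    rw [hT.eq_of_dense hT']
    exact hpos t U hU
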